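/- **Model.** There are $n$ parties in a synchronous network with authenticated channels, and $\lambda$ is the security parameter. Values come from a finite set $V$ (it may depend on $\lambda$) with $|V|\ge 2$ and elements of $O(\lambda)$ bits; outputs lie in $V\cup\{\bot\}$. A protocol may use a trusted setup, digital signatures and threshold signatures (each of $\lambda$ bits, sent along with the signed statement), and private random coins. An adversary chooses the inputs and the common round in which all honest parties call $\mathsf{propose}$, corrupts parties (adaptively, or statically if it fixes the corrupt set at the beginning), sees the whole transcript, all outputs and terminations and the internal state of the corrupt parties, and chooses the messages of the corrupt parties after seeing those of the honest parties in the same round. In the *sabotaged* setting it moreover knows the entire setup and can forge every signature. In the *authenticated* setting the trusted setup is secret, and signatures and threshold signatures are perfectly unforgeable; with these ideal primitives no further computational restriction is put on the adversary. An adversary is $t$-bounded if at most $t$ parties are ever corrupt, and a party is (forever) honest if it is never corrupted. A Byzantine agreement (BA) protocol is authenticated (sabotaged) $t$-secure if in that setting the following hold, except with probability negligible in $\lambda$, for every $t$-bounded adversary: if all honest parties have the same input $v$, then all output $v$; no two honest parties output different values; and every honest party outputs and terminates within some number of rounds. Black-box access to $(\Pi,T_\Pi)$ means that $\Pi$ is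 $t$-secure in the respective setting and that, when all honest parties propose in the same round, all of them have produced outputs (satisfying the BA conditions) $T_\Pi$ rounds later, except with negligible probability. A compiler with such access sees only the outputs and terminations of the two protocols; it can start each of them at each party, with an input, and stop it. **Theorem.** Let $2t_i+t_s<n$ and $t_i\le t_s<n/2$, and let $T_{\mathsf{Auth}},T_{\mathsf{Sab}}$ be given. There is a deterministic compiler, which depends only on $n,t_s,t_i,\lambda,V,T_{\mathsf{Auth}},T_{\mathsf{Sab}}$, that turns black-box access to $(\mathsf{BA}_{\mathsf{Auth}},T_{\mathsf{Auth}})$, with $\mathsf{BA}_{\mathsf{Auth}}$ authenticated $t_s$-secure, and $(\mathsf{BA}_{\mathsf{Sab}},T_{\mathsf{Sab}})$, with $\mathsf{BA}_{\mathsf{Sab}}$ sabotaged $t_i$-secure, into a BA protocol $\mathsf{Juggernaut}$ that is authenticated $t_s$-secure and sabotaged $t_i$-secure, with round bound $T_{\mathsf{Auth}}+T_{\mathsf{Sab}}+O(1)$. Write $\mathsf{CC}_{\mathcal A}(\cdot)$ for the expected number of bits that honest parties send, under the adversary $\mathcal A$ against $\mathsf{Juggernaut}$, in $\mathsf{Juggernaut}$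 or in its instance of $\mathsf{BA}_{\mathsf{Auth}}$ or $\mathsf{BA}_{\mathsf{Sab}}$. The constants in $O(\cdot)$ depend only on the constant in the bound on the size of values, and: 1. Security is preserved for each type of corruption: if the two given protocols are secure against adaptive (static) adversaries, then so is $\mathsf{Juggernaut}$, and items 2–5 hold for adversaries of that type. 2. In the sabotaged setting, for $t_i$-bounded $\mathcal A$ and all $\lambda\ge1$, $\mathsf{CC}_{\mathcal A}(\mathsf{Juggernaut})\le\mathsf{CC}_{\mathcal A}(\mathsf{BA}_{\mathsf{Auth}})+\mathsf{CC}_{\mathcal A}(\mathsf{BA}_{\mathsf{Sab}})+O(\lambda n^2)$. 3. In the authenticated setting, for $t_s$-bounded $\mathcal A$, except with negligible probability, honest parties send at most $O(\lambda n^2)$ bits in $\mathsf{Juggernaut}$ in addition to those they send in $\mathsf{BA}_{\mathsf{Auth}}$. If the number of bits they send in $\mathsf{BA}_{\mathsf{Sab}}$ never exceeds some polynomial in $\lambda$, then also $\mathsf{CC}_{\mathcal A}(\mathsf{Juggernaut})\le\mathsf{CC}_{\mathcal A}(\mathsf{BA}_{\mathsf{Auth}})+O(\lambda n^2)$ for all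 sufficiently large $\lambda$. 4. In every execution all honest parties start $\mathsf{BA}_{\mathsf{Auth}}$ in one common round, a fixed number $O(1)$ of rounds after the start of $\mathsf{Juggernaut}$. 5. In the authenticated setting, for $t_s$-bounded $\mathcal A$, except with negligible probability: if $r$ is a round such that all parties honest at round $r$ have produced an output from $\mathsf{BA}_{\mathsf{Auth}}$ and terminated it, or such that some party honest at round $r$ has already quit its unfinished instance of $\mathsf{BA}_{\mathsf{Auth}}$, then all forever honest parties have produced an output from $\mathsf{Juggernaut}$ and terminated by round $r+O(1)$. -/

import Mathlib

open scoped BigOperators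

namespace CryptoAgnostic

/-! ### Messages, ideal signatures and threshold signatures -/

/-- An authentication token. `sig i s` is the signature of party `i` on the statement (bit string) `s`;
`cert m s` is the threshold signature obtained from signatures of `m` distinct parties on `s`. -/
inductive Token (n : ℕ) where
  | sig (signer : Fin n) (stmt : List Bool)
  | cert (threshold : ℕ) (stmt : List Bool)

/-- What is sent over one channel in one round for one key instance: a bit string with tokens. -/
structure Wire (n : ℕ) where
  body : List Bool
  tokens : List (Token n)

/-- Nothing is sent. -/
def Wire.silent (n : ℕ) : Wire n := ⟨[], []⟩

/-- Length in bits, for security parameter `κ`: a signature, and a threshold signature, takes `κ` bits,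
and the statement it authenticates is always sent along with it. -/
def Token.size {n : ℕ} (κ : ℕ) : Token n → ℕ
  | .sig _ s => κ + s.length
  | .cert _ s => κ + s.length

def Wire.size {n : ℕ} (κ : ℕ) (w : Wire n) : ℕ :=
  w.body.length + (w.tokens.map (Token.size κ)).sum

/-- The tokens that can be produced without forging, by someone who holds the signing keys of the
parties in `own` and has seen the tokens in `known`. -/
def Derivable {n : ℕ} (own : Finset (Fin n)) (known : Set (Token n)) : Token n → Prop
  | .sig i s => i ∈ own ∨ Token.sig i s ∈ known
  | .cert m s => Token.cert m s ∈ known ∨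
      ∃ S : Finset (Fin n), m ≤ S.card ∧ ∀ i ∈ S, i ∈ own ∨ Token.sig i s ∈ known

open Classical in
/-- Verification with perfectly secure primitives: tokens that cannot be derived are rejected. -/
noncomputable def Wire.verified {n : ℕ} (own : Finset (Fin n)) (known : Set (Token n)) (w : Wire n) :
    Wire n :=
  ⟨w.body, w.tokens.filter fun t => decide (Derivable own known t)⟩

/-! ### Protocols -/

/-- A synchronous protocol for `n` parties with inputs in `V` and outputs in `V ∪ {⊥}`
(`Option V`, with `none` for `⊥`).

`K` indexes independent key instances (separate signing keys for separate sub-protocols).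
A trusted dealer draws a uniform element of `Setup`, publishes `pub` and hands `priv i` to party `i`.
In every round a running party draws a fresh uniform coin, sends a message to every party and moves
to a new state after receiving the messages of the round. `out` tells whether an output has been
produced and `halt` whether the party terminates. -/
structure Protocol (n : ℕ) (V : Type) where
  K : Type
  Setup : Type
  Pub : Type
  Priv : Type
  Coin : Type
  State : Type
  [fintypeK : Fintype K]
  [fintypeSetup : Fintype Setup]
  [nonemptySetup : Nonempty Setup]
  [fintypeCoin : Fintype Coin]
  [nonemptyCoin : Nonempty Coin]
  pub : Setup → Pub
  priv : Setup → Fin n → Priv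
  init : Fin n → Priv → V → State
  send : Fin n → State → Coin → Fin n → K → Wire n
  recv : Fin n → State → Coin → (Fin n → K → Wire n) → State
  out : State → Option (Option V)
  halt : State → Bool

attribute [instance] Protocol.fintypeK Protocol.fintypeSetup Protocol.nonemptySetup
  Protocol.fintypeCoin Protocol.nonemptyCoin

variable {n : ℕ} {V : Type}

/-- The externally visible status of a protocol instance at one party. -/
structure Status (V : Type) where
  out : Option (Option V)
  halted : Bool

/-- An output has been produced and the instance has terminated. -/
def Status.Done (s : Status V) : Prop := s.out.isSome = true ∧ s.halted = true

/-- A protocol instance at one party: `st = none` before the start. -/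
structure Inst (P : Protocol n V) where
  st : Option P.State
  status : Status V

def Inst.idle (P : Protocol n V) : Inst P := ⟨none, ⟨none, false⟩⟩

/-- The party calls `propose v`. -/
def Inst.propose (P : Protocol n V) (i : Fin n) (p : P.Priv) (v : V) : Inst P :=
  ⟨some (P.init i p v), ⟨P.out (P.init i p v), P.halt (P.init i p v)⟩⟩

/-- The messages of a round; an instance that is not started or has terminated is silent. -/
def Inst.send {P : Protocol n V} (i : Fin n) (x : Inst P) (coin : P.Coin) (j : Fin n) (a : P.K) :
    Wire n :=
  match x.st, x.status.halted with
  | some s, false => P.send i s coin j a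
  | _, _ => Wire.silent n

/-- End of a round. The first output is final, and so is termination. -/
def Inst.recv {P : Protocol n V} (i : Fin n) (x : Inst P) (coin : P.Coin)
    (inbox : Fin n → P.K → Wire n) : Inst P :=
  match x.st, x.status.halted with
  | some s, false =>
    ⟨some (P.recv i s coin inbox),
      ⟨x.status.out.or (P.out (P.recv i s coin inbox)), P.halt (P.recv i s coin inbox)⟩⟩
  | _, _ => x

/-! ### Adversaries and executions -/

/-- The setting chosen by the adversary. -/
inductive Setting where
  | sabotaged
  | authenticated

/-- Static or adaptive corruption. -/
inductive Corruption where
  | static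
  | adaptive

/-- The transcript of one round: corrupt parties, statuses and all messages `msgs sender receiver`. -/
structure Record (P : Protocol n V) where
  corrupt : Finset (Fin n)
  status : Fin n → Status V
  msgs : Fin n → Fin n → P.K → Wire n

/-- A global configuration. `hist` lists the past rounds, newest first. The local state of a party
is frozen when the party is corrupted. -/
structure Config (P : Protocol n V) where
  loc : Fin n → Inst P
  inp : Fin n → Option V
  corrupt : Finset (Fin n)
  hist : List (Record P)

def Config.start (P : Protocol n V) : Config P :=
  ⟨fun _ => Inst.idle P, fun _ => none, ∅, []⟩

/-- What the adversary sees: the public part of the setup (and, in the sabotaged setting, all of the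
setup), the complete transcript, inputs, outputs and terminations, and the private setup string and
local state of every corrupt party. -/
structure View (P : Protocol n V) where
  pub : P.Pub
  leak : Option P.Setup
  hist : List (Record P)
  inp : Fin n → Option V
  status : Fin n → Status V
  corrupt : Finset (Fin n)
  inner : Fin n → Option (P.Priv × Inst P)

def Config.view {P : Protocol n V} (m : Setting) (σ : P.Setup) (c : Config P) : View P where
  pub := P.pub σ
  leak := match m with
    | .sabotaged => some σ
    | .authenticated => none
  hist := c.hist
  inp := c.inp
  status := fun i => (c.loc i).status
  corrupt := c.corrupt
  inner := fun i => if i ∈ c.corrupt then some (P.priv σ i, c.loc i) else none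

/-- An adversary. All honest parties call `propose` in round `start`, with inputs of the adversary's
choice. At the beginning of a round it corrupts parties; then, having seen the messages sent by honest
parties in this round, it chooses the messages of the corrupt ones. There is no
bound on its computations: in the authenticated setting its only limitation is that it cannot
forge signatures and does not see the secrets of honest parties. -/
structure Adversary (P : Protocol n V) where
  start : ℕ
  corrupt : View P → Finset (Fin n)
  input : View P → Fin n → V
  attack : View P → (Fin n → Fin n → P.K → Wire n) → Fin n → Fin n → P.K → Wire n

/-- The beginning of a round: new corruptions and, in round `start`, the inputs. -/
def beginRound {P : Protocol n V} (A : Adversary P) (m : Setting) (σ : P.Setup) (c : Config P) :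
    Config P :=
  let d : Config P := { c with corrupt := c.corrupt ∪ A.corrupt (c.view m σ) }
  if d.hist.length = A.start then
    { d with
      inp := fun i => if i ∈ d.corrupt then none else some (A.input (d.view m σ) i)
      loc := fun i => if i ∈ d.corrupt then d.loc i
        else Inst.propose P i (P.priv σ i) (A.input (d.view m σ) i) }
  else d

/-- The tokens of key instance `a` received by party `i` in past rounds. -/
def tokensReceived {P : Protocol n V} (h : List (Record P)) (i : Fin n) (a : P.K) : Set (Token n) :=
  {t | ∃ R ∈ h, ∃ j, t ∈ (R.msgs j i a).tokens}

/-- The tokens of key instance `a` sent in past rounds, or occurring in `hm`. -/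
def tokensSent {P : Protocol n V} (h : List (Record P)) (hm : Fin n → Fin n → P.K → Wire n)
    (a : P.K) : Set (Token n) :=
  {t | (∃ R ∈ h, ∃ i j, t ∈ (R.msgs i j a).tokens) ∨ ∃ i j, t ∈ (hm i j a).tokens}

/-- The messages of the honest parties in a round. -/
noncomputable def honestMsgs {P : Protocol n V} (d : Config P) (coin : Fin n → P.Coin) :
    Fin n → Fin n → P.K → Wire n := fun i j a =>
  if i ∈ d.corrupt then Wire.silent n
  else ((d.loc i).send i (coin i) j a).verified {i} (tokensReceived d.hist i a)

/-- All messages of a round. In the sabotaged setting the adversary can forge every token. -/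
noncomputable def roundMsgs {P : Protocol n V} (A : Adversary P) (m : Setting) (σ : P.Setup)
    (d : Config P) (coin : Fin n → P.Coin) : Fin n → Fin n → P.K → Wire n := fun i j a =>
  if i ∈ d.corrupt then
    match m with
    | .sabotaged => A.attack (d.view m σ) (honestMsgs d coin) i j a
    | .authenticated => (A.attack (d.view m σ) (honestMsgs d coin) i j a).verified d.corrupt
        (tokensSent d.hist (honestMsgs d coin) a)
  else honestMsgs d coin i j a

/-- The rest of a round: all messages are sent and delivered, and honest parties update. -/
noncomputable def endRound {P : Protocol n V} (A : Adversary P) (m : Setting) (σ : P.Setup)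
    (coin : Fin n → P.Coin) (d : Config P) : Config P :=
  { d with
    loc := fun i => if i ∈ d.corrupt then d.loc i
      else (d.loc i).recv i (coin i) (fun j a => roundMsgs A m σ d coin j i a)
    hist := ⟨d.corrupt, fun i => (d.loc i).status, roundMsgs A m σ d coin⟩ :: d.hist }

/-- The randomness of an execution of `H` rounds, always drawn uniformly: the randomness of the setup
and one coin per party and round. -/
abbrev Randomness (P : Protocol n V) (H : ℕ) : Type := P.Setup × (Fin n → Fin H → P.Coin)

noncomputable def Randomness.coin {P : Protocol n V} {H : ℕ} (ω : Randomness P H) (r : ℕ) (i : Fin n) : P.Coin :=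
  if h : r < H then ω.2 i ⟨r, h⟩ else Classical.arbitrary P.Coin

/-- The configuration after `r` rounds. -/
noncomputable def conf {P : Protocol n V} (A : Adversary P) (m : Setting) {H : ℕ} (ω : Randomness P H) :
    ℕ → Config P
  | 0 => Config.start P
  | r + 1 => endRound A m ω.1 (ω.coin r) (beginRound A m ω.1 (conf A m ω r))

/-- The configuration in which round `r` is executed (rounds are numbered from `0`);
its set of corrupt parties is the set of parties corrupt at round `r`. -/
noncomputable def during {P : Protocol n V} (A : Adversary P) (m : Setting) {H : ℕ} (ω : Randomness P H)
    (r : ℕ) : Config P :=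
  beginRound A m ω.1 (conf A m ω r)

/-- At most `t` parties are ever corrupt in the first `H` rounds, and a static adversary never changes
the set of corrupt parties it chose at the beginning. -/
def Admissible {P : Protocol n V} (A : Adversary P) (m : Setting) (q : Corruption) (t H : ℕ) : Prop :=
  ∀ ω : Randomness P H, (conf A m ω H).corrupt.card ≤ t ∧
    (q = .static → ∀ r < H, (during A m ω r).corrupt = (during A m ω 0).corrupt)

/-! ### Probability, expectation, communication -/

open Classical in
/-- Probability under the uniform distribution on a finite type. -/
noncomputable def prob {Ω : Type} [Fintype Ω] (E : Ω → Prop) : ℝ :=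
  𝔼 ω : Ω, (if E ω then (1 : ℝ) else 0)

/-- A function of the security parameter is negligible if it decays faster than every inverse
polynomial. -/
def Negligible (f : ℕ → ℝ) : Prop :=
  Asymptotics.SuperpolynomialDecay Filter.atTop (fun κ : ℕ => (κ : ℝ)) f

open Classical in
/-- The number of bits sent by honest parties within the key instances in `S`. -/
noncomputable def Config.bits {P : Protocol n V} (κ : ℕ) (S : Set P.K) (c : Config P) : ℕ :=
  (c.hist.map fun R => ∑ i : Fin n, if i ∈ R.corrupt then 0 else
    ∑ j : Fin n, ∑ a : P.K, if a ∈ S then (R.msgs i j a).size κ else 0).sum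

/-- Bits sent by honest parties within the key instances in `S` in an execution of `H` rounds. -/
noncomputable def bits {P : Protocol n V} (κ : ℕ) (A : Adversary P) (m : Setting) {H : ℕ}
    (S : Set P.K) (ω : Randomness P H) : ℕ :=
  (conf A m ω H).bits κ S

/-- Expected communication complexity in bits under the adversary `A`. -/
noncomputable def expectedBits {P : Protocol n V} (κ : ℕ) (A : Adversary P) (m : Setting) (H : ℕ)
    (S : Set P.K) : ℝ :=
  𝔼 ω : Randomness P H, (bits κ A m S ω : ℝ)

/-! ### Byzantine agreement

Protocols come as families indexed by the security parameter. Honest parties in an execution of `H`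
rounds are those that are never corrupted in it. -/

/-- Except with negligible probability: `T` rounds after the start (or later), if all honest parties
have the same input `v`, then all of them have output `v`. -/
def ValidBy (m : Setting) (q : Corruption) (t : ℕ) {V : ℕ → Type} (P : ∀ κ, Protocol n (V κ))
    (T : ℕ → ℕ) : Prop :=
  ∀ (A : ∀ κ, Adversary (P κ)) (H : ℕ → ℕ), (∀ κ, Admissible (A κ) m q t (H κ)) →
    Negligible fun κ => prob fun ω : Randomness (P κ) (H κ) => (A κ).start + T κ ≤ H κ ∧
      ∃ v : V κ, (∀ i ∉ (conf (A κ) m ω (H κ)).corrupt, (conf (A κ) m ω (H κ)).inp i = some v) ∧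
        ∃ i ∉ (conf (A κ) m ω (H κ)).corrupt,
          ((conf (A κ) m ω (H κ)).loc i).status.out ≠ some (some v)

/-- Except with negligible probability, no two honest parties have different outputs. -/
def Consistent (m : Setting) (q : Corruption) (t : ℕ) {V : ℕ → Type}
    (P : ∀ κ, Protocol n (V κ)) : Prop :=
  ∀ (A : ∀ κ, Adversary (P κ)) (H : ℕ → ℕ), (∀ κ, Admissible (A κ) m q t (H κ)) →
    Negligible fun κ => prob fun ω : Randomness (P κ) (H κ) =>
      ∃ i ∉ (conf (A κ) m ω (H κ)).corrupt, ∃ j ∉ (conf (A κ) m ω (H κ)).corrupt,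
        ∃ v w : Option (V κ), ((conf (A κ) m ω (H κ)).loc i).status.out = some v ∧
          ((conf (A κ) m ω (H κ)).loc j).status.out = some w ∧ v ≠ w

/-- Except with negligible probability, all honest parties have produced an output `T` rounds after the
start. -/
def OutputBy (m : Setting) (q : Corruption) (t : ℕ) {V : ℕ → Type} (P : ∀ κ, Protocol n (V κ))
    (T : ℕ → ℕ) : Prop :=
  ∀ (A : ∀ κ, Adversary (P κ)) (H : ℕ → ℕ), (∀ κ, Admissible (A κ) m q t (H κ)) →
    Negligible fun κ => prob fun ω : Randomness (P κ) (H κ) => (A κ).start + T κ ≤ H κ ∧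
      ∃ i ∉ (conf (A κ) m ω (H κ)).corrupt,
        ((conf (A κ) m ω ((A κ).start + T κ)).loc i).status.out = none

/-- Except with negligible probability, all honest parties have produced an output and terminated
`T` rounds after the start. -/
def TerminatingBy (m : Setting) (q : Corruption) (t : ℕ) {V : ℕ → Type} (P : ∀ κ, Protocol n (V κ))
    (T : ℕ → ℕ) : Prop :=
  ∀ (A : ∀ κ, Adversary (P κ)) (H : ℕ → ℕ), (∀ κ, Admissible (A κ) m q t (H κ)) →
    Negligible fun κ => prob fun ω : Randomness (P κ) (H κ) => (A κ).start + T κ ≤ H κ ∧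
      ∃ i ∉ (conf (A κ) m ω (H κ)).corrupt,
        ¬ ((conf (A κ) m ω ((A κ).start + T κ)).loc i).status.Done

/-- `t`-valid, `t`-consistent and `t`-terminating, with round bound `T`. -/
def SecureBy (m : Setting) (q : Corruption) (t : ℕ) {V : ℕ → Type} (P : ∀ κ, Protocol n (V κ))
    (T : ℕ → ℕ) : Prop :=
  ValidBy m q t P T ∧ Consistent m q t P ∧ TerminatingBy m q t P T

/-- A `t`-secure Byzantine agreement protocol. -/
def Secure (m : Setting) (q : Corruption) (t : ℕ) {V : ℕ → Type} (P : ∀ κ, Protocol n (V κ)) : Prop :=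
  ∃ T : ℕ → ℕ, SecureBy m q t P T

/-- The guarantee for a given pair `(P, T)`: `P` is `t`-secure, and if all honest parties propose in the
same round, then `T` rounds later all of them have produced outputs, which satisfy the conditions of
Byzantine agreement, except with negligible probability. -/
def BlackBox (m : Setting) (q : Corruption) (t : ℕ) {V : ℕ → Type} (P : ∀ κ, Protocol n (V κ))
    (T : ℕ → ℕ) : Prop :=
  Secure m q t P ∧ OutputBy m q t P T ∧ ValidBy m q t P T ∧ Consistent m q t P

/-! ### Black-box compilers -/

/-- A deterministic program that uses two Byzantine agreement instances as black boxes: at the end of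
each round it sees only the outputs and terminations of the two local instances, and it can
start each instance once, with an input, and stop it for good. It has signing keys of its own. -/
structure Host (n : ℕ) (V : Type) where
  State : Type
  init : Fin n → V → State
  send : Fin n → State → Fin n → Wire n
  recv : Fin n → State → (Fin n → Wire n) → Status V → Status V → State
  out : State → Option (Option V)
  halt : State → Bool
  startAuth : State → Option V
  stopAuth : State → Bool
  startSab : State → Option V
  stopSab : State → Bool

/-- A local instance under the control of a host. -/
structure Slot (P : Protocol n V) where
  inst : Inst P
  stopped : Bool

def Slot.send {P : Protocol n V} (i : Fin n) (x : Slot P) (coin : P.Coin) (j : Fin n) (a : P.K) :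
    Wire n :=
  if x.stopped then Wire.silent n else x.inst.send i coin j a

def Slot.recv {P : Protocol n V} (i : Fin n) (x : Slot P) (coin : P.Coin)
    (inbox : Fin n → P.K → Wire n) : Slot P :=
  if x.stopped then x else ⟨x.inst.recv i coin inbox, false⟩

/-- The commands of the host: start with the given input, stop. -/
def Slot.command {P : Protocol n V} (i : Fin n) (p : P.Priv) (go : Option V) (quit : Bool)
    (x : Slot P) : Slot P :=
  match x.inst.st, x.stopped, go with
  | none, false, some v => ⟨Inst.propose P i p v, quit⟩
  | _, _, _ => ⟨x.inst, x.stopped || quit⟩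

structure CompiledState (h : Host n V) (P Q : Protocol n V) where
  host : h.State
  privAuth : P.Priv
  privSab : Q.Priv
  auth : Slot P
  sab : Slot Q

/-- Carry out the commands issued in the current state of the host. -/
def CompiledState.commands {h : Host n V} {P Q : Protocol n V} (i : Fin n)
    (s : CompiledState h P Q) : CompiledState h P Q :=
  { s with
    auth := s.auth.command i s.privAuth (h.startAuth s.host) (h.stopAuth s.host)
    sab := s.sab.command i s.privSab (h.startSab s.host) (h.stopSab s.host) }

/-- The compiled protocol: the host together with `P` (authenticated) and `Q` (sabotaged). -/
def compile (h : Host n V) (P Q : Protocol n V) : Protocol n V where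
  K := Unit ⊕ (P.K ⊕ Q.K)
  Setup := P.Setup × Q.Setup
  Pub := P.Pub × Q.Pub
  Priv := P.Priv × Q.Priv
  Coin := P.Coin × Q.Coin
  State := CompiledState h P Q
  pub := fun σ => (P.pub σ.1, Q.pub σ.2)
  priv := fun σ i => (P.priv σ.1 i, Q.priv σ.2 i)
  init := fun i p v => CompiledState.commands i
    { host := h.init i v
      privAuth := p.1
      privSab := p.2
      auth := ⟨Inst.idle P, false⟩
      sab := ⟨Inst.idle Q, false⟩ }
  send := fun i s coin j a => match a with
    | .inl _ => h.send i s.host j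
    | .inr (.inl b) => s.auth.send i coin.1 j b
    | .inr (.inr b) => s.sab.send i coin.2 j b
  recv := fun i s coin inbox =>
    let x := s.auth.recv i coin.1 fun j b => inbox j (.inr (.inl b))
    let y := s.sab.recv i coin.2 fun j b => inbox j (.inr (.inr b))
    CompiledState.commands i
      { s with
        host := h.recv i s.host (fun j => inbox j (.inl ())) x.inst.status y.inst.status
        auth := x
        sab := y }
  out := fun s => h.out s.host
  halt := fun s => h.halt s.host

/-- The key instances used by the authenticated protocol inside the compiled one. -/
def authPart (h : Host n V) (P Q : Protocol n V) : Set (compile h P Q).K :=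
  {a | ∃ b : P.K, a = (Sum.inr (Sum.inl b) : Unit ⊕ (P.K ⊕ Q.K))}

/-- The key instances used by the sabotaged protocol inside the compiled one. -/
def sabPart (h : Host n V) (P Q : Protocol n V) : Set (compile h P Q).K :=
  {a | ∃ b : Q.K, a = (Sum.inr (Sum.inr b) : Unit ⊕ (P.K ⊕ Q.K))}

/-- Party `i` has started its instance of the authenticated protocol. -/
def AuthStarted {h : Host n V} {P Q : Protocol n V} (c : Config (compile h P Q)) (i : Fin n) : Prop :=
  ∃ s : CompiledState h P Q, (c.loc i).st = some s ∧ s.auth.inst.st.isSome = true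

/-- Party `i` has produced an output from the authenticated protocol and terminated it. -/
def AuthDone {h : Host n V} {P Q : Protocol n V} (c : Config (compile h P Q)) (i : Fin n) : Prop :=
  ∃ s : CompiledState h P Q, (c.loc i).st = some s ∧ s.auth.inst.status.Done

/-- Party `i` started the authenticated protocol, and quit it before it was done. -/
def AuthAbandoned {h : Host n V} {P Q : Protocol n V} (c : Config (compile h P Q)) (i : Fin n) : Prop :=
  ∃ s : CompiledState h P Q, (c.loc i).st = some s ∧ s.auth.inst.st.isSome = true ∧
    ¬ s.auth.inst.status.Done ∧ (s.auth.stopped = true ∨ (c.loc i).status.halted = true)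

end CryptoAgnostic

open CryptoAgnostic

/-! The compiler. In round 0 every party signs its input. A party that receives `n - ti` signatures
on one value calls this value strong and circulates a threshold signature on it in round 1; a
certified value replaces the own input to the authenticated protocol, which starts in round 2. The
output of that protocol, overridden by a strong value, is the candidate of the party. Candidates
then pass through the stages relay, quorum, vote and commit with threshold `n - ts`. A party votes
only after it has circulated its own quorum certificate, and only if no conflicting certificate has
arrived. With `n - ts` commitments in time it decides and leaves. A party that is left over locks a
value with `ti + 1` commitments, enters the sabotaged protocol with a value that has `ti + 1` votes
(otherwise with its candidate), and finally outputs its lock or, without one, what the sabotaged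
protocol returned.

Authenticated setting, at most `ts` corruptions. Certificates are genuine (`sound`). Two sets of `n
- ti` signers have at least `n - 2 * ti > ts` common members, hence an honest one; so a strong value
is everybody's input to the authenticated protocol (`authInput_of_strong`), and by validity also its
output. Therefore all candidates agree (`exists_candidates`), and four rounds later everybody has
decided (`Rounds.Follows.decision_of_candidates`). This is before the sabotaged protocol would
start, so that protocol stays silent.

Sabotaged setting, at most `ti` corruptions. Certificates may be forged, but a signature that
arrives from the signer itself is protected by the channel, and the counts use only such signatures.
Forged certificates can spoil inputs to the authenticated protocol and prevent votes, yet honest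
votes never differ (`vote_unique`), nor do commitments (`commit_unique`). If somebody decides early,
at least `n - ts - ti > ti` honest commitments stand behind this, and all others lock the same value
(`lock_of_decision`). If nobody does, all honest parties run the sabotaged protocol, and a locked
value is their common input (`sabInput_of_lock`). Unanimous inputs are strong for everybody, so all
candidates equal the common input.

Using the given protocols. Their guarantees speak of adversaries against them alone, so an adversary
against the compiled protocol `J` has to be turned into one against the inner protocol `P`. The
randomness of `J` outside `P` is fixed by averaging. For each value of the randomness of `P`, a
scripted adversary repeats what happens to `P` inside `J` (`Embedding.script`, `Embedding.tracks`).
Its choices turn out to depend only on what it sees, since all of `J` but the secrets of honest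
parties in `P` can be recomputed from its view (`Embedding.sim_conf`); hence the scripts merge into
a single adversary (`exists_adversary_of_family`). The comparison is valid while no honest party
abandons an unfinished instance of `P` (`Embedding.Live`). The outcome is
`Embedding.negligible_broken`: `P` works in live executions of `J`, except with negligible
probability. Outside that event all arguments about the compiler are combinatorial. -/

namespace CryptoAgnostic

section

variable {n : ℕ} {V : Type} {P : Protocol n V}

/-! ### Executions -/

section Rounds

variable (A : Adversary P) (m : Setting) (σ : P.Setup) (c : Config P)

/-- The corruptions at the beginning of a round. -/
def corruptRound : Config P := { c with corrupt := c.corrupt ∪ A.corrupt (c.view m σ) }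

theorem beginRound_eq : beginRound A m σ c =
    if c.hist.length = A.start then
      { corruptRound A m σ c with
        inp := fun i => if i ∈ (corruptRound A m σ c).corrupt then none
          else some (A.input ((corruptRound A m σ c).view m σ) i)
        loc := fun i => if i ∈ (corruptRound A m σ c).corrupt then c.loc i
          else Inst.propose P i (P.priv σ i) (A.input ((corruptRound A m σ c).view m σ) i) }
    else corruptRound A m σ c := rfl

theorem beginRound_of_ne (h : c.hist.length ≠ A.start) :
    beginRound A m σ c = corruptRound A m σ c := by
  rw [beginRound_eq, if_neg h]

theorem beginRound_corrupt :
    (beginRound A m σ c).corrupt = c.corrupt ∪ A.corrupt (c.view m σ) := by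
  rw [beginRound_eq]; split_ifs <;> rfl

theorem beginRound_hist : (beginRound A m σ c).hist = c.hist := by
  rw [beginRound_eq]; split_ifs <;> rfl

theorem beginRound_loc_of_mem {i : Fin n} (h : i ∈ (beginRound A m σ c).corrupt) :
    (beginRound A m σ c).loc i = c.loc i := by
  rw [beginRound_corrupt] at h
  rw [beginRound_eq]; split_ifs
  · exact if_pos h
  · rfl

end Rounds

section Runs

variable (A : Adversary P) (m : Setting) {H : ℕ} (ω : Randomness P H)

theorem conf_succ (r : ℕ) :
    conf A m ω (r + 1) = endRound A m ω.1 (ω.coin r) (during A m ω r) := rfl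

theorem conf_hist_length (r : ℕ) : (conf A m ω r).hist.length = r := by
  induction r with
  | zero => rfl
  | succ r ih =>
    change (beginRound A m ω.1 (conf A m ω r)).hist.length + 1 = r + 1
    rw [beginRound_hist, ih]

theorem during_hist (r : ℕ) : (during A m ω r).hist = (conf A m ω r).hist := beginRound_hist ..

theorem during_hist_length (r : ℕ) : (during A m ω r).hist.length = r := by
  rw [during_hist, conf_hist_length]

theorem conf_succ_corrupt (r : ℕ) :
    (conf A m ω (r + 1)).corrupt = (during A m ω r).corrupt := rfl

theorem conf_corrupt_subset_during (r : ℕ) :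
    (conf A m ω r).corrupt ⊆ (during A m ω r).corrupt := by
  rw [during, beginRound_corrupt]; exact Finset.subset_union_left

theorem conf_corrupt_mono {r s : ℕ} (h : r ≤ s) :
    (conf A m ω r).corrupt ⊆ (conf A m ω s).corrupt := by
  induction s, h using Nat.le_induction with
  | base => exact subset_rfl
  | succ s _ ih => exact ih.trans (conf_corrupt_subset_during A m ω s)

theorem during_corrupt_subset_conf {r s : ℕ} (h : r < s) :
    (during A m ω r).corrupt ⊆ (conf A m ω s).corrupt :=
  conf_corrupt_mono A m ω (Nat.succ_le_of_lt h)

theorem during_loc_of_mem {r : ℕ} {i : Fin n} (h : i ∈ (during A m ω r).corrupt) :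
    (during A m ω r).loc i = (conf A m ω r).loc i :=
  beginRound_loc_of_mem _ _ _ _ h

theorem during_loc_of_ne {r : ℕ} (h : r ≠ A.start) (i : Fin n) :
    (during A m ω r).loc i = (conf A m ω r).loc i := by
  rw [during, beginRound_of_ne _ _ _ _ (by rwa [conf_hist_length])]; rfl

theorem during_inp_of_ne {r : ℕ} (h : r ≠ A.start) :
    (during A m ω r).inp = (conf A m ω r).inp := by
  rw [during, beginRound_of_ne _ _ _ _ (by rwa [conf_hist_length])]; rfl

theorem during_start {i : Fin n} (h : i ∉ (during A m ω A.start).corrupt) :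
    ∃ v, (during A m ω A.start).inp i = some v ∧
      (during A m ω A.start).loc i = Inst.propose P i (P.priv ω.1 i) v ∧
      v = A.input ((corruptRound A m ω.1 (conf A m ω A.start)).view m ω.1) i := by
  have h' : i ∉ (corruptRound A m ω.1 (conf A m ω A.start)).corrupt := by
    rwa [during, beginRound_corrupt] at h
  rw [during, beginRound_eq, if_pos (conf_hist_length ..)]
  exact ⟨_, if_neg h', if_neg h', rfl⟩

theorem conf_succ_inp (r : ℕ) : (conf A m ω (r + 1)).inp = (during A m ω r).inp := rfl

theorem conf_succ_loc_of_mem {r : ℕ} {i : Fin n} (h : i ∈ (during A m ω r).corrupt) :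
    (conf A m ω (r + 1)).loc i = (conf A m ω r).loc i := by
  rw [conf_succ, endRound, ← during_loc_of_mem _ _ _ h]; exact if_pos h

/-- The messages of round `r`, indexed by sender and receiver. -/
noncomputable def msgsAt (r : ℕ) : Fin n → Fin n → P.K → Wire n :=
  roundMsgs A m ω.1 (during A m ω r) (ω.coin r)

theorem conf_succ_hist (r : ℕ) : (conf A m ω (r + 1)).hist =
    ⟨(during A m ω r).corrupt, fun i => ((during A m ω r).loc i).status, msgsAt A m ω r⟩ ::
      (conf A m ω r).hist := by
  rw [conf_succ, ← during_hist]; rfl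

theorem conf_succ_loc {r : ℕ} {i : Fin n} (h : i ∉ (during A m ω r).corrupt) :
    (conf A m ω (r + 1)).loc i =
      ((during A m ω r).loc i).recv i (ω.coin r i) (fun j a => msgsAt A m ω r j i a) :=
  if_neg h

theorem conf_loc_of_le_start {r : ℕ} (h : r ≤ A.start) (i : Fin n) :
    (conf A m ω r).loc i = Inst.idle P := by
  induction r with
  | zero => rfl
  | succ r ih =>
    by_cases hi : i ∈ (during A m ω r).corrupt
    · rw [conf_succ_loc_of_mem _ _ _ hi, ih (by omega)]
    · rw [conf_succ_loc _ _ _ hi, during_loc_of_ne _ _ _ (by omega), ih (by omega)]; rfl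

theorem conf_inp_of_le_start {r : ℕ} (h : r ≤ A.start) :
    (conf A m ω r).inp = fun _ => none := by
  induction r with
  | zero => rfl
  | succ r ih => rw [conf_succ_inp, during_inp_of_ne _ _ _ (by omega), ih (by omega)]

theorem conf_inp_of_lt {r : ℕ} (h : A.start < r) :
    (conf A m ω r).inp = (during A m ω A.start).inp := by
  induction r, Nat.succ_le_of_lt h using Nat.le_induction with
  | base => rfl
  | succ r hr ih =>
    have hr' : A.start < r := hr
    rw [conf_succ_inp, during_inp_of_ne _ _ _ (by omega), ih hr']

theorem mem_conf_hist {r : ℕ} {R : Record P} : R ∈ (conf A m ω r).hist ↔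
    ∃ k < r, R = ⟨(during A m ω k).corrupt, fun i => ((during A m ω k).loc i).status,
      msgsAt A m ω k⟩ := by
  induction r with
  | zero => simp [conf, Config.start]
  | succ r ih =>
    rw [conf_succ_hist, List.mem_cons, ih]
    constructor
    · rintro (h | ⟨k, hk, h⟩)
      · exact ⟨r, by omega, h⟩
      · exact ⟨k, by omega, h⟩
    · rintro ⟨k, hk, h⟩
      obtain rfl | hk := eq_or_lt_of_le (Nat.le_of_lt_succ hk)
      · exact .inl h
      · exact .inr ⟨k, hk, h⟩

theorem mem_tokensReceived {r : ℕ} {i : Fin n} {a : P.K} {t : Token n} :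
    t ∈ tokensReceived (conf A m ω r).hist i a ↔
      ∃ k < r, ∃ j, t ∈ (msgsAt A m ω k j i a).tokens := by
  simp only [tokensReceived, Set.mem_ofPred_eq, mem_conf_hist]
  constructor
  · rintro ⟨R, ⟨k, hk, rfl⟩, j, h⟩; exact ⟨k, hk, j, h⟩
  · rintro ⟨k, hk, j, h⟩; exact ⟨_, ⟨k, hk, rfl⟩, j, h⟩

theorem msgsAt_of_notMem {r : ℕ} {i : Fin n} (h : i ∉ (during A m ω r).corrupt) (j : Fin n)
    (a : P.K) : msgsAt A m ω r i j a =
      (((during A m ω r).loc i).send i (ω.coin r i) j a).verified {i}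
        (tokensReceived (conf A m ω r).hist i a) := by
  simp only [msgsAt, roundMsgs, honestMsgs, if_neg h, during_hist]

end Runs

/-! ### Local instances -/

theorem Inst.recv_status_out {x : Inst P} {i : Fin n} {coin : P.Coin} {inbox} {o : Option V}
    (h : x.status.out = some o) : (x.recv i coin inbox).status.out = some o := by
  unfold Inst.recv; split <;> simp [h]

theorem Inst.recv_of_halted {x : Inst P} {i : Fin n} {coin : P.Coin} {inbox}
    (h : x.status.halted = true) : x.recv i coin inbox = x := by
  unfold Inst.recv; split <;> simp_all

theorem Inst.send_of_halted {x : Inst P} {i : Fin n} {coin : P.Coin}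
    (h : x.status.halted = true) : x.send i coin = fun _ _ => Wire.silent n := by
  funext j a; unfold Inst.send; split <;> simp_all

theorem Inst.recv_st_isSome (x : Inst P) (i : Fin n) (coin : P.Coin) (inbox) :
    (x.recv i coin inbox).st.isSome = x.st.isSome := by
  unfold Inst.recv; split <;> simp_all

theorem Inst.recv_idle (i : Fin n) (coin : P.Coin) (inbox) :
    (Inst.idle P).recv i coin inbox = Inst.idle P := rfl

theorem Inst.send_idle (i : Fin n) (coin : P.Coin) :
    (Inst.idle P).send i coin = fun _ _ => Wire.silent n := rfl

theorem conf_out_mono (A : Adversary P) (m : Setting) {H : ℕ} (ω : Randomness P H) {r s : ℕ}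
    (h : r ≤ s) (hr : A.start < r) {i : Fin n} {o : Option V}
    (ho : ((conf A m ω r).loc i).status.out = some o) :
    ((conf A m ω s).loc i).status.out = some o := by
  induction s, h using Nat.le_induction with
  | base => exact ho
  | succ s hs ih =>
    by_cases hi : i ∈ (during A m ω s).corrupt
    · rwa [conf_succ_loc_of_mem _ _ _ hi]
    · rw [conf_succ_loc _ _ _ hi, during_loc_of_ne _ _ _ (by omega)]
      exact Inst.recv_status_out ih

end

section

variable {n : ℕ} {V : Type} {P : Protocol n V}

/-! ### What an adversary sees, and adversaries given by scripts -/

section Views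

variable {A A' : Adversary P} {m : Setting} {H : ℕ} {ω ω' : Randomness P H}

/-- Each record stores the corrupt set of its round, and corruptions happen only at the beginning of
rounds. -/
theorem conf_corrupt_eq_of_hist_eq {r : ℕ} (h : (conf A m ω r).hist = (conf A' m ω' r).hist) :
    (conf A m ω r).corrupt = (conf A' m ω' r).corrupt := by
  cases r with
  | zero => rfl
  | succ r =>
    rw [conf_succ_hist, conf_succ_hist, List.cons.injEq] at h
    exact congrArg Record.corrupt h.1

theorem view_inner_eq {c c' : Config P} {σ σ' : P.Setup} (h : c.view m σ = c'.view m σ')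
    {i : Fin n} (hi : i ∈ c.corrupt) : P.priv σ i = P.priv σ' i ∧ c.loc i = c'.loc i := by
  have hc : c.corrupt = c'.corrupt := congrArg View.corrupt h
  have := congrFun (congrArg View.inner h) i
  simp only [Config.view] at this
  rw [if_pos hi, if_pos (hc ▸ hi), Option.some.injEq, Prod.mk.injEq] at this
  exact this

theorem view_ext {c c' : Config P} {σ σ' : P.Setup} (h1 : P.pub σ = P.pub σ')
    (h2 : m = .sabotaged → σ = σ') (h3 : c.hist = c'.hist) (h4 : c.inp = c'.inp)
    (h5 : ∀ i, (c.loc i).status = (c'.loc i).status) (h6 : c.corrupt = c'.corrupt)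
    (h7 : ∀ i ∈ c.corrupt, P.priv σ i = P.priv σ' i ∧ c.loc i = c'.loc i) :
    c.view m σ = c'.view m σ' := by
  simp only [Config.view, View.mk.injEq]
  refine ⟨h1, ?_, h3, h4, funext h5, h6, ?_⟩
  · cases m
    · simpa using h2 rfl
    · rfl
  · funext i
    by_cases hi : i ∈ c.corrupt
    · rw [if_pos hi, if_pos (h6 ▸ hi), (h7 i hi).1, (h7 i hi).2]
    · rw [if_neg hi, if_neg (h6 ▸ hi)]

theorem view_leak_eq {c c' : Config P} {σ σ' : P.Setup} (h : c.view m σ = c'.view m σ')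
    (hm : m = .sabotaged) : σ = σ' := by
  subst hm; simpa [Config.view] using congrArg View.leak h

theorem view_pub_eq {c c' : Config P} {σ σ' : P.Setup} (h : c.view m σ = c'.view m σ') :
    P.pub σ = P.pub σ' := congrArg View.pub h

theorem view_status_eq {c c' : Config P} {σ σ' : P.Setup} (h : c.view m σ = c'.view m σ')
    (i : Fin n) : (c.loc i).status = (c'.loc i).status := congrFun (congrArg View.status h) i

/-- New corruptions only add information: the corrupt set before them can be read off the history.
-/
theorem conf_view_eq_of_corruptRound_view_eq {r : ℕ}
    (h : (corruptRound A m ω.1 (conf A m ω r)).view m ω.1 =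
      (corruptRound A' m ω'.1 (conf A' m ω' r)).view m ω'.1) :
    (conf A m ω r).view m ω.1 = (conf A' m ω' r).view m ω'.1 := by
  have hh : (conf A m ω r).hist = (conf A' m ω' r).hist := congrArg View.hist h
  refine view_ext (view_pub_eq h) (view_leak_eq h) hh (congrArg View.inp h)
    (fun i => view_status_eq h i)
    (conf_corrupt_eq_of_hist_eq hh) fun i hi => view_inner_eq h (i := i) ?_
  exact Finset.mem_union_left _ hi

/-- In round `start` the inputs and local states of honest parties are overwritten. Nothing is lost
by this, since up to then all inputs are empty and all instances are idle. -/
theorem corruptRound_view_eq_of_during_view_eq (hs : A.start = A'.start) {r : ℕ}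
    (h : (during A m ω r).view m ω.1 = (during A' m ω' r).view m ω'.1) :
    (corruptRound A m ω.1 (conf A m ω r)).view m ω.1 =
      (corruptRound A' m ω'.1 (conf A' m ω' r)).view m ω'.1 := by
  have hh : (conf A m ω r).hist = (conf A' m ω' r).hist := by
    rw [← during_hist, ← during_hist]; exact congrArg View.hist h
  have hc : (during A m ω r).corrupt = (during A' m ω' r).corrupt := congrArg View.corrupt h
  by_cases hr : r = A.start
  · have l1 := conf_loc_of_le_start A m ω hr.le
    have l2 := conf_loc_of_le_start A' m ω' (hs ▸ hr.le)
    refine view_ext (view_pub_eq h) (view_leak_eq h) hh ?_ ?_ ?_ ?_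
    · exact (conf_inp_of_le_start A m ω hr.le).trans (conf_inp_of_le_start A' m ω' (hs ▸ hr.le)).symm
    · intro i
      exact congrArg Inst.status ((l1 i).trans (l2 i).symm)
    · rw [during, during, beginRound_corrupt, beginRound_corrupt] at hc
      exact hc
    · intro i hi
      have : i ∈ (during A m ω r).corrupt := by rwa [during, beginRound_corrupt]
      exact ⟨(view_inner_eq h this).1, (l1 i).trans (l2 i).symm⟩
  · rwa [during, during, beginRound_of_ne _ _ _ _ (by rwa [conf_hist_length]),
      beginRound_of_ne _ _ _ _ (by rwa [conf_hist_length, ← hs])] at h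

theorem honestMsgs_eq_msgsAt {r : ℕ} {i : Fin n} (h : i ∉ (during A m ω r).corrupt) :
    honestMsgs (during A m ω r) (ω.coin r) i = msgsAt A m ω r i := by
  funext j a; simp only [msgsAt, roundMsgs, if_neg h]

theorem honestMsgs_of_mem {d : Config P} {coin : Fin n → P.Coin} {i : Fin n} (h : i ∈ d.corrupt) :
    honestMsgs d coin i = fun _ _ => Wire.silent n := by
  funext j a; simp only [honestMsgs, if_pos h]

/-- The newest record holds corruptions, statuses and messages of the round just ended, and the
states of corrupt parties are frozen. So the view after the round contains all that was visible
within it. -/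
theorem during_view_eq_of_conf_succ_view_eq {r : ℕ}
    (h : (conf A m ω (r + 1)).view m ω.1 = (conf A' m ω' (r + 1)).view m ω'.1) :
    (during A m ω r).view m ω.1 = (during A' m ω' r).view m ω'.1 ∧
      honestMsgs (during A m ω r) (ω.coin r) = honestMsgs (during A' m ω' r) (ω'.coin r) := by
  have hh : (conf A m ω (r + 1)).hist = (conf A' m ω' (r + 1)).hist := congrArg View.hist h
  rw [conf_succ_hist, conf_succ_hist, List.cons.injEq, Record.mk.injEq] at hh
  obtain ⟨⟨h1, h2, h3⟩, h4⟩ := hh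
  refine ⟨view_ext (view_pub_eq h) (view_leak_eq h) (by rwa [during_hist, during_hist])
    (congrArg View.inp h) (congrFun h2) h1 ?_, ?_⟩
  · intro i hi
    have := view_inner_eq h (i := i) hi
    rw [conf_succ_loc_of_mem _ _ _ hi, conf_succ_loc_of_mem _ _ _ (h1 ▸ hi),
      ← during_loc_of_mem _ _ _ hi, ← during_loc_of_mem _ _ _ (h1 ▸ hi)] at this
    exact this
  · funext i
    by_cases hi : i ∈ (during A m ω r).corrupt
    · rw [honestMsgs_of_mem hi, honestMsgs_of_mem (h1 ▸ hi)]
    · rw [honestMsgs_eq_msgsAt hi, honestMsgs_eq_msgsAt (h1 ▸ hi), h3]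

end Views

open Classical in
/-- A family of adversaries, one for each choice of the randomness, can be merged into one adversary
if each decision depends only on what the adversary sees. -/
theorem exists_adversary_of_family [Nonempty V] (m : Setting) (s : ℕ) {H : ℕ}
    (F : Randomness P H → Adversary P) (hs : ∀ ω, (F ω).start = s)
    (hcorrupt : ∀ r ω ω', (conf (F ω) m ω r).view m ω.1 = (conf (F ω') m ω' r).view m ω'.1 →
      (F ω).corrupt ((conf (F ω) m ω r).view m ω.1) =
        (F ω').corrupt ((conf (F ω') m ω' r).view m ω'.1))
    (hinput : ∀ ω ω', (corruptRound (F ω) m ω.1 (conf (F ω) m ω s)).view m ω.1 =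
        (corruptRound (F ω') m ω'.1 (conf (F ω') m ω' s)).view m ω'.1 →
      ∀ i ∉ (corruptRound (F ω) m ω.1 (conf (F ω) m ω s)).corrupt,
        (F ω).input ((corruptRound (F ω) m ω.1 (conf (F ω) m ω s)).view m ω.1) i =
        (F ω').input ((corruptRound (F ω') m ω'.1 (conf (F ω') m ω' s)).view m ω'.1) i)
    (hattack : ∀ r ω ω', (during (F ω) m ω r).view m ω.1 = (during (F ω') m ω' r).view m ω'.1 →
      honestMsgs (during (F ω) m ω r) (ω.coin r) = honestMsgs (during (F ω') m ω' r) (ω'.coin r) →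
      (F ω).attack ((during (F ω) m ω r).view m ω.1)
          (honestMsgs (during (F ω) m ω r) (ω.coin r)) =
        (F ω').attack ((during (F ω') m ω' r).view m ω'.1)
          (honestMsgs (during (F ω') m ω' r) (ω'.coin r))) :
    ∃ B : Adversary P, B.start = s ∧ ∀ ω r, conf B m ω r = conf (F ω) m ω r := by
  -- On each view, `B` imitates the family member of some randomness that produces this view. The
  -- compatibility hypotheses make the choice immaterial; on views that never occur the behaviour is
  -- arbitrary.
  let B : Adversary P :=
    { start := s
      corrupt := fun w =>
        if h : ∃ ω, (conf (F ω) m ω w.hist.length).view m ω.1 = w then (F h.choose).corrupt w else ∅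
      input := fun w i =>
        if h : ∃ ω, (corruptRound (F ω) m ω.1 (conf (F ω) m ω s)).view m ω.1 = w then
          (F h.choose).input w i else Classical.arbitrary V
      attack := fun w hm =>
        if h : ∃ ω, (during (F ω) m ω w.hist.length).view m ω.1 = w ∧
            honestMsgs (during (F ω) m ω w.hist.length) (ω.coin w.hist.length) = hm then
          (F h.choose).attack w hm else fun _ _ _ => Wire.silent n }
  refine ⟨B, rfl, fun ω r => ?_⟩
  induction r with
  | zero => rfl
  | succ r ih =>
    have hlen : ((conf (F ω) m ω r).view m ω.1).hist.length = r := conf_hist_length ..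
    have hlen' : ((during (F ω) m ω r).view m ω.1).hist.length = r := during_hist_length ..
    have e1 : B.corrupt ((conf (F ω) m ω r).view m ω.1) =
        (F ω).corrupt ((conf (F ω) m ω r).view m ω.1) := by
      have h : ∃ ω', (conf (F ω') m ω' ((conf (F ω) m ω r).view m ω.1).hist.length).view m ω'.1 =
        (conf (F ω) m ω r).view m ω.1 := ⟨ω, by rw [hlen]⟩
      have h' := h.choose_spec
      change dite _ _ _ = _
      rw [dif_pos h]
      generalize h.choose = ω' at h' ⊢
      rw [hlen] at h'
      rw [← hcorrupt _ _ _ h', h']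
    have e2 : corruptRound B m ω.1 (conf (F ω) m ω r) =
        corruptRound (F ω) m ω.1 (conf (F ω) m ω r) := by
      rw [corruptRound, corruptRound, e1]
    have e3 : beginRound B m ω.1 (conf (F ω) m ω r) = during (F ω) m ω r := by
      rw [during, beginRound_eq, beginRound_eq, e2, hs]
      by_cases hr : (conf (F ω) m ω r).hist.length = s
      · have hr' : r = s := by rwa [conf_hist_length] at hr
        subst hr'
        have key : ∀ i ∉ (corruptRound (F ω) m ω.1 (conf (F ω) m ω r)).corrupt,
            B.input ((corruptRound (F ω) m ω.1 (conf (F ω) m ω r)).view m ω.1) i =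
            (F ω).input ((corruptRound (F ω) m ω.1 (conf (F ω) m ω r)).view m ω.1) i := by
          intro i hi
          have h : ∃ ω', (corruptRound (F ω') m ω'.1 (conf (F ω') m ω' r)).view m ω'.1 =
            (corruptRound (F ω) m ω.1 (conf (F ω) m ω r)).view m ω.1 := ⟨ω, rfl⟩
          have h' := h.choose_spec
          change dite _ _ _ = _
          rw [dif_pos h, hinput _ _ h'.symm i hi, h']
        rw [if_pos hr, if_pos (by exact hr)]
        simp only [Config.mk.injEq, and_true]
        constructor
        · funext i
          split_ifs with hi
          · rfl
          · rw [key i hi]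
        · funext i
          split_ifs with hi
          · rfl
          · rw [key i hi]
      · rw [if_neg hr, if_neg (by exact hr)]
    have e4 : B.attack ((during (F ω) m ω r).view m ω.1)
          (honestMsgs (during (F ω) m ω r) (ω.coin r)) =
        (F ω).attack ((during (F ω) m ω r).view m ω.1)
          (honestMsgs (during (F ω) m ω r) (ω.coin r)) := by
      have h : ∃ ω', (during (F ω') m ω' ((during (F ω) m ω r).view m ω.1).hist.length).view m ω'.1 =
          (during (F ω) m ω r).view m ω.1 ∧
          honestMsgs (during (F ω') m ω' ((during (F ω) m ω r).view m ω.1).hist.length)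
            (ω'.coin ((during (F ω) m ω r).view m ω.1).hist.length) =
          honestMsgs (during (F ω) m ω r) (ω.coin r) := ⟨ω, by rw [hlen'], by rw [hlen']⟩
      have h' := h.choose_spec
      change dite _ _ _ = _
      rw [dif_pos h]
      generalize h.choose = ω' at h' ⊢
      rw [hlen'] at h'
      rw [← hattack _ _ _ h'.1 h'.2, h'.1, h'.2]
    have e5 : roundMsgs B m ω.1 (during (F ω) m ω r) (ω.coin r) =
        roundMsgs (F ω) m ω.1 (during (F ω) m ω r) (ω.coin r) := by
      unfold roundMsgs; rw [e4]
    rw [conf_succ, conf_succ, during, ih, e3, endRound, endRound, e5]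

end

section

variable {n : ℕ} {V : Type}

/-! ### Protocols that run another protocol as a black box -/

/-- `J` runs one instance of `P` at each party, and its remaining state depends on the instance of `P`
only through the status of the latter. -/
structure Embedding (J P : Protocol n V) where
  Rest : Type
  RSetup : Type
  RCoin : Type
  [fintypeRSetup : Fintype RSetup]
  [nonemptyRSetup : Nonempty RSetup]
  [fintypeRCoin : Fintype RCoin]
  [nonemptyRCoin : Nonempty RCoin]
  setup : J.Setup ≃ P.Setup × RSetup
  coin : J.Coin ≃ P.Coin × RCoin
  pub : P.Pub → RSetup → J.Pub
  pub_eq : ∀ σ, J.pub σ = pub (P.pub (setup σ).1) (setup σ).2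
  priv : P.Priv → RSetup → Fin n → J.Priv
  priv_eq : ∀ σ i, J.priv σ i = priv (P.priv (setup σ).1 i) (setup σ).2 i
  key : P.K → J.K
  slot : J.State → Slot P
  rest : J.State → Rest
  secret : J.State → P.Priv
  ext : ∀ s s', slot s = slot s' → rest s = rest s' → secret s = secret s' → s = s'
  send_key : ∀ i s c j b, J.send i s c j (key b) = (slot s).send i (coin c).1 j b
  send_other : ∀ i s s' c c' j a, (∀ b, a ≠ key b) → rest s = rest s' → (coin c).2 = (coin c').2 →
    J.send i s c j a = J.send i s' c' j a
  go : Rest → Option V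
  quit : Rest → Bool
  rest_recv : ∀ i s s' c c' inbox, rest s = rest s' → (coin c).2 = (coin c').2 →
    ((slot s).recv i (coin c).1 fun j b => inbox j (key b)).inst.status =
      ((slot s').recv i (coin c').1 fun j b => inbox j (key b)).inst.status →
    rest (J.recv i s c inbox) = rest (J.recv i s' c' inbox)
  secret_recv : ∀ i s c inbox, secret (J.recv i s c inbox) = secret s
  slot_recv : ∀ i s c inbox, slot (J.recv i s c inbox) =
    ((slot s).recv i (coin c).1 fun j b => inbox j (key b)).command i (secret s)
      (go (rest (J.recv i s c inbox))) (quit (rest (J.recv i s c inbox)))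
  rest_init : ∀ i p p' ρ v, rest (J.init i (priv p ρ i) v) = rest (J.init i (priv p' ρ i) v)
  secret_init : ∀ i p ρ v, secret (J.init i (priv p ρ i) v) = p
  slot_init : ∀ i p v, slot (J.init i p v) =
    Slot.command i (secret (J.init i p v)) (go (rest (J.init i p v))) (quit (rest (J.init i p v)))
      ⟨Inst.idle P, false⟩
  out_eq : ∀ s s', rest s = rest s' → J.out s = J.out s'
  halt_eq : ∀ s s', rest s = rest s' → J.halt s = J.halt s'

attribute [instance] Embedding.fintypeRSetup Embedding.nonemptyRSetup Embedding.fintypeRCoin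
  Embedding.nonemptyRCoin

theorem Slot.command_of_started {P : Protocol n V} {i : Fin n} {p : P.Priv} {go : Option V}
    {quit : Bool} {x : Slot P} (h : x.inst.st.isSome = true) :
    x.command i p go quit = ⟨x.inst, x.stopped || quit⟩ := by
  unfold Slot.command; split <;> simp_all

theorem Slot.command_idle {P : Protocol n V} {i : Fin n} {p : P.Priv} {go : Option V}
    {quit b : Bool} :
    ((⟨Inst.idle P, b⟩ : Slot P).command i p go quit).inst = Inst.idle P ∨
      ∃ v, go = some v ∧
        ((⟨Inst.idle P, b⟩ : Slot P).command i p go quit).inst = Inst.propose P i p v := by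
  unfold Slot.command
  split
  · exact .inr ⟨_, rfl, rfl⟩
  · exact .inl rfl

theorem Slot.command_inst_congr {P : Protocol n V} {i : Fin n} {p : P.Priv} {go : Option V}
    {quit : Bool} {x x' : Slot P} {p' : P.Priv} (h : x.inst.st.isSome = x'.inst.st.isSome)
    (hs : x.stopped = x'.stopped) :
    (x.command i p go quit).stopped = (x'.command i p' go quit).stopped ∧
      (x.command i p go quit).inst.st.isSome = (x'.command i p' go quit).inst.st.isSome := by
  obtain ⟨⟨st, a⟩, b⟩ := x
  obtain ⟨⟨st', a'⟩, b'⟩ := x'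
  simp only at hs h
  subst hs
  cases st <;> cases st' <;> simp at h <;> cases b <;> cases go <;> simp [Slot.command, Inst.propose]

theorem Slot.recv_stopped {P : Protocol n V} (x : Slot P) (i : Fin n) (coin : P.Coin) (inbox) :
    (x.recv i coin inbox).stopped = x.stopped := by
  unfold Slot.recv; split <;> simp_all

theorem Slot.recv_isSome {P : Protocol n V} (x : Slot P) (i : Fin n) (coin : P.Coin) (inbox) :
    (x.recv i coin inbox).inst.st.isSome = x.inst.st.isSome := by
  unfold Slot.recv; split <;> simp [Inst.recv_st_isSome]

theorem Slot.recv_inst {P : Protocol n V} {x : Slot P} {i : Fin n} {coin : P.Coin} {inbox}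
    (h : x.stopped = true → x.inst.status.halted = true) :
    (x.recv i coin inbox).inst = x.inst.recv i coin inbox := by
  unfold Slot.recv; split
  · rw [Inst.recv_of_halted (h ‹_›)]
  · rfl

theorem Slot.recv_inst_idle {P : Protocol n V} {x : Slot P} {i : Fin n} {coin : P.Coin} {inbox}
    (h : x.inst = Inst.idle P) : (x.recv i coin inbox).inst = Inst.idle P := by
  unfold Slot.recv; split
  · exact h
  · simp [h, Inst.recv_idle]

theorem Slot.send_eq {P : Protocol n V} {x : Slot P} {i : Fin n} {coin : P.Coin}
    (h : x.stopped = true → x.inst.status.halted = true) :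
    x.send i coin = x.inst.send i coin := by
  funext j a
  unfold Slot.send; split
  · rw [Inst.send_of_halted (h ‹_›)]
  · rfl

namespace Embedding

variable {J P : Protocol n V} (e : Embedding J P)

/-- The instance of `P` inside a local instance of `J`. -/
def part (x : Inst J) : Slot P :=
  match x.st with
  | some s => e.slot s
  | none => ⟨Inst.idle P, false⟩

theorem part_some {x : Inst J} {s : J.State} (h : x.st = some s) : e.part x = e.slot s := by
  simp [part, h]

theorem part_none {x : Inst J} (h : x.st = none) : e.part x = ⟨Inst.idle P, false⟩ := by
  simp [part, h]

/-- The randomness of `J` apart from that of `P`. -/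
abbrev RestRandomness (H : ℕ) : Type := e.RSetup × (Fin n → Fin H → e.RCoin)

/-- The randomness of `J` composed of that of `P` and the rest. -/
def merge {H k : ℕ} (ρ : e.RestRandomness H) (ω : Randomness P (H + k)) : Randomness J H :=
  (e.setup.symm (ω.1, ρ.1), fun i r => e.coin.symm (ω.2 i (Fin.castAdd k r), ρ.2 i r))

variable {H k : ℕ} (ρ : e.RestRandomness H) (ω ω' : Randomness P (H + k))

theorem setup_merge : e.setup (e.merge ρ ω).1 = (ω.1, ρ.1) := e.setup.apply_symm_apply _

theorem pub_merge : J.pub (e.merge ρ ω).1 = e.pub (P.pub ω.1) ρ.1 := by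
  rw [e.pub_eq, setup_merge]

theorem priv_merge (i : Fin n) : J.priv (e.merge ρ ω).1 i = e.priv (P.priv ω.1 i) ρ.1 i := by
  rw [e.priv_eq, setup_merge]

theorem coin_merge {r : ℕ} (h : r < H) (i : Fin n) :
    e.coin ((e.merge ρ ω).coin r i) = (ω.coin r i, ρ.2 i ⟨r, h⟩) := by
  have h' : r < H + k := by omega
  rw [Randomness.coin, Randomness.coin, dif_pos h, dif_pos h']
  exact e.coin.apply_symm_apply _

/-- The instance of `P` in an honest party is not started before round `s`, started in round `s`, and
not interrupted afterwards. -/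
def LiveAt (s r : ℕ) (d : Config J) : Prop :=
  ∀ i ∉ d.corrupt,
    (r < s → (e.part (d.loc i)).inst.st = none) ∧
    (s ≤ r → (e.part (d.loc i)).inst.st.isSome = true ∧
      ((e.part (d.loc i)).stopped = true ∨ (d.loc i).status.halted = true →
        (e.part (d.loc i)).inst.status.halted = true))

/-- `LiveAt` in all rounds before round `r`. -/
def Live (A : Adversary J) (m : Setting) (s : ℕ) {H : ℕ} (ω : Randomness J H) (r : ℕ) : Prop :=
  ∀ r' < r, e.LiveAt s r' (during A m ω r')

theorem Live.mono {e : Embedding J P} {A : Adversary J} {m : Setting} {s : ℕ} {H : ℕ}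
    {ω : Randomness J H} {r r' : ℕ} (h : e.Live A m s ω r) (hr : r' ≤ r) : e.Live A m s ω r' :=
  fun _ hq => h _ (hq.trans_le hr)

theorem live_succ {A : Adversary J} {m : Setting} {s : ℕ} {H : ℕ} {ω : Randomness J H} {r : ℕ} :
    e.Live A m s ω (r + 1) ↔ e.Live A m s ω r ∧ e.LiveAt s r (during A m ω r) := by
  refine ⟨fun h => ⟨h.mono (by omega), h r (by omega)⟩, fun h q hq => ?_⟩
  obtain rfl | hq := eq_or_lt_of_le (Nat.le_of_lt_succ hq)
  · exact h.2
  · exact h.1 q hq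

/-- Not yet started, or just started. -/
def Early (i : Fin n) (p : P.Priv) (x : Inst J) : Prop :=
  (e.part x).inst = Inst.idle P ∨
    ∃ s v, x.st = some s ∧ e.go (e.rest s) = some v ∧ (e.part x).inst = Inst.propose P i p v

variable {e} in
theorem Early.idle {i : Fin n} {p : P.Priv} {x : Inst J} (h : e.Early i p x)
    (hx : (e.part x).inst.st = none) : (e.part x).inst = Inst.idle P := by
  obtain h | ⟨s, v, -, -, h⟩ := h
  · exact h
  · rw [h] at hx; simp [Inst.propose] at hx

variable {e} in
theorem Early.propose {i : Fin n} {p : P.Priv} {x : Inst J} (h : e.Early i p x)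
    (hx : (e.part x).inst.st.isSome = true) :
    ∃ s v, x.st = some s ∧ e.go (e.rest s) = some v ∧
      (e.part x).inst = Inst.propose P i p v := by
  obtain h | h := h
  · rw [h] at hx; simp [Inst.idle] at hx
  · exact h

section Tracking

variable (A : Adversary J) (m : Setting)

/-- The secret stored by a party is the one it obtained from the dealer. -/
theorem secret_eq {r : ℕ} {i : Fin n} {s : J.State}
    (h : ((conf A m (e.merge ρ ω) r).loc i).st = some s) : e.secret s = P.priv ω.1 i := by
  have key : ∀ r, (∀ s, ((conf A m (e.merge ρ ω) r).loc i).st = some s →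
      e.secret s = P.priv ω.1 i) →
      ∀ s, ((during A m (e.merge ρ ω) r).loc i).st = some s → e.secret s = P.priv ω.1 i := by
    intro r ih s hs
    by_cases hi : i ∈ (during A m (e.merge ρ ω) r).corrupt
    · rw [during_loc_of_mem _ _ _ hi] at hs; exact ih s hs
    · by_cases hr : r = A.start
      · subst hr
        obtain ⟨v, -, hv, -⟩ := during_start A m _ hi
        rw [hv, priv_merge] at hs
        simp only [Inst.propose, Option.some.injEq] at hs
        rw [← hs, e.secret_init]
      · rw [during_loc_of_ne _ _ _ hr] at hs; exact ih s hs
  induction r generalizing s with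
  | zero => simp [conf, Config.start, Inst.idle] at h
  | succ r ih =>
    by_cases hi : i ∈ (during A m (e.merge ρ ω) r).corrupt
    · rw [conf_succ_loc_of_mem _ _ _ hi] at h; exact ih h
    · rw [conf_succ_loc _ _ _ hi] at h
      have := key r fun s => ih
      generalize (during A m (e.merge ρ ω) r).loc i = x at this h
      unfold Inst.recv at h
      split at h
      · rename_i s' h1 h2
        simp only [Option.some.injEq] at h
        rw [← h, e.secret_recv]; exact this _ h1
      · exact this _ h

theorem during_secret_eq {r : ℕ} {i : Fin n} {s : J.State}
    (h : ((during A m (e.merge ρ ω) r).loc i).st = some s) : e.secret s = P.priv ω.1 i := by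
  by_cases hi : i ∈ (during A m (e.merge ρ ω) r).corrupt
  · rw [during_loc_of_mem _ _ _ hi] at h; exact e.secret_eq _ _ _ _ h
  · by_cases hr : r = A.start
    · subst hr
      obtain ⟨v, -, hv, -⟩ := during_start A m _ hi
      rw [hv, priv_merge] at h
      simp only [Inst.propose, Option.some.injEq] at h
      rw [← h, e.secret_init]
    · rw [during_loc_of_ne _ _ _ hr] at h; exact e.secret_eq _ _ _ _ h

/-- The instance of `P` in a party of `J` at the end of a round. -/
theorem part_conf_succ {r : ℕ} {i : Fin n} (hi : i ∉ (during A m (e.merge ρ ω) r).corrupt)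
    (hr : r < H) {s : J.State}
    (hs : ((during A m (e.merge ρ ω) r).loc i).st = some s)
    (hh : ((during A m (e.merge ρ ω) r).loc i).status.halted = false) :
    ∃ s', ((conf A m (e.merge ρ ω) (r + 1)).loc i).st = some s' ∧
      s' = J.recv i s ((e.merge ρ ω).coin r i) (fun j a => msgsAt A m (e.merge ρ ω) r j i a) ∧
      e.slot s' = ((e.slot s).recv i (ω.coin r i) fun j b =>
        msgsAt A m (e.merge ρ ω) r j i (e.key b)).command i (P.priv ω.1 i)
          (e.go (e.rest s')) (e.quit (e.rest s')) := by
  refine ⟨_, ?_, rfl, ?_⟩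
  · rw [conf_succ_loc _ _ _ hi, Inst.recv, hs, hh]
  · rw [e.slot_recv, e.coin_merge _ _ hr, e.during_secret_eq _ _ _ _ hs]

theorem conf_succ_loc_of_silent {r : ℕ} {i : Fin n}
    (hi : i ∉ (during A m (e.merge ρ ω) r).corrupt)
    (h : ((during A m (e.merge ρ ω) r).loc i).st = none ∨
      ((during A m (e.merge ρ ω) r).loc i).status.halted = true) :
    (conf A m (e.merge ρ ω) (r + 1)).loc i = (during A m (e.merge ρ ω) r).loc i := by
  rw [conf_succ_loc _ _ _ hi, Inst.recv]
  split <;> simp_all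

variable {s : ℕ}

/-- Liveness forbids a start of `P` before round `s`, so up to then the instance is idle. At `r = s`
the commands at the end of the previous round may just have started it; its state is then the
initial one for the input `go`, which an adversary against `P` can supply. -/
theorem early {r : ℕ} (hr : r ≤ s) (hrH : r ≤ H) (hl : e.Live A m s (e.merge ρ ω) r) {i : Fin n}
    (hi : i ∉ (conf A m (e.merge ρ ω) r).corrupt) :
    e.Early i (P.priv ω.1 i) ((conf A m (e.merge ρ ω) r).loc i) := by
  induction r with
  | zero => exact .inl rfl
  | succ r ih =>
    have hid : i ∉ (during A m (e.merge ρ ω) r).corrupt := hi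
    have ihr := ih (by omega) (by omega) (hl.mono (by omega))
      (fun h => hi (conf_corrupt_subset_during _ _ _ _ h))
    have hld := ((hl r (by omega)) i hid).1 (by omega)
    have hidle : (e.part ((during A m (e.merge ρ ω) r).loc i)).inst = Inst.idle P := by
      by_cases hrs : r = A.start
      · subst hrs
        obtain ⟨v, -, hv, -⟩ := during_start A m _ hid
        rw [hv] at hld ⊢
        rw [e.part_some (s := J.init i (J.priv (e.merge ρ ω).1 i) v) rfl, e.slot_init] at hld ⊢
        obtain h | ⟨w, -, h⟩ := Slot.command_idle (P := P) (i := i)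
          (p := e.secret (J.init i (J.priv (e.merge ρ ω).1 i) v))
          (go := e.go (e.rest (J.init i (J.priv (e.merge ρ ω).1 i) v)))
          (quit := e.quit (e.rest (J.init i (J.priv (e.merge ρ ω).1 i) v))) (b := false)
        · exact h
        · rw [h] at hld; simp [Inst.propose] at hld
      · rw [during_loc_of_ne _ _ _ hrs] at hld ⊢
        exact ihr.idle hld
    by_cases hq : ((during A m (e.merge ρ ω) r).loc i).st = none ∨
      ((during A m (e.merge ρ ω) r).loc i).status.halted = true
    · rw [Early, e.conf_succ_loc_of_silent _ _ _ _ hid hq]; exact .inl hidle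
    · push Not at hq
      obtain ⟨s0, hs0⟩ := Option.ne_none_iff_exists'.mp hq.1
      obtain ⟨s', h1, -, h3⟩ := e.part_conf_succ ρ ω A m hid (by omega) hs0 (by simpa using hq.2)
      rw [e.part_some hs0] at hidle
      rw [Early, e.part_some h1, h3]
      have hx := Slot.recv_inst_idle (i := i) (coin := ω.coin r i)
        (inbox := fun j b => msgsAt A m (e.merge ρ ω) r j i (e.key b)) hidle
      generalize (e.slot s0).recv i (ω.coin r i) (fun j b =>
        msgsAt A m (e.merge ρ ω) r j i (e.key b)) = x at hx ⊢
      obtain ⟨inst, b⟩ := x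
      simp only at hx
      subst hx
      obtain h | ⟨w, hw, h⟩ := Slot.command_idle (P := P) (i := i)
          (p := P.priv ω.1 i) (go := e.go (e.rest s')) (quit := e.quit (e.rest s')) (b := b)
      · exact .inl h
      · exact .inr ⟨s', w, h1, hw, h⟩

theorem during_early {r : ℕ} (hr : r ≤ s) (hrH : r ≤ H) (hl : e.Live A m s (e.merge ρ ω) r)
    {i : Fin n} (hi : i ∉ (conf A m (e.merge ρ ω) r).corrupt) :
    e.Early i (P.priv ω.1 i) ((during A m (e.merge ρ ω) r).loc i) := by
  by_cases hrs : r = A.start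
  · subst hrs
    by_cases hid : i ∈ (during A m (e.merge ρ ω) A.start).corrupt
    · rw [during_loc_of_mem _ _ _ hid]; exact e.early ρ ω A m hr hrH hl hi
    obtain ⟨v, -, hv, -⟩ := during_start A m _ hid
    rw [hv, Early, e.part_some (s := J.init i (J.priv (e.merge ρ ω).1 i) v) rfl, e.slot_init]
    obtain h | ⟨w, hw, h⟩ := Slot.command_idle (P := P) (i := i)
      (p := e.secret (J.init i (J.priv (e.merge ρ ω).1 i) v))
      (go := e.go (e.rest (J.init i (J.priv (e.merge ρ ω).1 i) v)))
      (quit := e.quit (e.rest (J.init i (J.priv (e.merge ρ ω).1 i) v))) (b := false)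
    · exact .inl h
    · refine .inr ⟨_, w, rfl, hw, ?_⟩
      rw [h, priv_merge, e.secret_init]
  · rw [during_loc_of_ne _ _ _ hrs]; exact e.early ρ ω A m hr hrH hl hi

end Tracking

end Embedding

end

/-! ### The scripted adversary against the inner protocol -/

section

variable {n : ℕ} {V : Type}

theorem Slot.command_inst_of_started {P : Protocol n V} {i : Fin n} {p : P.Priv} {go : Option V}
    {quit : Bool} {x : Slot P} (h : x.inst.st.isSome = true) :
    (x.command i p go quit).inst = x.inst := by
  rw [Slot.command_of_started h]

theorem tokensReceived_eq_of_map {P J : Protocol n V} {key : P.K → J.K} {h : List (Record P)}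
    {h' : List (Record J)}
    (hh : h.map Record.msgs = h'.map fun R i j b => R.msgs i j (key b)) (i : Fin n) (b : P.K) :
    tokensReceived h i b = tokensReceived h' i (key b) := by
  have e : ∀ {Q : Protocol n V} (l : List (Record Q)) (a : Q.K), tokensReceived l i a =
      {t | ∃ M ∈ l.map fun R i j => R.msgs i j a, ∃ j, t ∈ (M j i).tokens} := by
    intro Q l a; ext t; simp [tokensReceived]
  rw [e, e]
  have : (h.map fun R i j => R.msgs i j b) = h'.map fun R i j => R.msgs i j (key b) := by
    have := congrArg (List.map fun M (i j : Fin n) => M i j b) hh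
    simpa [Function.comp_def] using this
  rw [this]

/-- Tokens are verified within one key instance. Hence the traffic of `J` outside `P` is of no use
for producing tokens of `P`. -/
theorem tokensSent_eq_of_map {P J : Protocol n V} {key : P.K → J.K} {h : List (Record P)}
    {h' : List (Record J)}
    (hh : h.map Record.msgs = h'.map fun R i j b => R.msgs i j (key b))
    {hm : Fin n → Fin n → P.K → Wire n} {hm' : Fin n → Fin n → J.K → Wire n} {b : P.K}
    (hb : ∀ i j, hm i j b = hm' i j (key b)) :
    tokensSent h hm b = tokensSent h' hm' (key b) := by
  have e : ∀ {Q : Protocol n V} (l : List (Record Q)) (f) (a : Q.K), tokensSent l f a =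
      {t | (∃ M ∈ l.map fun R i j => R.msgs i j a, ∃ i j, t ∈ (M i j).tokens) ∨
        ∃ i j, t ∈ (f i j a).tokens} := by
    intro Q l f a; ext t; simp [tokensSent]
  rw [e, e]
  have : (h.map fun R i j => R.msgs i j b) = h'.map fun R i j => R.msgs i j (key b) := by
    have := congrArg (List.map fun M (i j : Fin n) => M i j b) hh
    simpa [Function.comp_def] using this
  rw [this]; simp only [hb]

namespace Embedding

variable {J P : Protocol n V} (e : Embedding J P) {H k : ℕ} (ρ : e.RestRandomness H)
  (A : Adversary J) (m : Setting) (s R : ℕ) (q : Corruption) (t : ℕ) (S : Finset (Fin n))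

open Classical in
/-- The adversary that repeats what `A` does to the instance of `P`, before round `R` and as
long as the execution is live. An adaptive adversary moreover corrupts `S` in round `R`, provided that
it may. -/
noncomputable def script [Nonempty V] (ω : Randomness P (H + k)) : Adversary P where
  start := s
  corrupt := fun w =>
    -- The script has access to the whole randomness `ω`. That its choices can be computed from the
    -- view is proved afterwards, by comparing the scripts for different `ω`.
    if w.hist.length < R ∧ e.Live A m s (e.merge ρ ω) w.hist.length then
      (during A m (e.merge ρ ω) w.hist.length).corrupt
    else if w.hist.length = R ∧ q = .adaptive ∧ (w.corrupt ∪ S).card ≤ t then S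
    else ∅
  input := fun _ i => if s ≤ R ∧ e.Live A m s (e.merge ρ ω) s then
      (((conf A m (e.merge ρ ω) s).loc i).st.bind fun x => e.go (e.rest x)).getD
        (Classical.arbitrary V)
    else Classical.arbitrary V
  attack := fun w _ i j b =>
    -- Liveness has to include the current round here: only then do the honest parties send the same
    -- messages of `P` as inside `J`.
    if w.hist.length < R ∧ e.Live A m s (e.merge ρ ω) (w.hist.length + 1) then
      A.attack ((during A m (e.merge ρ ω) w.hist.length).view m (e.merge ρ ω).1)
        (honestMsgs (during A m (e.merge ρ ω) w.hist.length) ((e.merge ρ ω).coin w.hist.length))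
        i j (e.key b)
    else Wire.silent n

section

variable {e ρ A m s} {ω : Randomness P (H + k)}

/-- At the end of a live round, the instance of `P` has received its messages. -/
theorem part_recv {r : ℕ} (hr : r < H)
    (hl : e.Live A m s (e.merge ρ ω) (r + 1)) (hsr : s ≤ r) {i : Fin n}
    (hi : i ∉ (during A m (e.merge ρ ω) r).corrupt) :
    (e.part ((conf A m (e.merge ρ ω) (r + 1)).loc i)).inst =
      (e.part ((during A m (e.merge ρ ω) r).loc i)).inst.recv i (ω.coin r i)
        (fun j b => msgsAt A m (e.merge ρ ω) r j i (e.key b)) := by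
  obtain ⟨hl0, hl1⟩ := e.live_succ.mp hl
  have h2 := (hl1 i hi).2 hsr
  by_cases hq : ((during A m (e.merge ρ ω) r).loc i).st = none ∨
      ((during A m (e.merge ρ ω) r).loc i).status.halted = true
  · rw [e.conf_succ_loc_of_silent _ _ _ _ hi hq]
    obtain hq | hq := hq
    · rw [e.part_none hq] at h2; simp [Inst.idle] at h2
    · rw [Inst.recv_of_halted (h2.2 (.inr hq))]
  · push Not at hq
    obtain ⟨y, hy⟩ := Option.ne_none_iff_exists'.mp hq.1
    obtain ⟨s', h3, -, h4⟩ := e.part_conf_succ ρ ω A m hi hr hy (by simpa using hq.2)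
    rw [e.part_some h3, h4, e.part_some hy]
    rw [e.part_some hy] at h2
    rw [Slot.command_inst_of_started (by rw [Slot.recv_isSome]; exact h2.1),
      Slot.recv_inst fun h => h2.2 (.inl h)]

end

variable [Nonempty V] (ω : Randomness P (H + k))

open Classical in
theorem script_corrupt {w : View P} {r : ℕ} (h : w.hist.length = r) :
    (e.script ρ A m s R q t S ω).corrupt w =
      if r < R ∧ e.Live A m s (e.merge ρ ω) r then (during A m (e.merge ρ ω) r).corrupt
      else if r = R ∧ q = .adaptive ∧ (w.corrupt ∪ S).card ≤ t then S else ∅ := by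
  subst h; rfl

open Classical in
theorem script_attack {w : View P} {r : ℕ} (h : w.hist.length = r) (f) (i j b) :
    (e.script ρ A m s R q t S ω).attack w f i j b =
      if r < R ∧ e.Live A m s (e.merge ρ ω) (r + 1) then
        A.attack ((during A m (e.merge ρ ω) r).view m (e.merge ρ ω).1)
          (honestMsgs (during A m (e.merge ρ ω) r) ((e.merge ρ ω).coin r)) i j (e.key b)
      else Wire.silent n := by
  subst h; rfl

/-- The execution of `P` follows that of `J` up to the beginning of round `r`. -/
structure Tracks (r : ℕ) : Prop where
  corrupt : (conf (e.script ρ A m s R q t S ω) m ω r).corrupt =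
    (conf A m (e.merge ρ ω) r).corrupt
  hist : (conf (e.script ρ A m s R q t S ω) m ω r).hist.map Record.msgs =
    (conf A m (e.merge ρ ω) r).hist.map fun M i j b => M.msgs i j (e.key b)
  loc : s < r → ∀ i ∉ (conf A m (e.merge ρ ω) r).corrupt,
    (conf (e.script ρ A m s R q t S ω) m ω r).loc i =
      (e.part ((conf A m (e.merge ρ ω) r).loc i)).inst

variable {e ρ A m s R q t S ω}

theorem Tracks.during_corrupt {r : ℕ} (ht : e.Tracks ρ A m s R q t S ω r) (hr : r < R)
    (hl : e.Live A m s (e.merge ρ ω) r) :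
    (during (e.script ρ A m s R q t S ω) m ω r).corrupt =
      (during A m (e.merge ρ ω) r).corrupt := by
  rw [during, beginRound_corrupt, ht.corrupt]
  have hlen : ((conf (e.script ρ A m s R q t S ω) m ω r).view m ω.1).hist.length = r :=
    conf_hist_length ..
  have : (e.script ρ A m s R q t S ω).corrupt
      ((conf (e.script ρ A m s R q t S ω) m ω r).view m ω.1) =
      (during A m (e.merge ρ ω) r).corrupt := by
    rw [e.script_corrupt ρ A m s R q t S ω hlen, if_pos ⟨hr, hl⟩]
  rw [this]
  exact Finset.union_eq_right.mpr (conf_corrupt_subset_during ..)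

/-- In round `s` both sides have just called `propose` with the same secret and the same input;
afterwards the claim is part of the invariant. -/
theorem Tracks.during_loc {r : ℕ} (hs : A.start < s) (ht : e.Tracks ρ A m s R q t S ω r)
    (hr : r < R) (hRH : R ≤ H)
    (hl : e.Live A m s (e.merge ρ ω) r) {i : Fin n}
    (hi : i ∉ (during A m (e.merge ρ ω) r).corrupt) (hsr : s ≤ r)
    (hx : (e.part ((during A m (e.merge ρ ω) r).loc i)).inst.st.isSome = true) :
    (during (e.script ρ A m s R q t S ω) m ω r).loc i =
      (e.part ((during A m (e.merge ρ ω) r).loc i)).inst := by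
  have hic : i ∉ (conf A m (e.merge ρ ω) r).corrupt :=
    fun h => hi (conf_corrupt_subset_during _ _ _ _ h)
  obtain rfl | hsr := eq_or_lt_of_le hsr
  · have hi' : i ∉ (during (e.script ρ A m s R q t S ω) m ω
        (e.script ρ A m s R q t S ω).start).corrupt := by
      change i ∉ (during (e.script ρ A m s R q t S ω) m ω s).corrupt
      rwa [ht.during_corrupt hr hl]
    obtain ⟨v, -, hv, hv'⟩ := during_start _ _ _ hi'
    have := (e.during_early ρ ω A m le_rfl (by omega) hl hic).propose hx
    obtain ⟨x, w, h1, h2, h3⟩ := this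
    rw [h3]
    refine hv.trans ?_
    rw [during_loc_of_ne _ _ _ (by omega)] at h1
    rw [hv']
    simp only [script, h1, Option.bind_some, h2, Option.getD_some]
    rw [if_pos ⟨by omega, hl⟩]
  · rw [during_loc_of_ne _ _ _ (by change r ≠ s; omega), during_loc_of_ne _ _ _ (by omega)]
    exact ht.loc hsr i hic

theorem Tracks.during_loc_before {r : ℕ} (hsr : r < s) (i : Fin n) :
    (during (e.script ρ A m s R q t S ω) m ω r).loc i = Inst.idle P := by
  rw [during_loc_of_ne _ _ _ (by change r ≠ s; omega)]
  exact conf_loc_of_le_start _ _ _ hsr.le i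

/-- Before round `s` both sides are silent in `P`. From then on a stopped slot or a halted party of
`J` makes no difference, since by liveness the instance of `P` has halted as well. -/
theorem Tracks.honestMsgs_eq {r : ℕ} (hs : A.start < s) (ht : e.Tracks ρ A m s R q t S ω r)
    (hr : r < R) (hRH : R ≤ H) (hl : e.Live A m s (e.merge ρ ω) (r + 1)) (i j : Fin n) (b : P.K) :
    honestMsgs (during (e.script ρ A m s R q t S ω) m ω r) (ω.coin r) i j b =
      honestMsgs (during A m (e.merge ρ ω) r) ((e.merge ρ ω).coin r) i j (e.key b) := by
  obtain ⟨hl0, hl1⟩ := e.live_succ.mp hl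
  have hc := ht.during_corrupt hr hl0
  by_cases hi : i ∈ (during A m (e.merge ρ ω) r).corrupt
  · rw [honestMsgs_of_mem hi, honestMsgs_of_mem (hc ▸ hi)]
  · have hic : i ∉ (conf A m (e.merge ρ ω) r).corrupt :=
      fun h => hi (conf_corrupt_subset_during _ _ _ _ h)
    simp only [honestMsgs]
    rw [if_neg hi, if_neg (hc ▸ hi), during_hist, during_hist, tokensReceived_eq_of_map ht.hist]
    congr 1
    by_cases hsr : s ≤ r
    · have h2 := (hl1 i hi).2 hsr
      rw [ht.during_loc hs hr hRH hl0 hi hsr h2.1]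
      generalize (during A m (e.merge ρ ω) r).loc i = x at h2 ⊢
      cases hx : x.st with
      | none => rw [e.part_none hx] at h2; simp [Inst.idle] at h2
      | some y =>
        rw [e.part_some hx] at h2 ⊢
        cases hh : x.status.halted with
        | true =>
          rw [Inst.send_of_halted (h2.2 (.inr hh)), Inst.send_of_halted hh]
        | false =>
          rw [← Slot.send_eq fun h => h2.2 (.inl h)]
          conv_rhs => rw [Inst.send, hx, hh]
          simp only
          rw [e.send_key, e.coin_merge _ _ (by omega)]
    · have h1 := (e.during_early ρ ω A m (by omega) (by omega) hl0 hic).idle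
        ((hl1 i hi).1 (by omega))
      rw [Tracks.during_loc_before (by omega), Inst.send_idle]
      generalize (during A m (e.merge ρ ω) r).loc i = x at h1 ⊢
      unfold Inst.send
      split
      · rename_i y h2 h3
        rw [e.send_key, ← e.part_some h2, Slot.send, h1]
        split <;> rfl
      · rfl

/-- The script proposes the messages chosen by `A`, and in the authenticated setting they are
filtered with the same corrupt set and the same known tokens. -/
theorem Tracks.msgsAt_eq {r : ℕ} (hs : A.start < s) (ht : e.Tracks ρ A m s R q t S ω r)
    (hr : r < R) (hRH : R ≤ H) (hl : e.Live A m s (e.merge ρ ω) (r + 1)) (i j : Fin n) (b : P.K) :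
    msgsAt (e.script ρ A m s R q t S ω) m ω r i j b =
      msgsAt A m (e.merge ρ ω) r i j (e.key b) := by
  obtain ⟨hl0, hl1⟩ := e.live_succ.mp hl
  have hc := ht.during_corrupt hr hl0
  have hm := ht.honestMsgs_eq hs hr hRH hl
  by_cases hi : i ∈ (during A m (e.merge ρ ω) r).corrupt
  · have hlen : ((during (e.script ρ A m s R q t S ω) m ω r).view m ω.1).hist.length = r :=
      during_hist_length ..
    have ha : ∀ f, (e.script ρ A m s R q t S ω).attack
        ((during (e.script ρ A m s R q t S ω) m ω r).view m ω.1) f i j b =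
        A.attack ((during A m (e.merge ρ ω) r).view m (e.merge ρ ω).1)
          (honestMsgs (during A m (e.merge ρ ω) r) ((e.merge ρ ω).coin r)) i j (e.key b) := by
      intro f
      rw [e.script_attack ρ A m s R q t S ω hlen, if_pos ⟨hr, hl⟩]
    simp only [msgsAt, roundMsgs]
    rw [if_pos hi, if_pos (hc ▸ hi)]
    cases m with
    | sabotaged => exact ha _
    | authenticated =>
      simp only
      rw [ha, hc, during_hist, during_hist, tokensSent_eq_of_map ht.hist fun i j => hm i j b]
  · rw [← honestMsgs_eq_msgsAt hi, ← honestMsgs_eq_msgsAt (hc ▸ hi), hm]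

theorem tracks {r : ℕ} (hs : A.start < s) (hr : r ≤ R) (hRH : R ≤ H)
    (hl : e.Live A m s (e.merge ρ ω) r) : e.Tracks ρ A m s R q t S ω r := by
  induction r with
  | zero => exact ⟨rfl, rfl, fun h => by omega⟩
  | succ r ih =>
    have ht := ih (by omega) (hl.mono (by omega))
    have hr' : r < R := by omega
    obtain ⟨hl0, hl1⟩ := e.live_succ.mp hl
    have hm := fun i j b => ht.msgsAt_eq hs hr' hRH hl i j b
    refine ⟨ht.during_corrupt hr' hl0, ?_, ?_⟩
    · rw [conf_succ_hist, conf_succ_hist, List.map_cons, List.map_cons, ht.hist]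
      congr 1
      funext i j b; exact hm i j b
    · intro hsr i hi
      have hid : i ∉ (during A m (e.merge ρ ω) r).corrupt := hi
      rw [conf_succ_loc _ _ _ (by rwa [ht.during_corrupt hr' hl0]), part_recv (by omega) hl (by omega) hid,
        ht.during_loc hs hr' hRH hl0 hid (by omega) ((hl1 i hid).2 (by omega)).1]
      simp only [hm]

end Embedding

end

/-! ### What the scripted adversary can recompute of the execution of `J` -/

section

variable {n : ℕ} {V : Type}

namespace Embedding

variable {J P : Protocol n V} (e : Embedding J P)

/-- Two local instances of `J` that differ at most in the secrets of `P`. -/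
structure LocSim (x x' : Inst J) : Prop where
  status : x.status = x'.status
  state : (x.st = none ∧ x'.st = none) ∨ ∃ y y', x.st = some y ∧ x'.st = some y' ∧
    e.rest y = e.rest y' ∧ (e.slot y).stopped = (e.slot y').stopped ∧
    (e.slot y).inst.st.isSome = (e.slot y').inst.st.isSome

/-- Two configurations of `J` that differ at most in what honest parties keep secret in `P`. -/
structure Sim (c c' : Config J) : Prop where
  inp : c.inp = c'.inp
  corrupt : c.corrupt = c'.corrupt
  hist : c.hist = c'.hist
  loc : ∀ i, e.LocSim (c.loc i) (c'.loc i)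
  frozen : ∀ i ∈ c.corrupt, c.loc i = c'.loc i

variable {e}

theorem LocSim.part_isSome {x x' : Inst J} (h : e.LocSim x x') :
    (e.part x).inst.st.isSome = (e.part x').inst.st.isSome := by
  obtain ⟨h1, h2⟩ | ⟨y, y', h1, h2, -, -, h3⟩ := h.state
  · rw [e.part_none h1, e.part_none h2]
  · rwa [e.part_some h1, e.part_some h2]

theorem LocSim.part_stopped {x x' : Inst J} (h : e.LocSim x x') :
    (e.part x).stopped = (e.part x').stopped := by
  obtain ⟨h1, h2⟩ | ⟨y, y', h1, h2, -, h3, -⟩ := h.state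
  · rw [e.part_none h1, e.part_none h2]
  · rwa [e.part_some h1, e.part_some h2]

variable {H k : ℕ} {ρ : e.RestRandomness H}
  {A : Adversary J} {m : Setting} {s R : ℕ} {q : Corruption} {t : ℕ} {S : Finset (Fin n)}
  {ω ω' : Randomness P (H + k)}

/-- The setup of `J` is that of `P` together with the fixed `ρ`. So an adversary that sees a part of
the setup of `P` can complete it to the corresponding part for `J`. -/
theorem Sim.view_eq {c c' : Config J} (h : e.Sim c c') (h1 : P.pub ω.1 = P.pub ω'.1)
    (h2 : m = .sabotaged → ω.1 = ω'.1) (h3 : ∀ i ∈ c.corrupt, P.priv ω.1 i = P.priv ω'.1 i) :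
    c.view m (e.merge ρ ω).1 = c'.view m (e.merge ρ ω').1 := by
  refine view_ext ?_ ?_ h.hist h.inp (fun i => (h.loc i).status) h.corrupt fun i hi => ⟨?_, h.frozen i hi⟩
  · rw [pub_merge, pub_merge, h1]
  · intro hm; simp only [merge, h2 hm]
  · rw [priv_merge, priv_merge, h3 i hi]

theorem locSim_propose (i : Fin n) (v : V) :
    e.LocSim (Inst.propose J i (J.priv (e.merge ρ ω).1 i) v)
      (Inst.propose J i (J.priv (e.merge ρ ω').1 i) v) := by
  rw [priv_merge, priv_merge]
  have h := e.rest_init i (P.priv ω.1 i) (P.priv ω'.1 i) ρ.1 v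
  refine ⟨?_, .inr ⟨_, _, rfl, rfl, h, ?_⟩⟩
  · simp only [Inst.propose, e.out_eq _ _ h, e.halt_eq _ _ h]
  · rw [e.slot_init, e.slot_init, h]
    exact Slot.command_inst_congr rfl rfl

theorem sim_during {r : ℕ} (h1 : P.pub ω.1 = P.pub ω'.1)
    (h2 : m = .sabotaged → ω.1 = ω'.1)
    (h3 : ∀ i ∈ (during A m (e.merge ρ ω) r).corrupt, P.priv ω.1 i = P.priv ω'.1 i)
    (hsim : e.Sim (corruptRound A m (e.merge ρ ω).1 (conf A m (e.merge ρ ω) r))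
      (corruptRound A m (e.merge ρ ω').1 (conf A m (e.merge ρ ω') r))) :
    e.Sim (during A m (e.merge ρ ω) r) (during A m (e.merge ρ ω') r) := by
  by_cases hr : r = A.start
  · have hview := hsim.view_eq (ρ := ρ) (m := m) h1 h2
      (by rw [during, beginRound_corrupt] at h3; exact h3)
    rw [during, during, beginRound_eq, beginRound_eq, if_pos (by rwa [conf_hist_length]),
      if_pos (by rwa [conf_hist_length])]
    rw [hview, hsim.corrupt]
    refine ⟨rfl, hsim.corrupt, hsim.hist, fun i => ?_, fun i hi => ?_⟩
    · simp only
      split_ifs with hi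
      · exact hsim.loc i
      · exact locSim_propose i _
    · have hi' : i ∈ (corruptRound A m (e.merge ρ ω').1 (conf A m (e.merge ρ ω') r)).corrupt := by
        rw [← hsim.corrupt]; exact hi
      simp only
      rw [if_pos hi', if_pos hi']
      exact hsim.frozen i hi
  · rwa [during, during, beginRound_of_ne _ _ _ _ (by rwa [conf_hist_length]),
      beginRound_of_ne _ _ _ _ (by rwa [conf_hist_length])]

theorem sim_msgsAt {r : ℕ}
    (hm : honestMsgs (during A m (e.merge ρ ω) r) ((e.merge ρ ω).coin r) =
      honestMsgs (during A m (e.merge ρ ω') r) ((e.merge ρ ω').coin r))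
    (hv : (during A m (e.merge ρ ω) r).view m (e.merge ρ ω).1 =
      (during A m (e.merge ρ ω') r).view m (e.merge ρ ω').1) :
    msgsAt A m (e.merge ρ ω) r = msgsAt A m (e.merge ρ ω') r := by
  have h1 : (during A m (e.merge ρ ω) r).corrupt = (during A m (e.merge ρ ω') r).corrupt :=
    congrArg View.corrupt hv
  have h2 : (during A m (e.merge ρ ω) r).hist = (during A m (e.merge ρ ω') r).hist :=
    congrArg View.hist hv
  unfold msgsAt roundMsgs
  rw [hm, hv, h1, h2]

variable [Nonempty V]

/-- The point is a newly corrupted party, whose entire state in `J` is revealed to `A`. Its secret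
and its instance of `P` are revealed to the script at the same moment; everything else is determined
by the simulation, and `ext` assembles the state. -/
theorem sim_corruptRound {r : ℕ} (hr : r < R) (hRH : R ≤ H)
    (hl : e.Live A m s (e.merge ρ ω) r) (hl' : e.Live A m s (e.merge ρ ω') r)
    (ht : e.Tracks ρ A m s R q t S ω r) (ht' : e.Tracks ρ A m s R q t S ω' r)
    (hv : (corruptRound (e.script ρ A m s R q t S ω) m ω.1
        (conf (e.script ρ A m s R q t S ω) m ω r)).view m ω.1 =
      (corruptRound (e.script ρ A m s R q t S ω') m ω'.1
        (conf (e.script ρ A m s R q t S ω') m ω' r)).view m ω'.1)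
    (hsim : e.Sim (conf A m (e.merge ρ ω) r) (conf A m (e.merge ρ ω') r)) :
    e.Sim (corruptRound A m (e.merge ρ ω).1 (conf A m (e.merge ρ ω) r))
      (corruptRound A m (e.merge ρ ω').1 (conf A m (e.merge ρ ω') r)) := by
  have hcv := conf_view_eq_of_corruptRound_view_eq hv
  have hview := hsim.view_eq (ρ := ρ) (m := m) (view_pub_eq hv) (view_leak_eq hv) fun i hi =>
    (view_inner_eq hcv (by rwa [ht.corrupt])).1
  have hc : (corruptRound A m (e.merge ρ ω).1 (conf A m (e.merge ρ ω) r)).corrupt =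
      (corruptRound A m (e.merge ρ ω').1 (conf A m (e.merge ρ ω') r)).corrupt := by
    simp only [corruptRound]; rw [hsim.corrupt, hview]
  refine ⟨hsim.inp, hc, hsim.hist, hsim.loc, fun i hi => ?_⟩
  by_cases hic : i ∈ (conf A m (e.merge ρ ω) r).corrupt
  · exact hsim.frozen i hic
  have hic' : i ∉ (conf A m (e.merge ρ ω') r).corrupt := by rwa [← hsim.corrupt]
  have hin : i ∈ (corruptRound (e.script ρ A m s R q t S ω) m ω.1
        (conf (e.script ρ A m s R q t S ω) m ω r)).corrupt := by
    have := ht.during_corrupt hr hl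
    rw [during, during, beginRound_corrupt, beginRound_corrupt] at this
    rw [corruptRound, this]; exact hi
  obtain ⟨hp, hloc⟩ := view_inner_eq hv hin
  change (conf (e.script ρ A m s R q t S ω) m ω r).loc i =
    (conf (e.script ρ A m s R q t S ω') m ω' r).loc i at hloc
  change (conf A m (e.merge ρ ω) r).loc i = (conf A m (e.merge ρ ω') r).loc i
  have hli := hsim.loc i
  have hslot : (e.part ((conf A m (e.merge ρ ω) r).loc i)).inst =
      (e.part ((conf A m (e.merge ρ ω') r).loc i)).inst := by
    by_cases hsr : s < r
    · rw [← ht.loc hsr i hic, ← ht'.loc hsr i hic', hloc]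
    -- At `r = s` the instance inside `J` may already be started while the script still sees an idle
    -- one. Input and secret determine it, and both agree.
    · have h1 := e.early ρ ω A m (by omega) (by omega) hl hic
      have h2 := e.early ρ ω' A m (by omega) (by omega) hl' hic'
      by_cases hx : (e.part ((conf A m (e.merge ρ ω) r).loc i)).inst.st.isSome = true
      · have hx' := hx
        rw [hli.part_isSome] at hx'
        obtain ⟨y, v, a1, a2, a3⟩ := h1.propose hx
        obtain ⟨y', v', b1, b2, b3⟩ := h2.propose hx'
        obtain ⟨c1, -⟩ | ⟨z, z', c1, c2, c3, -⟩ := hli.state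
        · simp [a1] at c1
        · rw [a1] at c1; rw [b1] at c2
          cases c1; cases c2
          rw [c3, b2] at a2
          cases a2
          rw [a3, b3, hp]
      · have hx' := hx
        rw [hli.part_isSome] at hx'
        simp only [Bool.not_eq_true, Option.isSome_eq_false_iff, Option.isNone_iff_eq_none] at hx hx'
        rw [h1.idle hx, h2.idle hx']
  have hst := hli.part_stopped
  have hsec := fun y => e.secret_eq ρ ω A m (r := r) (i := i) (s := y)
  have hsec' := fun y => e.secret_eq ρ ω' A m (r := r) (i := i) (s := y)
  generalize (conf A m (e.merge ρ ω) r).loc i = x at hli hslot hst hsec ⊢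
  generalize (conf A m (e.merge ρ ω') r).loc i = x' at hli hslot hst hsec' ⊢
  obtain ⟨h1, h2⟩ | ⟨y, y', h1, h2, h3, -⟩ := hli.state
  · obtain ⟨st, a⟩ := x; obtain ⟨st', a'⟩ := x'
    have := hli.status
    simp_all
  · rw [e.part_some h1, e.part_some h2] at hslot hst
    have hy : y = y' := by
      refine e.ext _ _ ?_ h3 (by rw [hsec y h1, hsec' y' h2, hp])
      generalize e.slot y = a at hslot hst ⊢
      generalize e.slot y' = a' at hslot hst ⊢
      obtain ⟨_, _⟩ := a; obtain ⟨_, _⟩ := a'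
      simp_all
    obtain ⟨st, a⟩ := x; obtain ⟨st', a'⟩ := x'
    have := hli.status
    simp_all

/-- Liveness is visible to the script: it depends only on whether the slots are started or stopped,
on whether parties of `J` have halted, and on the statuses of the instances of `P`. -/
theorem liveAt_of_sim {r : ℕ} (hs : A.start < s) (hr : r < R) (hRH : R ≤ H)
    (hl : e.Live A m s (e.merge ρ ω) (r + 1)) (hl' : e.Live A m s (e.merge ρ ω') r)
    (ht : e.Tracks ρ A m s R q t S ω r) (ht' : e.Tracks ρ A m s R q t S ω' r)
    (hv : (during (e.script ρ A m s R q t S ω) m ω r).view m ω.1 =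
      (during (e.script ρ A m s R q t S ω') m ω' r).view m ω'.1)
    (hsim : e.Sim (during A m (e.merge ρ ω) r) (during A m (e.merge ρ ω') r)) :
    e.LiveAt s r (during A m (e.merge ρ ω') r) := by
  obtain ⟨hl0, hl1⟩ := e.live_succ.mp hl
  intro i hi'
  have hi : i ∉ (during A m (e.merge ρ ω) r).corrupt := by rwa [hsim.corrupt]
  have hli := hsim.loc i
  refine ⟨fun hrs => ?_, fun hsr => ?_⟩
  · have := (hl1 i hi).1 hrs
    have h4 := hli.part_isSome
    rw [this] at h4
    simpa using h4.symm
  · obtain ⟨h4, h5⟩ := (hl1 i hi).2 hsr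
    have h6 : (e.part ((during A m (e.merge ρ ω') r).loc i)).inst.st.isSome = true := by
      rw [← hli.part_isSome]; exact h4
    refine ⟨h6, ?_⟩
    rw [← hli.part_stopped, ← hli.status]
    have h7 := view_status_eq hv i
    rw [ht.during_loc hs hr hRH hl0 hi hsr h4, ht'.during_loc hs hr hRH hl' hi' hsr h6] at h7
    rw [← h7]; exact h5

/-- Messages of `P` are seen by the script; all others are functions of the part of the state
outside `P` and of the coins fixed in `ρ`. -/
theorem sim_honestMsgs {r : ℕ} (hs : A.start < s) (hr : r < R) (hRH : R ≤ H)
    (hl : e.Live A m s (e.merge ρ ω) (r + 1)) (hl' : e.Live A m s (e.merge ρ ω') (r + 1))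
    (ht : e.Tracks ρ A m s R q t S ω r) (ht' : e.Tracks ρ A m s R q t S ω' r)
    (hm : honestMsgs (during (e.script ρ A m s R q t S ω) m ω r) (ω.coin r) =
      honestMsgs (during (e.script ρ A m s R q t S ω') m ω' r) (ω'.coin r))
    (hsim : e.Sim (during A m (e.merge ρ ω) r) (during A m (e.merge ρ ω') r)) :
    honestMsgs (during A m (e.merge ρ ω) r) ((e.merge ρ ω).coin r) =
      honestMsgs (during A m (e.merge ρ ω') r) ((e.merge ρ ω').coin r) := by
  funext i j a
  by_cases ha : ∃ b, a = e.key b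
  · obtain ⟨b, rfl⟩ := ha
    rw [← ht.honestMsgs_eq hs hr hRH hl, ← ht'.honestMsgs_eq hs hr hRH hl', hm]
  · push Not at ha
    simp only [honestMsgs]
    rw [hsim.corrupt, hsim.hist]
    split_ifs with hi
    · rfl
    · congr 1
      have hli := hsim.loc i
      unfold Inst.send
      obtain ⟨h1, h2⟩ | ⟨y, y', h1, h2, h3, -⟩ := hli.state
      · rw [h1, h2]
      · rw [h1, h2, hli.status]
        cases ((during A m (e.merge ρ ω') r).loc i).status.halted with
        | true => rfl
        | false =>
          refine e.send_other _ _ _ _ _ _ _ ha h3 ?_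
          rw [e.coin_merge _ _ (by omega), e.coin_merge _ _ (by omega)]

/-- The part of a state outside `P` learns about `P` only through the status of the instance after
the round. From round `s` on this status is in the view of the script; before, the instance is idle.
-/
theorem sim_conf_succ_loc {r : ℕ} (hs : A.start < s) (hr : r < R) (hRH : R ≤ H)
    (hl : e.Live A m s (e.merge ρ ω) (r + 1)) (hl' : e.Live A m s (e.merge ρ ω') (r + 1))
    (hv : (conf (e.script ρ A m s R q t S ω) m ω (r + 1)).view m ω.1 =
      (conf (e.script ρ A m s R q t S ω') m ω' (r + 1)).view m ω'.1)
    (hm : msgsAt A m (e.merge ρ ω) r = msgsAt A m (e.merge ρ ω') r)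
    (hsim : e.Sim (during A m (e.merge ρ ω) r) (during A m (e.merge ρ ω') r)) (i : Fin n) :
    e.LocSim ((conf A m (e.merge ρ ω) (r + 1)).loc i)
      ((conf A m (e.merge ρ ω') (r + 1)).loc i) := by
  have hli := hsim.loc i
  by_cases hi : i ∈ (during A m (e.merge ρ ω) r).corrupt
  · have hi' := hi
    rw [hsim.corrupt] at hi'
    rwa [conf_succ_loc_of_mem _ _ _ hi, conf_succ_loc_of_mem _ _ _ hi',
      ← during_loc_of_mem _ _ _ hi, ← during_loc_of_mem _ _ _ hi']
  have hi' : i ∉ (during A m (e.merge ρ ω') r).corrupt := by rwa [← hsim.corrupt]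
  by_cases hq : ((during A m (e.merge ρ ω) r).loc i).st = none ∨
      ((during A m (e.merge ρ ω) r).loc i).status.halted = true
  · have hq' : ((during A m (e.merge ρ ω') r).loc i).st = none ∨
        ((during A m (e.merge ρ ω') r).loc i).status.halted = true := by
      rw [← hli.status]
      obtain ⟨-, h2⟩ | ⟨y, y', h1, -⟩ := hli.state
      · exact .inl h2
      · exact hq.elim (fun h => by simp [h1] at h) .inr
    rwa [e.conf_succ_loc_of_silent _ _ _ _ hi hq, e.conf_succ_loc_of_silent _ _ _ _ hi' hq']
  · push Not at hq
    obtain ⟨h1, -⟩ | ⟨y, y', h1, h2, h3, h4, h5⟩ := hli.state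
    · exact absurd h1 hq.1
    have hh : ((during A m (e.merge ρ ω) r).loc i).status.halted = false := by simpa using hq.2
    have hh' : ((during A m (e.merge ρ ω') r).loc i).status.halted = false := by
      rwa [← hli.status]
    obtain ⟨z, a1, a2, a3⟩ := e.part_conf_succ ρ ω A m hi (by omega) h1 hh
    obtain ⟨z', b1, b2, b3⟩ := e.part_conf_succ ρ ω' A m hi' (by omega) h2 hh'
    have hcoin := e.coin_merge ρ ω (r := r) (by omega) i
    have hcoin' := e.coin_merge ρ ω' (r := r) (by omega) i
    have hrest : e.rest z = e.rest z' := by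
      rw [a2, b2, hm]
      refine e.rest_recv _ _ _ _ _ _ h3 (by rw [hcoin, hcoin']) ?_
      rw [hcoin, hcoin']
      simp only
      obtain ⟨hl0, hl1⟩ := e.live_succ.mp hl
      obtain ⟨hl0', hl1'⟩ := e.live_succ.mp hl'
      by_cases hsr : s ≤ r
      · have c1 := (hl1 i hi).2 hsr
        have c2 := (hl1' i hi').2 hsr
        have c3 := view_status_eq hv i
        rw [(tracks hs (by omega) hRH hl).loc (by omega) i hi,
          (tracks hs (by omega) hRH hl').loc (by omega) i hi',
          part_recv (by omega) hl hsr hi, part_recv (by omega) hl' hsr hi', e.part_some h1,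
          e.part_some h2, hm] at c3
        rw [e.part_some h1] at c1
        rw [e.part_some h2] at c2
        rwa [Slot.recv_inst fun h => c1.2 (.inl h), Slot.recv_inst fun h => c2.2 (.inl h)]
      · have c1 := (e.during_early ρ ω A m (by omega) (by omega) hl0
          (fun h => hi (conf_corrupt_subset_during _ _ _ _ h))).idle ((hl1 i hi).1 (by omega))
        have c2 := (e.during_early ρ ω' A m (by omega) (by omega) hl0'
          (fun h => hi' (conf_corrupt_subset_during _ _ _ _ h))).idle ((hl1' i hi').1 (by omega))
        rw [e.part_some h1] at c1
        rw [e.part_some h2] at c2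
        rw [Slot.recv_inst_idle c1, Slot.recv_inst_idle c2]
    refine ⟨?_, .inr ⟨z, z', a1, b1, hrest, ?_⟩⟩
    · rw [conf_succ_loc _ _ _ hi, conf_succ_loc _ _ _ hi', Inst.recv, Inst.recv, h1, h2, hh, hh']
      simp only
      rw [← a2, ← b2, e.out_eq _ _ hrest, e.halt_eq _ _ hrest, hli.status]
    · rw [a3, b3, hrest]
      exact Slot.command_inst_congr (by rw [Slot.recv_isSome, Slot.recv_isSome, h5])
        (by rw [Slot.recv_stopped, Slot.recv_stopped, h4])

/-- What the scripted adversary sees determines everything in the execution of `J` but the secrets of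
honest parties. -/
theorem sim_conf {r : ℕ} (hs : A.start < s) (hr : r ≤ R) (hRH : R ≤ H)
    (hl : e.Live A m s (e.merge ρ ω) r)
    (hv : (conf (e.script ρ A m s R q t S ω) m ω r).view m ω.1 =
      (conf (e.script ρ A m s R q t S ω') m ω' r).view m ω'.1) :
    e.Live A m s (e.merge ρ ω') r ∧
      e.Sim (conf A m (e.merge ρ ω) r) (conf A m (e.merge ρ ω') r) := by
  induction r with
  | zero =>
    refine ⟨fun r' h => by omega, rfl, rfl, rfl, fun i => ⟨rfl, .inl ⟨rfl, rfl⟩⟩, ?_⟩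
    intro i hi; simp [conf, Config.start] at hi
  | succ r ih =>
    obtain ⟨hdv, hhm⟩ := during_view_eq_of_conf_succ_view_eq hv
    have hstart : (e.script ρ A m s R q t S ω).start = (e.script ρ A m s R q t S ω').start := rfl
    have hkv := corruptRound_view_eq_of_during_view_eq hstart hdv
    have hl0 := hl.mono (r' := r) (by omega)
    obtain ⟨hl0', hsim⟩ := ih (by omega) hl0 (conf_view_eq_of_corruptRound_view_eq hkv)
    have ht := tracks (q := q) (t := t) (S := S) hs (show r ≤ R by omega) hRH hl0
    have ht' := tracks (q := q) (t := t) (S := S) hs (show r ≤ R by omega) hRH hl0'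
    have hr' : r < R := by omega
    have hpriv : ∀ i ∈ (during A m (e.merge ρ ω) r).corrupt, P.priv ω.1 i = P.priv ω'.1 i :=
      fun i hi => (view_inner_eq hdv (by rwa [ht.during_corrupt hr' hl0])).1
    have hsd := sim_during (view_pub_eq hv) (view_leak_eq hv) hpriv
      (sim_corruptRound hr' hRH hl0 hl0' ht ht' hkv hsim)
    have hl' : e.Live A m s (e.merge ρ ω') (r + 1) :=
      e.live_succ.mpr ⟨hl0', liveAt_of_sim hs hr' hRH hl hl0' ht ht' hdv hsd⟩
    have hmsg := sim_msgsAt (sim_honestMsgs hs hr' hRH hl hl' ht ht' hhm hsd)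
      (hsd.view_eq (view_pub_eq hv) (view_leak_eq hv) hpriv)
    refine ⟨hl', hsd.inp, hsd.corrupt, ?_, sim_conf_succ_loc hs hr' hRH hl hl' hv hmsg hsd, ?_⟩
    · rw [conf_succ_hist, conf_succ_hist, hsd.corrupt, hsim.hist, hmsg]
      have : (fun i => ((during A m (e.merge ρ ω) r).loc i).status) =
          fun i => ((during A m (e.merge ρ ω') r).loc i).status :=
        funext fun i => (hsd.loc i).status
      rw [this]
    · intro i hi
      have hi1 : i ∈ (during A m (e.merge ρ ω) r).corrupt := hi
      have hi2 := hi1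
      rw [hsd.corrupt] at hi2
      rw [conf_succ_loc_of_mem _ _ _ hi1, conf_succ_loc_of_mem _ _ _ hi2,
        ← during_loc_of_mem _ _ _ hi1, ← during_loc_of_mem _ _ _ hi2]
      exact hsd.frozen i hi1

end Embedding

end

/-! ### The reduction to an adversary against the inner protocol -/

section

variable {n : ℕ} {V : Type}

namespace Embedding

variable {J P : Protocol n V} {e : Embedding J P} {H k : ℕ} {ρ : e.RestRandomness H}
  {A : Adversary J} {m : Setting} {s R : ℕ} {q : Corruption} {t : ℕ} {S : Finset (Fin n)}
  [Nonempty V] {ω ω' : Randomness P (H + k)}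

theorem script_view_eq {r : ℕ} (hs : A.start < s) (hr : r ≤ R) (hRH : R ≤ H)
    (hl : e.Live A m s (e.merge ρ ω) r)
    (hv : (conf (e.script ρ A m s R q t S ω) m ω r).view m ω.1 =
      (conf (e.script ρ A m s R q t S ω') m ω' r).view m ω'.1) :
    (conf A m (e.merge ρ ω) r).view m (e.merge ρ ω).1 =
      (conf A m (e.merge ρ ω') r).view m (e.merge ρ ω').1 :=
  (sim_conf hs hr hRH hl hv).2.view_eq (view_pub_eq hv) (view_leak_eq hv) fun _ hi =>
    (view_inner_eq hv (by rwa [(tracks hs hr hRH hl).corrupt])).1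

theorem script_corrupt_congr {r : ℕ} (hs : A.start < s) (hRH : R ≤ H)
    (hv : (conf (e.script ρ A m s R q t S ω) m ω r).view m ω.1 =
      (conf (e.script ρ A m s R q t S ω') m ω' r).view m ω'.1) :
    (e.script ρ A m s R q t S ω).corrupt ((conf (e.script ρ A m s R q t S ω) m ω r).view m ω.1) =
      (e.script ρ A m s R q t S ω').corrupt
        ((conf (e.script ρ A m s R q t S ω') m ω' r).view m ω'.1) := by
  rw [e.script_corrupt ρ A m s R q t S ω (conf_hist_length _ _ _ r),
    e.script_corrupt ρ A m s R q t S ω' (conf_hist_length _ _ _ r), hv]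
  have h1 : r < R → e.Live A m s (e.merge ρ ω) r → e.Live A m s (e.merge ρ ω') r :=
    fun hr hl => (sim_conf hs hr.le hRH hl hv).1
  have h2 : r < R → e.Live A m s (e.merge ρ ω') r → e.Live A m s (e.merge ρ ω) r :=
    fun hr hl => (sim_conf hs hr.le hRH hl hv.symm).1
  by_cases hc : r < R ∧ e.Live A m s (e.merge ρ ω) r
  · rw [if_pos hc, if_pos ⟨hc.1, h1 hc.1 hc.2⟩]
    have := script_view_eq hs hc.1.le hRH hc.2 hv
    rw [during, during, beginRound_corrupt, beginRound_corrupt, this,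
      (sim_conf hs hc.1.le hRH hc.2 hv).2.corrupt]
  · have hc' : ¬(r < R ∧ e.Live A m s (e.merge ρ ω') r) := fun h => hc ⟨h.1, h2 h.1 h.2⟩
    rw [if_neg hc, if_neg hc']

theorem script_input_congr (hs : A.start < s) (hRH : R ≤ H)
    (hv : (corruptRound (e.script ρ A m s R q t S ω) m ω.1
        (conf (e.script ρ A m s R q t S ω) m ω s)).view m ω.1 =
      (corruptRound (e.script ρ A m s R q t S ω') m ω'.1
        (conf (e.script ρ A m s R q t S ω') m ω' s)).view m ω'.1) (w w') (i : Fin n) :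
    (e.script ρ A m s R q t S ω).input w i = (e.script ρ A m s R q t S ω').input w' i := by
  have hcv := conf_view_eq_of_corruptRound_view_eq hv
  simp only [script]
  by_cases hc : s ≤ R ∧ e.Live A m s (e.merge ρ ω) s
  · have := sim_conf hs hc.1 hRH hc.2 hcv
    rw [if_pos hc, if_pos ⟨hc.1, this.1⟩]
    obtain ⟨h1, h2⟩ | ⟨y, y', h1, h2, h3, -⟩ := (this.2.loc i).state
    · rw [h1, h2]
    · rw [h1, h2, Option.bind_some, Option.bind_some, h3]
  · rw [if_neg hc, if_neg]
    exact fun h => hc ⟨h.1, (sim_conf hs h.1 hRH h.2 hcv.symm).1⟩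

/-- Within a round, equal views and equal honest messages of `P` give equal views and equal honest
messages of `J`, on which the decision of `A` is based. -/
theorem script_attack_congr {r : ℕ} (hs : A.start < s) (hRH : R ≤ H)
    (hv : (during (e.script ρ A m s R q t S ω) m ω r).view m ω.1 =
      (during (e.script ρ A m s R q t S ω') m ω' r).view m ω'.1)
    (hm : honestMsgs (during (e.script ρ A m s R q t S ω) m ω r) (ω.coin r) =
      honestMsgs (during (e.script ρ A m s R q t S ω') m ω' r) (ω'.coin r)) :
    (e.script ρ A m s R q t S ω).attack
        ((during (e.script ρ A m s R q t S ω) m ω r).view m ω.1)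
        (honestMsgs (during (e.script ρ A m s R q t S ω) m ω r) (ω.coin r)) =
      (e.script ρ A m s R q t S ω').attack
        ((during (e.script ρ A m s R q t S ω') m ω' r).view m ω'.1)
        (honestMsgs (during (e.script ρ A m s R q t S ω') m ω' r) (ω'.coin r)) := by
  have hstart : (e.script ρ A m s R q t S ω).start = (e.script ρ A m s R q t S ω').start := rfl
  have hkv := corruptRound_view_eq_of_during_view_eq hstart hv
  have hcv := conf_view_eq_of_corruptRound_view_eq hkv
  have key : ∀ {ω ω' : Randomness P (H + k)},
      (during (e.script ρ A m s R q t S ω) m ω r).view m ω.1 =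
        (during (e.script ρ A m s R q t S ω') m ω' r).view m ω'.1 →
      honestMsgs (during (e.script ρ A m s R q t S ω) m ω r) (ω.coin r) =
        honestMsgs (during (e.script ρ A m s R q t S ω') m ω' r) (ω'.coin r) →
      r < R → e.Live A m s (e.merge ρ ω) (r + 1) → e.Live A m s (e.merge ρ ω') (r + 1) ∧
        honestMsgs (during A m (e.merge ρ ω) r) ((e.merge ρ ω).coin r) =
          honestMsgs (during A m (e.merge ρ ω') r) ((e.merge ρ ω').coin r) ∧
        (during A m (e.merge ρ ω) r).view m (e.merge ρ ω).1 =
          (during A m (e.merge ρ ω') r).view m (e.merge ρ ω').1 := by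
    intro ω ω' hv hm hr hl
    have hstart : (e.script ρ A m s R q t S ω).start = (e.script ρ A m s R q t S ω').start := rfl
    have hkv := corruptRound_view_eq_of_during_view_eq hstart hv
    have hcv := conf_view_eq_of_corruptRound_view_eq hkv
    have hl0 := hl.mono (r' := r) (by omega)
    obtain ⟨hl0', hsim⟩ := sim_conf hs hr.le hRH hl0 hcv
    have ht := tracks (q := q) (t := t) (S := S) hs hr.le hRH hl0
    have ht' := tracks (q := q) (t := t) (S := S) hs hr.le hRH hl0'
    have hpriv : ∀ i ∈ (during A m (e.merge ρ ω) r).corrupt, P.priv ω.1 i = P.priv ω'.1 i :=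
      fun i hi => (view_inner_eq hv (by rwa [ht.during_corrupt hr hl0])).1
    have hsd := sim_during (view_pub_eq hv) (view_leak_eq hv) hpriv
      (sim_corruptRound hr hRH hl0 hl0' ht ht' hkv hsim)
    have hl' : e.Live A m s (e.merge ρ ω') (r + 1) :=
      e.live_succ.mpr ⟨hl0', liveAt_of_sim hs hr hRH hl hl0' ht ht' hv hsd⟩
    exact ⟨hl', sim_honestMsgs hs hr hRH hl hl' ht ht' hm hsd,
      hsd.view_eq (view_pub_eq hv) (view_leak_eq hv) hpriv⟩
  funext i j b
  rw [e.script_attack ρ A m s R q t S ω (during_hist_length _ _ _ r),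
    e.script_attack ρ A m s R q t S ω' (during_hist_length _ _ _ r)]
  by_cases hc : r < R ∧ e.Live A m s (e.merge ρ ω) (r + 1)
  · obtain ⟨h1, h2, h3⟩ := key hv hm hc.1 hc.2
    rw [if_pos hc, if_pos ⟨hc.1, h1⟩, h2, h3]
  · rw [if_neg hc, if_neg fun h => hc ⟨h.1, (key hv.symm hm.symm h.1 h.2).1⟩]

open Classical in
theorem script_during_corrupt (hs : A.start < s) (hRH : R ≤ H) (r : ℕ) :
    (during (e.script ρ A m s R q t S ω) m ω r).corrupt =
      if r < R ∧ e.Live A m s (e.merge ρ ω) r then (during A m (e.merge ρ ω) r).corrupt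
      else if r = R ∧ q = .adaptive ∧
          ((conf (e.script ρ A m s R q t S ω) m ω r).corrupt ∪ S).card ≤ t then
        (conf (e.script ρ A m s R q t S ω) m ω r).corrupt ∪ S
      else (conf (e.script ρ A m s R q t S ω) m ω r).corrupt := by
  by_cases hc : r < R ∧ e.Live A m s (e.merge ρ ω) r
  · rw [if_pos hc]; exact (tracks hs hc.1.le hRH hc.2).during_corrupt hc.1 hc.2
  · rw [if_neg hc, during, beginRound_corrupt,
      e.script_corrupt ρ A m s R q t S ω (conf_hist_length _ _ _ r), if_neg hc]
    change _ ∪ (if r = R ∧ q = .adaptive ∧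
          ((conf (e.script ρ A m s R q t S ω) m ω r).corrupt ∪ S).card ≤ t then S else ∅) = _
    split_ifs
    · rfl
    · simp

/-- While the execution is live the script copies corrupt sets of `A`, and `S` is added only within
the budget. So the bound holds in all executions, live or not, as admissibility requires. -/
theorem script_card_le (hs : A.start < s) (hRH : R ≤ H) (hA : Admissible A m q t H) (r : ℕ) :
    (conf (e.script ρ A m s R q t S ω) m ω r).corrupt.card ≤ t := by
  induction r with
  | zero => simp [conf, Config.start]
  | succ r ih =>
    rw [conf_succ_corrupt, script_during_corrupt hs hRH]
    split_ifs with h1 h2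
    · exact (Finset.card_le_card (during_corrupt_subset_conf A m _ (by omega))).trans
        (hA (e.merge ρ ω)).1
    · exact h2.2.2
    · exact ih

theorem script_static (hs : A.start < s) (hRH : R ≤ H) (hA : Admissible A m q t H)
    (hq : q = .static) (r : ℕ) :
    (during (e.script ρ A m s R q t S ω) m ω r).corrupt =
      (during (e.script ρ A m s R q t S ω) m ω 0).corrupt := by
  induction r with
  | zero => rfl
  | succ r ih =>
    rw [script_during_corrupt hs hRH (r + 1)]
    split_ifs with h1 h2
    · have h0 : 0 < R ∧ e.Live A m s (e.merge ρ ω) 0 := ⟨by omega, h1.2.mono (by omega)⟩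
      rw [script_during_corrupt hs hRH 0, if_pos h0]
      exact (hA (e.merge ρ ω)).2 hq _ (by omega)
    · rw [hq] at h2; simp at h2
    · exact ih

/-- An adversary against `J` yields an adversary against `P` that has the same effect on the instances
of `P` in live executions. In round `R` it corrupts the parties in `S`, if it may. -/
theorem exists_reduction (hs : A.start < s) (hRH : R ≤ H) (hk : 0 < k)
    (hA : Admissible A m q t H) (ρ : e.RestRandomness H) (S : Finset (Fin n)) :
    ∃ B : Adversary P, B.start = s ∧ Admissible B m q t (H + k) ∧
      ∀ ω : Randomness P (H + k), e.Live A m s (e.merge ρ ω) R → s < R →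
        (conf A m (e.merge ρ ω) R).corrupt ⊆ S → S.card ≤ t →
        (q = .static → S = (conf A m (e.merge ρ ω) R).corrupt) →
        (conf B m ω (H + k)).corrupt = S ∧
        (∀ i ∉ S, ∃ y v, ((conf A m (e.merge ρ ω) s).loc i).st = some y ∧
          e.go (e.rest y) = some v ∧ (conf B m ω (H + k)).inp i = some v) ∧
        (∀ i ∉ S, ∀ o, (e.part ((conf A m (e.merge ρ ω) R).loc i)).inst.status.out = some o →
          ((conf B m ω (H + k)).loc i).status.out = some o) ∧
        ∀ T, s + T ≤ R → ∀ i ∉ S, ((conf B m ω (s + T)).loc i).status.out ≠ none →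
          (e.part ((conf A m (e.merge ρ ω) R).loc i)).inst.status.out ≠ none := by
  obtain ⟨B, hB, hconf⟩ := exists_adversary_of_family m s
    (fun ω : Randomness P (H + k) => e.script ρ A m s R q t S ω) (fun _ => rfl)
    (fun r ω ω' h => script_corrupt_congr hs hRH h)
    (fun ω ω' h i _ => script_input_congr hs hRH h _ _ i)
    (fun r ω ω' h h' => script_attack_congr hs hRH h h')
  have hdur : ∀ (ω : Randomness P (H + k)) r, (during B m ω r).corrupt =
      (during (e.script ρ A m s R q t S ω) m ω r).corrupt := by
    intro ω r
    have := congrArg Config.corrupt (hconf ω (r + 1))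
    exact this
  refine ⟨B, hB, fun ω => ⟨?_, fun hq r _ => ?_⟩, fun ω hl hsR hcS hSt hq => ?_⟩
  · rw [hconf]; exact script_card_le hs hRH hA _
  · rw [hdur, hdur]; exact script_static hs hRH hA hq r
  have ht := tracks (q := q) (t := t) (S := S) hs le_rfl hRH hl
  -- Since `R ≤ H < H + k`, round `R` takes place. An adaptive adversary corrupts the rest of `S` in
  -- it; in the static case `S` is already the corrupt set.
  have hfin : ∀ r, R < r → (conf (e.script ρ A m s R q t S ω) m ω r).corrupt = S := by
    intro r hr
    induction r, Nat.succ_le_of_lt hr using Nat.le_induction with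
    | base =>
      rw [conf_succ_corrupt, script_during_corrupt hs hRH, if_neg (by omega), ht.corrupt,
        Finset.union_eq_right.mpr hcS]
      cases q with
      | static => simp [(hq rfl).symm]
      | adaptive => rw [if_pos ⟨rfl, rfl, hSt⟩]
    | succ r hr' ih =>
      rw [conf_succ_corrupt, script_during_corrupt hs hRH, if_neg (by omega), if_neg (by omega)]
      exact ih (by omega)
  refine ⟨?_, ?_, ?_, ?_⟩
  · rw [hconf]; exact hfin _ (by omega)
  · intro i hi
    have hls := hl.mono (r' := s) (by omega)
    have hid : i ∉ (during A m (e.merge ρ ω) s).corrupt := fun h =>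
      hi (hcS (during_corrupt_subset_conf A m _ hsR h))
    have hic : i ∉ (conf A m (e.merge ρ ω) s).corrupt := fun h =>
      hid (conf_corrupt_subset_during _ _ _ _ h)
    obtain ⟨y, v, h1, h2, h3⟩ := (e.during_early ρ ω A m le_rfl (by omega) hls hic).propose
      ((hl s hsR i hid).2 le_rfl).1
    rw [during_loc_of_ne _ _ _ (by omega)] at h1
    refine ⟨y, v, h1, h2, ?_⟩
    rw [hconf, conf_inp_of_lt _ _ _ (show s < H + k by omega)]
    have hi' : i ∉ (during (e.script ρ A m s R q t S ω) m ω
        (e.script ρ A m s R q t S ω).start).corrupt := by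
      change i ∉ (during (e.script ρ A m s R q t S ω) m ω s).corrupt
      rwa [(tracks hs (by omega) hRH hls).during_corrupt hsR hls]
    obtain ⟨w, h4, -, h5⟩ := during_start _ _ _ hi'
    refine h4.trans ?_
    rw [h5]
    simp only [script, h1, Option.bind_some, h2, Option.getD_some]
    rw [if_pos ⟨by omega, hls⟩]
  · intro i hi o ho
    rw [hconf]
    refine conf_out_mono _ _ _ (show R ≤ H + k by omega) hsR ?_
    rwa [ht.loc hsR i fun h => hi (hcS h)]
  · intro T hT i hi ho
    rw [hconf] at ho
    rw [← ht.loc hsR i fun h => hi (hcS h)]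
    obtain ⟨o, ho⟩ := Option.ne_none_iff_exists'.mp ho
    cases T with
    -- For `T = 0` the configuration is the one before `propose` in round `s`, so there is no output
    -- yet.
    | zero =>
      rw [conf_loc_of_le_start _ _ _ (by change s + 0 ≤ s; omega)] at ho
      simp [Inst.idle] at ho
    | succ T =>
      rw [conf_out_mono _ _ _ hT (by change s < s + (T + 1); omega) ho]
      simp

end Embedding

end

section

/-! ### Probability -/

section Probability

variable {Ω : Type} [Fintype Ω]

theorem prob_nonneg (E : Ω → Prop) : 0 ≤ prob E :=
  Finset.expect_nonneg fun ω _ => by split_ifs <;> norm_num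

theorem prob_mono {E F : Ω → Prop} (h : ∀ ω, E ω → F ω) : prob E ≤ prob F := by
  classical
  refine Finset.expect_le_expect fun ω _ => ?_
  by_cases hE : E ω
  · rw [if_pos hE, if_pos (h ω hE)]
  · rw [if_neg hE]; split_ifs <;> norm_num

theorem prob_or_le (E F : Ω → Prop) : prob (fun ω => E ω ∨ F ω) ≤ prob E + prob F := by
  classical
  rw [prob, prob, prob, ← Finset.expect_add_distrib]
  refine Finset.expect_le_expect fun ω _ => ?_
  by_cases hE : E ω <;> by_cases hF : F ω <;> simp [hE, hF]

/-- The union bound. -/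
theorem prob_exists_le {ι : Type} [Fintype ι] (E : ι → Ω → Prop) :
    prob (fun ω => ∃ i, E i ω) ≤ ∑ i, prob (E i) := by
  classical
  simp only [prob]
  rw [← Finset.expect_sum_comm]
  refine Finset.expect_le_expect fun ω _ => ?_
  split_ifs with h
  · obtain ⟨i, hi⟩ := h
    refine le_trans (by rw [if_pos hi]) (Finset.single_le_sum
      (f := fun i => if E i ω then (1 : ℝ) else 0) (fun i _ => ?_) (Finset.mem_univ i))
    split_ifs <;> norm_num
  · exact Finset.sum_nonneg fun i _ => by split_ifs <;> norm_num

theorem prob_prod {Ω' : Type} [Fintype Ω'] (E : Ω × Ω' → Prop) :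
    prob E = 𝔼 a : Ω, prob fun b => E (a, b) := by
  rw [prob, ← Finset.univ_product_univ, Finset.expect_product]; rfl

open Classical in
theorem prob_fst {Ω' : Type} [Fintype Ω'] [Nonempty Ω'] (E : Ω → Prop) :
    prob (fun y : Ω × Ω' => E y.1) = prob E := by
  rw [prob_prod]
  have h : ∀ a, (prob fun b : Ω' => E (a, b).1) = if E a then (1 : ℝ) else 0 := fun a => by
    dsimp only [prob]
    exact Finset.expect_const (M := ℝ) (s := (Finset.univ : Finset Ω')) Finset.univ_nonempty _
  simp only [h]
  rfl

theorem prob_equiv {Ω' : Type} [Fintype Ω'] (f : Ω ≃ Ω') (E : Ω' → Prop) :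
    prob (fun ω => E (f ω)) = prob E :=
  Fintype.expect_equiv f _ _ fun _ => rfl

end Probability

theorem Negligible.mono {f g : ℕ → ℝ} (hg : Negligible g) (h0 : ∀ κ, 0 ≤ f κ) (h : ∀ κ, f κ ≤ g κ) :
    Negligible f :=
  Asymptotics.SuperpolynomialDecay.trans_abs_le hg fun κ => by
    simp only [abs_of_nonneg (h0 κ), abs_of_nonneg ((h0 κ).trans (h κ)), h κ]

theorem Negligible.add {f g : ℕ → ℝ} (hf : Negligible f) (hg : Negligible g) :
    Negligible fun κ => f κ + g κ :=
  Asymptotics.SuperpolynomialDecay.add hf hg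

theorem Negligible.sum {ι : Type} (s : Finset ι) {f : ι → ℕ → ℝ} (h : ∀ i ∈ s, Negligible (f i)) :
    Negligible fun κ => ∑ i ∈ s, f i κ := by
  classical
  induction s using Finset.induction_on with
  | empty => simpa only [Finset.sum_empty] using! Asymptotics.superpolynomialDecay_zero Filter.atTop fun κ : ℕ => (κ : ℝ)
  | insert i s hi ih =>
    simp only [Finset.sum_insert hi]
    exact (h i (Finset.mem_insert_self ..)).add (ih fun j hj => h j (Finset.mem_insert_of_mem hj))

theorem negligible_prob_mono {Ω : ℕ → Type} [∀ κ, Fintype (Ω κ)] {E F : ∀ κ, Ω κ → Prop}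
    (hF : Negligible fun κ => prob (F κ)) (h : ∀ κ ω, E κ ω → F κ ω) :
    Negligible fun κ => prob (E κ) :=
  hF.mono (fun _ => prob_nonneg _) fun κ => prob_mono (h κ)

variable {n : ℕ}

/-! ### Averaging over the remaining randomness, and failure of the inner protocol -/

namespace Embedding

/-- Merging is a bijection up to the coins of `P` that `J` does not use. -/
def mergeEquiv {V : Type} {J P : Protocol n V} (e : Embedding J P) (H k : ℕ) :
    e.RestRandomness H × Randomness P (H + k) ≃ Randomness J H × (Fin n → Fin k → P.Coin) where
  toFun x := (e.merge x.1 x.2, fun i r => x.2.2 i (Fin.natAdd H r))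
  invFun y := (((e.setup y.1.1).2, fun i r => (e.coin (y.1.2 i r)).2),
    ((e.setup y.1.1).1, fun i => Fin.append (fun r => (e.coin (y.1.2 i r)).1) (y.2 i)))
  left_inv x := by
    obtain ⟨⟨a, b⟩, c, d⟩ := x
    simp only [merge, Equiv.apply_symm_apply, Prod.mk.injEq, true_and]
    funext i
    exact Fin.append_castAdd_natAdd
  right_inv y := by
    obtain ⟨⟨a, b⟩, c⟩ := y
    simp [merge]

/-- Averaging: some fixed value of the randomness outside `P` is at least as good for the event as a
random one. It can be built into the adversary, whose computations are unbounded. -/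
theorem exists_prob_le {V : Type} {J P : Protocol n V} (e : Embedding J P) {H : ℕ} (k : ℕ)
    (E : Randomness J H → Prop) :
    ∃ ρ : e.RestRandomness H, prob E ≤ prob fun ω : Randomness P (H + k) => E (e.merge ρ ω) := by
  classical
  have h : prob E =
      𝔼 ρ : e.RestRandomness H, prob fun ω : Randomness P (H + k) => E (e.merge ρ ω) := by
    rw [← prob_fst (Ω' := Fin n → Fin k → P.Coin) E, ← prob_equiv (e.mergeEquiv H k), prob_prod]
    rfl
  obtain ⟨ρ, -, hρ⟩ := Finset.exists_le_of_le_expect Finset.univ_nonempty h.le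
  exact ⟨ρ, hρ⟩

/-- The outputs of the instances of `P` outside `S` in round `R` violate consistency, validity, or the
bound `T` on the number of rounds until an output. -/
def Broken {V : Type} {J P : Protocol n V} (e : Embedding J P) (A : Adversary J) (m : Setting)
    (s R T : ℕ) (S : Finset (Fin n)) {H : ℕ} (ω : Randomness J H) : Prop :=
  (∃ i ∉ S, ∃ j ∉ S, ∃ v w, (e.part ((conf A m ω R).loc i)).inst.status.out = some v ∧
    (e.part ((conf A m ω R).loc j)).inst.status.out = some w ∧ v ≠ w) ∨
  (∃ v, (∀ i ∉ S, ∀ y, ((conf A m ω s).loc i).st = some y → e.go (e.rest y) = some v) ∧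
    ∃ i ∉ S, ∃ o, (e.part ((conf A m ω R).loc i)).inst.status.out = some o ∧ o ≠ some v) ∨
  (s + T ≤ R ∧ ∃ i ∉ S, (e.part ((conf A m ω R).loc i)).inst.status.out = none)

/-- `S` is a set of corrupt parties that an adversary may reach after round `R`. -/
def Reachable {V : Type} {J : Protocol n V} (A : Adversary J) (m : Setting) (q : Corruption) (t R : ℕ)
    {H : ℕ} (ω : Randomness J H) (S : Finset (Fin n)) : Prop :=
  (conf A m ω R).corrupt ⊆ S ∧ S.card ≤ t ∧ (q = .static → S = (conf A m ω R).corrupt)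

/-- A secure protocol run by `J` works in all live executions, except with negligible probability. -/
theorem negligible_broken {V : ℕ → Type} [∀ κ, Nonempty (V κ)] {J P : ∀ κ, Protocol n (V κ)}
    (e : ∀ κ, Embedding (J κ) (P κ)) {m : Setting} {q : Corruption} {t : ℕ} {T : ℕ → ℕ}
    (hO : OutputBy m q t P T) (hV : ValidBy m q t P T) (hC : Consistent m q t P)
    (A : ∀ κ, Adversary (J κ)) (H s R : ℕ → ℕ) (hA : ∀ κ, Admissible (A κ) m q t (H κ))
    (hs : ∀ κ, (A κ).start < s κ) (hR : ∀ κ, R κ ≤ H κ) :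
    Negligible fun κ => prob fun ω : Randomness (J κ) (H κ) =>
      (e κ).Live (A κ) m (s κ) ω (R κ) ∧ s κ < R κ ∧ ∃ S, Reachable (A κ) m q t (R κ) ω S ∧
        (e κ).Broken (A κ) m (s κ) (R κ) (T κ) S ω := by
  have main : ∀ S : Finset (Fin n), Negligible fun κ => prob fun ω : Randomness (J κ) (H κ) =>
      (e κ).Live (A κ) m (s κ) ω (R κ) ∧ s κ < R κ ∧ Reachable (A κ) m q t (R κ) ω S ∧
        (e κ).Broken (A κ) m (s κ) (R κ) (T κ) S ω := by
    intro S
    -- The execution against `P` gets `s + T + 1` extra rounds: it then lasts until round `s + T`,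
    -- which the validity and output guarantees presuppose, and it contains round `R` even if `R =
    -- H`.
    choose ρ hρ using fun κ => (e κ).exists_prob_le (s κ + T κ + 1)
      fun ω : Randomness (J κ) (H κ) => (e κ).Live (A κ) m (s κ) ω (R κ) ∧ s κ < R κ ∧
        Reachable (A κ) m q t (R κ) ω S ∧ (e κ).Broken (A κ) m (s κ) (R κ) (T κ) S ω
    choose B hB1 hB2 hB3 using fun κ => exists_reduction (e := e κ) (m := m) (k := s κ + T κ + 1)
      (hs κ) (hR κ) (by omega) (hA κ) (ρ κ) S
    have n1 := hO B _ hB2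
    have n2 := hV B _ hB2
    have n3 := hC B _ hB2
    refine (n1.add (n2.add n3)).mono (fun κ => prob_nonneg _) fun κ => (hρ κ).trans ?_
    refine le_trans ?_ ((prob_or_le _ _).trans (add_le_add le_rfl (prob_or_le _ _)))
    refine prob_mono fun ω => ?_
    rintro ⟨hl, hsR, ⟨h1, h2, h3⟩, hb⟩
    obtain ⟨c1, c2, c3, c4⟩ := hB3 κ ω hl hsR h1 h2 h3
    have hle : (B κ).start + T κ ≤ H κ + (s κ + T κ + 1) := by rw [hB1]; omega
    rw [c1]
    obtain ⟨i, hi, j, hj, v, w, hv, hw, hvw⟩ | ⟨v, hv, i, hi, o, ho, hne⟩ | ⟨hT, i, hi, ho⟩ := hb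
    · exact .inr (.inr ⟨i, hi, j, hj, v, w, c3 i hi _ hv, c3 j hj _ hw, hvw⟩)
    · refine .inr (.inl ⟨hle, v, fun j hj => ?_, i, hi, ?_⟩)
      · obtain ⟨y, w, d1, d2, d3⟩ := c2 j hj
        rw [hv j hj y d1] at d2
        rw [d3, d2]
      · rw [c3 i hi _ ho]
        simpa using hne
    · refine .inl ⟨hle, i, hi, ?_⟩
      by_contra hne
      rw [hB1] at hne
      exact c4 _ hT i hi hne ho
  -- The final corrupt set is known only later, but the number of its possible values does not
  -- depend on the security parameter.
  refine (Negligible.sum Finset.univ fun S _ => main S).mono (fun κ => prob_nonneg _) fun κ => ?_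
  refine le_trans (prob_mono fun ω => ?_) (prob_exists_le _)
  rintro ⟨h1, h2, S, h3, h4⟩
  exact ⟨S, h1, h2, h3, h4⟩

end Embedding

end

section

variable {n : ℕ} {V : Type}

/-! ### The two protocols inside a compiled one -/

/-- The authenticated protocol inside the compiled one. -/
def authEmbedding (h : Host n V) (P Q : Protocol n V) : Embedding (compile h P Q) P where
  Rest := h.State × Q.Priv × Slot Q
  RSetup := Q.Setup
  RCoin := Q.Coin
  setup := Equiv.refl _
  coin := Equiv.refl _
  pub a ρ := (a, Q.pub ρ)
  pub_eq _ := rfl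
  priv p ρ i := (p, Q.priv ρ i)
  priv_eq _ _ := rfl
  key b := .inr (.inl b)
  slot s := s.auth
  rest s := (s.host, s.privSab, s.sab)
  secret s := s.privAuth
  ext s s' h1 h2 h3 := by
    obtain ⟨_, _, _, _, _⟩ := s; obtain ⟨_, _, _, _, _⟩ := s'; simp_all; rfl
  send_key _ _ _ _ _ := rfl
  send_other i s s' c c' j a ha hr hc := by
    obtain ⟨_, _, _, _, _⟩ := s; obtain ⟨_, _, _, _, _⟩ := s'
    simp only [Prod.mk.injEq] at hr
    obtain ⟨rfl, rfl, rfl⟩ := hr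
    change c.2 = c'.2 at hc
    obtain _ | b | b := a
    · rfl
    · exact absurd rfl (ha b)
    · simp only [compile, hc]
  go r := h.startAuth r.1
  quit r := h.stopAuth r.1
  rest_recv i s s' c c' inbox hr hc hs := by
    obtain ⟨_, _, _, _, _⟩ := s; obtain ⟨_, _, _, _, _⟩ := s'
    simp only [Prod.mk.injEq] at hr
    obtain ⟨rfl, rfl, rfl⟩ := hr
    change c.2 = c'.2 at hc
    change (Slot.recv i _ c.1 _).inst.status = (Slot.recv i _ c'.1 _).inst.status at hs
    simp only [compile, CompiledState.commands, hc, hs]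
  secret_recv _ _ _ _ := rfl
  slot_recv _ _ _ _ := rfl
  rest_init _ _ _ _ _ := rfl
  secret_init _ _ _ _ := rfl
  slot_init _ _ _ := rfl
  out_eq s s' hr := by
    simp only [Prod.mk.injEq] at hr
    simp only [compile, hr.1]
  halt_eq s s' hr := by
    simp only [Prod.mk.injEq] at hr
    simp only [compile, hr.1]

/-- The sabotaged protocol inside the compiled one. -/
def sabEmbedding (h : Host n V) (P Q : Protocol n V) : Embedding (compile h P Q) Q where
  Rest := h.State × P.Priv × Slot P
  RSetup := P.Setup
  RCoin := P.Coin
  setup := Equiv.prodComm _ _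
  coin := Equiv.prodComm _ _
  pub a ρ := (P.pub ρ, a)
  pub_eq _ := rfl
  priv p ρ i := (P.priv ρ i, p)
  priv_eq _ _ := rfl
  key b := .inr (.inr b)
  slot s := s.sab
  rest s := (s.host, s.privAuth, s.auth)
  secret s := s.privSab
  ext s s' h1 h2 h3 := by
    obtain ⟨_, _, _, _, _⟩ := s; obtain ⟨_, _, _, _, _⟩ := s'; simp_all; rfl
  send_key _ _ _ _ _ := rfl
  send_other i s s' c c' j a ha hr hc := by
    obtain ⟨_, _, _, _, _⟩ := s; obtain ⟨_, _, _, _, _⟩ := s'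
    simp only [Prod.mk.injEq] at hr
    obtain ⟨rfl, rfl, rfl⟩ := hr
    change c.1 = c'.1 at hc
    obtain _ | b | b := a
    · rfl
    · simp only [compile, hc]
    · exact absurd rfl (ha b)
  go r := h.startSab r.1
  quit r := h.stopSab r.1
  rest_recv i s s' c c' inbox hr hc hs := by
    obtain ⟨_, _, _, _, _⟩ := s; obtain ⟨_, _, _, _, _⟩ := s'
    simp only [Prod.mk.injEq] at hr
    obtain ⟨rfl, rfl, rfl⟩ := hr
    change c.1 = c'.1 at hc
    change (Slot.recv i _ c.2 _).inst.status = (Slot.recv i _ c'.2 _).inst.status at hs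
    simp only [compile, CompiledState.commands, hc, hs]
  secret_recv _ _ _ _ := rfl
  slot_recv _ _ _ _ := rfl
  rest_init _ _ _ _ _ := rfl
  secret_init _ _ _ _ := rfl
  slot_init _ _ _ := rfl
  out_eq s s' hr := by
    simp only [Prod.mk.injEq] at hr
    simp only [compile, hr.1]
  halt_eq s s' hr := by
    simp only [Prod.mk.injEq] at hr
    simp only [compile, hr.1]

end

section

/-! ### The compiler -/

/-- What a signed value stands for. -/
inductive Topic where
  | input
  | relay
  | vote
  | commit

def Topic.code : Topic → List Bool
  | .input => [false, false]
  | .relay => [false, true]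
  | .vote => [true, false]
  | .commit => [true, true]

/-- The parameters of the compiler. -/
structure Params (n : ℕ) (V : Type) where
  ts : ℕ
  ti : ℕ
  authRounds : ℕ
  sabRounds : ℕ
  encode : V → List Bool
  encode_injective : Function.Injective encode
  default : V

open Classical in
/-- Some value with property `p`. -/
noncomputable def pick {V : Type} (p : V → Prop) : Option V :=
  if h : ∃ v, p v then some h.choose else none

theorem pick_spec {V : Type} {p : V → Prop} {v : V} (h : pick p = some v) : p v := by
  unfold pick at h
  split_ifs at h with h'
  rw [Option.some.injEq] at h
  exact h ▸ h'.choose_spec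

theorem exists_pick {V : Type} {p : V → Prop} {v : V} (h : p v) : ∃ w, pick p = some w ∧ p w := by
  have h' : ∃ v, p v := ⟨v, h⟩
  have : pick p = some h'.choose := dif_pos h'
  exact ⟨_, this, h'.choose_spec⟩

variable {n : ℕ} {V : Type}

namespace Params

variable (p : Params n V)

/-- The round, counted from the start, by which the authenticated protocol has to produce an output. -/
def deadline : ℕ := p.authRounds + 3

/-- The round in which the sabotaged protocol is started. -/
def fallback : ℕ := p.deadline + 4

/-- The round in which the output of the sabotaged protocol is used. -/
def finish : ℕ := p.fallback + p.sabRounds + 1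

def stmt (k : Topic) (v : V) : List Bool := k.code ++ p.encode v

/-- The codes of the four topics are distinct and have the same length, so a signature issued on one
topic is worthless for the others. -/
theorem stmt_inj {k k' : Topic} {v v' : V} (h : p.stmt k v = p.stmt k' v') : k = k' ∧ v = v' := by
  cases k <;> cases k' <;>
    simp only [stmt, Topic.code, List.cons_append, List.nil_append, List.cons.injEq, true_and,
      reduceCtorEq, false_and, and_false] at h
  all_goals exact ⟨rfl, p.encode_injective h⟩

open Classical in
/-- The parties that signed `v` on topic `k` themselves. -/
noncomputable def supporters (hd : Set (Fin n × Token n)) (k : Topic) (v : V) : Finset (Fin n) :=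
  Finset.univ.filter fun j => (j, Token.sig j (p.stmt k v)) ∈ hd

/-- A threshold signature of `m` parties on `v` was received. -/
def Certified (hd : Set (Fin n × Token n)) (m : ℕ) (k : Topic) (v : V) : Prop :=
  ∃ j, (j, Token.cert m (p.stmt k v)) ∈ hd

end Params

/-- The local state of the compiler. -/
structure JugState (n : ℕ) (V : Type) where
  clock : ℕ
  input : V
  heard : Set (Fin n × Token n)
  strong : Option V
  authInput : V
  cand : Option V
  quorum : Option V
  vote : Option V
  commit : Option V
  lock : Option V
  sabInput : V
  outbox : List (Token n)
  decision : Option (Option V)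

/-- The tokens received up to the end of a round. -/
def JugState.hear (s : JugState n V) (inbox : Fin n → Wire n) : Set (Fin n × Token n) :=
  s.heard ∪ {x | x.2 ∈ (inbox x.1).tokens}

namespace Params

variable (p : Params n V)

/-- The tokens issued by party `i` so far. -/
def issued (i : Fin n) (s : JugState n V) : List (Token n) :=
  Token.sig i (p.stmt .input s.input) ::
    ((s.strong.map fun v => Token.cert (n - p.ti) (p.stmt .input v)).toList ++
    ((s.cand.map fun v => Token.sig i (p.stmt .relay v)).toList ++
    ((s.quorum.map fun v => Token.cert (n - p.ts) (p.stmt .relay v)).toList ++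
    ((s.vote.map fun v => Token.sig i (p.stmt .vote v)).toList ++
    (s.commit.map fun v => Token.sig i (p.stmt .commit v)).toList))))

/-- The party can stop early. -/
def Quits (s : JugState n V) (hd : Set (Fin n × Token n)) : Prop :=
  -- A party may leave only after it has issued its own relay, vote and commit signatures; otherwise
  -- the remaining parties might miss the threshold `n - ts`.
  s.clock + 1 ≤ p.fallback ∧ s.cand.isSome = true ∧ s.vote.isSome = true ∧
    s.commit.isSome = true ∧ ∃ v, n - p.ts ≤ (p.supporters hd .commit v).card

open Classical in
/-- The decision taken at the end of a round. -/
noncomputable def verdict (s : JugState n V) (hd : Set (Fin n × Token n)) (b : Status V) :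
    Option (Option V) :=
  if p.Quits s hd then some (pick fun v => n - p.ts ≤ (p.supporters hd .commit v).card)
  else if s.clock + 1 = p.finish then some (s.lock.or (b.out.getD none))
  else none

open Classical in
/-- The candidate obtained from the authenticated protocol. -/
noncomputable def candidate (s : JugState n V) (a : Status V) : Option V :=
  -- An output alone is not enough before the deadline. Waiting for termination ensures that a party
  -- which decides before the deadline does not abandon an unfinished instance.
  if (a.out.isSome = true ∧ a.halted = true) ∨ p.deadline ≤ s.clock + 1 then
    some (s.strong.getD ((a.out.getD none).getD p.default))
  else none

open Classical in
/-- The state after a round without a decision, up to the messages for the next round. -/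
noncomputable def update (s : JugState n V) (hd : Set (Fin n × Token n)) (a : Status V) :
    JugState n V where
  clock := s.clock + 1
  input := s.input
  heard := hd
  -- Only signatures of round 0 count. The certificate is then sent in round 1, in time for all
  -- inputs to the authenticated protocol.
  strong := s.strong.or (if s.clock = 0 then
    pick fun v => n - p.ti ≤ (p.supporters hd .input v).card else none)
  authInput := if s.clock = 1 then (pick fun v => p.Certified hd (n - p.ti) .input v).getD s.input
    else s.authInput
  cand := s.cand.or (p.candidate s a)
  quorum := s.quorum.or (pick fun v => n - p.ts ≤ (p.supporters hd .relay v).card)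
  -- The quorum is taken from the state before the update, so its certificate has already been sent
  -- when the vote is formed. Uniqueness of votes rests on this delay.
  vote := s.vote.or (pick fun v => s.quorum = some v ∧
    ∀ w, p.Certified hd (n - p.ts) .relay w → w = v)
  commit := s.commit.or (pick fun v => n - p.ts ≤ (p.supporters hd .vote v).card)
  -- In the sabotaged setting `ti + 1` supporters include an honest one, and if some party decides
  -- early then every other honest party reaches this count.
  lock := if s.clock + 1 = p.fallback then
    pick fun v => p.ti + 1 ≤ (p.supporters hd .commit v).card else s.lock
  -- The lower threshold `ti + 1` lets every honest party recognise a value to which some honest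
  -- party has committed.
  sabInput := if s.clock + 1 = p.fallback then
    ((pick fun v => p.ti + 1 ≤ (p.supporters hd .vote v).card).or s.cand).getD p.default
    else s.sabInput
  outbox := []
  decision := none

open Classical in
-- Only newly issued tokens are put into the outbox, so that each token is sent to each party once.
noncomputable def next (i : Fin n) (s : JugState n V) (hd : Set (Fin n × Token n)) (a : Status V) :
    JugState n V :=
  { p.update s hd a with
    outbox := (p.issued i (p.update s hd a)).filter fun t => decide (t ∉ p.issued i s) }

def initial (i : Fin n) (v : V) : JugState n V where
  clock := 0
  input := v
  heard := ∅
  strong := none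
  authInput := v
  cand := none
  quorum := none
  vote := none
  commit := none
  lock := none
  sabInput := v
  outbox := [Token.sig i (p.stmt .input v)]
  decision := none

/-- One round of an undecided party. -/
noncomputable def step (i : Fin n) (s : JugState n V) (inbox : Fin n → Wire n) (a b : Status V) :
    JugState n V :=
  match p.verdict s (s.hear inbox) b with
  | some o => { s with outbox := [], decision := some o }
  | none => p.next i s (s.hear inbox) a

/-- The compiler. -/
noncomputable def juggernaut : Host n V where
  State := JugState n V
  init := p.initial
  send _ s _ := ⟨[], s.outbox⟩
  recv := p.step
  out s := s.decision
  halt s := s.decision.isSome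
  startAuth s := if s.clock = 2 then some s.authInput else none
  -- Instances are never stopped by a command; they end at the latest when the host itself
  -- terminates.
  stopAuth _ := false
  startSab s := if s.clock = p.fallback then some s.sabInput else none
  stopSab _ := false

/-! ### One step of the compiler -/

variable {p} {i : Fin n} {s : JugState n V} {inbox : Fin n → Wire n} {a b : Status V}

theorem mem_supporters {hd : Set (Fin n × Token n)} {k : Topic} {v : V} {j : Fin n} :
    j ∈ p.supporters hd k v ↔ (j, Token.sig j (p.stmt k v)) ∈ hd := by
  simp [supporters]

theorem issued_next (hd : Set (Fin n × Token n)) :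
    p.issued i (p.next i s hd a) = p.issued i (p.update s hd a) := rfl

theorem issued_sublist (hd : Set (Fin n × Token n)) :
    (p.issued i s).Sublist (p.issued i (p.next i s hd a)) := by
  have key : ∀ (x y : Option V) (f : V → Token n),
      (x.map f).toList.Sublist ((x.or y).map f).toList := by
    intro x y f; cases x <;> simp
  rw [issued_next]
  refine List.Sublist.cons_cons _ ?_
  exact (key _ _ _).append ((key _ _ _).append ((key _ _ _).append ((key _ _ _).append (key _ _ _))))

theorem step_cases : (∃ o, p.verdict s (s.hear inbox) b = some o ∧
      p.step i s inbox a b = { s with outbox := [], decision := some o }) ∨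
    (p.verdict s (s.hear inbox) b = none ∧ p.step i s inbox a b = p.next i s (s.hear inbox) a) := by
  unfold step
  cases h : p.verdict s (s.hear inbox) b with
  | some o => exact .inl ⟨o, rfl, rfl⟩
  | none => exact .inr ⟨rfl, rfl⟩

theorem mem_issued_sig {j : Fin n} {x : List Bool} : Token.sig j x ∈ p.issued i s ↔ j = i ∧
    (x = p.stmt .input s.input ∨ (∃ v, s.cand = some v ∧ x = p.stmt .relay v) ∨
      (∃ v, s.vote = some v ∧ x = p.stmt .vote v) ∨
      (∃ v, s.commit = some v ∧ x = p.stmt .commit v)) := by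
  simp only [issued, List.mem_cons, List.mem_append, Option.mem_toList,
    Option.map_eq_some_iff, Token.sig.injEq, reduceCtorEq, and_false, exists_false, false_or]
  constructor
  · rintro (⟨rfl, h⟩ | ⟨v, h1, rfl, h⟩ | ⟨v, h1, rfl, h⟩ | ⟨v, h1, rfl, h⟩)
    · exact ⟨rfl, .inl h⟩
    · exact ⟨rfl, .inr (.inl ⟨v, h1, h.symm⟩)⟩
    · exact ⟨rfl, .inr (.inr (.inl ⟨v, h1, h.symm⟩))⟩
    · exact ⟨rfl, .inr (.inr (.inr ⟨v, h1, h.symm⟩))⟩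
  · rintro ⟨rfl, (h | ⟨v, h1, h⟩ | ⟨v, h1, h⟩ | ⟨v, h1, h⟩)⟩
    · exact .inl ⟨rfl, h⟩
    · exact .inr (.inl ⟨v, h1, rfl, h.symm⟩)
    · exact .inr (.inr (.inl ⟨v, h1, rfl, h.symm⟩))
    · exact .inr (.inr (.inr ⟨v, h1, rfl, h.symm⟩))

theorem mem_issued_cert {m : ℕ} {x : List Bool} : Token.cert m x ∈ p.issued i s ↔
    (∃ v, s.strong = some v ∧ m = n - p.ti ∧ x = p.stmt .input v) ∨
      (∃ v, s.quorum = some v ∧ m = n - p.ts ∧ x = p.stmt .relay v) := by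
  simp only [issued, List.mem_cons, List.mem_append, Option.mem_toList,
    Option.map_eq_some_iff, Token.cert.injEq, reduceCtorEq, and_false, exists_false, false_or,
    or_false]
  constructor
  · rintro (⟨v, h1, h2, h3⟩ | ⟨v, h1, h2, h3⟩)
    · exact .inl ⟨v, h1, h2.symm, h3.symm⟩
    · exact .inr ⟨v, h1, h2.symm, h3.symm⟩
  · rintro (⟨v, h1, h2, h3⟩ | ⟨v, h1, h2, h3⟩)
    · exact .inl ⟨v, h1, h2.symm, h3.symm⟩
    · exact .inr ⟨v, h1, h2.symm, h3.symm⟩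

theorem sig_input_issued {v : V} : Token.sig i (p.stmt .input v) ∈ p.issued i s ↔ s.input = v := by
  rw [mem_issued_sig]
  refine ⟨fun h => ?_, fun h => ⟨rfl, .inl (h ▸ rfl)⟩⟩
  obtain ⟨-, h | ⟨w, -, h⟩ | ⟨w, -, h⟩ | ⟨w, -, h⟩⟩ := h
  · exact (p.stmt_inj h).2.symm
  all_goals exact absurd (p.stmt_inj h).1 (by simp)

theorem sig_relay_issued {v : V} :
    Token.sig i (p.stmt .relay v) ∈ p.issued i s ↔ s.cand = some v := by
  rw [mem_issued_sig]
  refine ⟨fun h => ?_, fun h => ⟨rfl, .inr (.inl ⟨v, h, rfl⟩)⟩⟩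
  obtain ⟨-, h | ⟨w, hw, h⟩ | ⟨w, -, h⟩ | ⟨w, -, h⟩⟩ := h
  · exact absurd (p.stmt_inj h).1 (by simp)
  · rw [hw, (p.stmt_inj h).2]
  all_goals exact absurd (p.stmt_inj h).1 (by simp)

theorem sig_vote_issued {v : V} :
    Token.sig i (p.stmt .vote v) ∈ p.issued i s ↔ s.vote = some v := by
  rw [mem_issued_sig]
  refine ⟨fun h => ?_, fun h => ⟨rfl, .inr (.inr (.inl ⟨v, h, rfl⟩))⟩⟩
  obtain ⟨-, h | ⟨w, hw, h⟩ | ⟨w, hw, h⟩ | ⟨w, -, h⟩⟩ := h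
  · exact absurd (p.stmt_inj h).1 (by simp)
  · exact absurd (p.stmt_inj h).1 (by simp)
  · rw [hw, (p.stmt_inj h).2]
  · exact absurd (p.stmt_inj h).1 (by simp)

theorem sig_commit_issued {v : V} :
    Token.sig i (p.stmt .commit v) ∈ p.issued i s ↔ s.commit = some v := by
  rw [mem_issued_sig]
  refine ⟨fun h => ?_, fun h => ⟨rfl, .inr (.inr (.inr ⟨v, h, rfl⟩))⟩⟩
  obtain ⟨-, h | ⟨w, hw, h⟩ | ⟨w, hw, h⟩ | ⟨w, hw, h⟩⟩ := h
  · exact absurd (p.stmt_inj h).1 (by simp)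
  · exact absurd (p.stmt_inj h).1 (by simp)
  · exact absurd (p.stmt_inj h).1 (by simp)
  · rw [hw, (p.stmt_inj h).2]

theorem cert_input_issued {v : V} (h : s.strong = some v) :
    Token.cert (n - p.ti) (p.stmt .input v) ∈ p.issued i s :=
  mem_issued_cert.mpr (.inl ⟨v, h, rfl, rfl⟩)

theorem cert_relay_issued {v : V} (h : s.quorum = some v) :
    Token.cert (n - p.ts) (p.stmt .relay v) ∈ p.issued i s :=
  mem_issued_cert.mpr (.inr ⟨v, h, rfl, rfl⟩)

/-- Every threshold signature issued is backed by signatures received. -/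
def Backed (p : Params n V) (i : Fin n) (s : JugState n V) : Prop :=
  ∀ m x, Token.cert m x ∈ p.issued i s →
    ∃ S : Finset (Fin n), m ≤ S.card ∧ ∀ j ∈ S, (j, Token.sig j x) ∈ s.heard

theorem subset_hear : s.heard ⊆ s.hear inbox := Set.subset_union_left

/-- A certificate is issued only when `pick` has found enough supporters, and the signatures of
supporters have been received. Certificates of honest parties therefore survive verification. -/
theorem Backed.step (h : p.Backed i s) : p.Backed i (p.step i s inbox a b) := by
  obtain ⟨o, -, hst⟩ | ⟨-, hst⟩ :=
    step_cases (p := p) (i := i) (s := s) (inbox := inbox) (a := a) (b := b)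
  · rw [hst]; exact h
  · rw [hst]
    intro m x hx
    have hold : Token.cert m x ∈ p.issued i s → ∃ S : Finset (Fin n), m ≤ S.card ∧
        ∀ j ∈ S, (j, Token.sig j x) ∈ s.hear inbox := fun hx => by
      obtain ⟨S, h1, h2⟩ := h m x hx
      exact ⟨S, h1, fun j hj => subset_hear (h2 j hj)⟩
    change ∃ S : Finset (Fin n), m ≤ S.card ∧ ∀ j ∈ S, (j, Token.sig j x) ∈ s.hear inbox
    rw [issued_next, mem_issued_cert] at hx
    obtain ⟨v, h1, rfl, rfl⟩ | ⟨v, h1, rfl, rfl⟩ := hx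
    · obtain h1 | ⟨-, h1⟩ := Option.or_eq_some_iff.mp h1
      · exact hold (cert_input_issued h1)
      · split_ifs at h1
        exact ⟨_, pick_spec (p := fun v => n - p.ti ≤ (p.supporters (s.hear inbox) .input v).card) h1,
          fun j hj => mem_supporters.mp hj⟩
    · obtain h1 | ⟨-, h1⟩ := Option.or_eq_some_iff.mp h1
      · exact hold (cert_relay_issued h1)
      · exact ⟨_, pick_spec (p := fun v => n - p.ts ≤ (p.supporters (s.hear inbox) .relay v).card) h1,
          fun j hj => mem_supporters.mp hj⟩

theorem backed_initial (i : Fin n) (v : V) : p.Backed i (p.initial i v) := by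
  intro m x hx
  rw [mem_issued_cert] at hx
  simp [initial] at hx

theorem outbox_initial (i : Fin n) (v : V) :
    (p.initial i v).outbox = p.issued i (p.initial i v) := rfl

theorem outbox_step_subset : ∀ t ∈ (p.step i s inbox a b).outbox,
    t ∈ p.issued i (p.step i s inbox a b) := by
  obtain ⟨o, -, hst⟩ | ⟨-, hst⟩ :=
    step_cases (p := p) (i := i) (s := s) (inbox := inbox) (a := a) (b := b)
  · rw [hst]; simp
  · rw [hst]; intro t ht
    exact (List.mem_filter.mp ht).1

theorem mem_issued_step {t : Token n} (h : t ∈ p.issued i (p.step i s inbox a b)) :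
    t ∈ p.issued i s ∨ t ∈ (p.step i s inbox a b).outbox ∧ (p.step i s inbox a b).decision = none := by
  obtain ⟨o, -, hst⟩ | ⟨-, hst⟩ :=
    step_cases (p := p) (i := i) (s := s) (inbox := inbox) (a := a) (b := b)
  · rw [hst] at h; exact .inl h
  · rw [hst] at h ⊢
    by_cases ht : t ∈ p.issued i s
    · exact .inl ht
    · exact .inr ⟨List.mem_filter.mpr ⟨h, by simpa using ht⟩, rfl⟩

/-- The list of issued tokens serves as a potential: what is sent next is paid for by its growth. No
old token is lost, as the old list is a sublist of the new one. -/
theorem outbox_step_length : (p.step i s inbox a b).outbox.length + (p.issued i s).length ≤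
    (p.issued i (p.step i s inbox a b)).length := by
  classical
  obtain ⟨o, -, hst⟩ | ⟨-, hst⟩ :=
    step_cases (p := p) (i := i) (s := s) (inbox := inbox) (a := a) (b := b)
  · rw [hst]; simp [issued]
  · rw [hst]
    have h1 := issued_sublist (p := p) (i := i) (s := s) (a := a) (s.hear inbox)
    have h2 := List.length_eq_length_filter_add (l := p.issued i (p.next i s (s.hear inbox) a))
      fun t => decide (t ∉ p.issued i s)
    have h3 := (h1.filter fun t => decide (t ∈ p.issued i s)).length_le
    rw [List.filter_eq_self.mpr (by simp)] at h3
    have h4 : (p.next i s (s.hear inbox) a).outbox =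
      (p.issued i (p.next i s (s.hear inbox) a)).filter fun t => decide (t ∉ p.issued i s) := by
      rw [issued_next, next]
    rw [h4]
    simp only [decide_not, Bool.not_not] at h2 ⊢
    omega

/-- Signatures on four topics and certificates on two of them: six tokens in a lifetime. This is the
source of the quadratic bound on communication. -/
theorem issued_length_le : (p.issued i s).length ≤ 6 := by
  have key : ∀ (x : Option V) (f : V → Token n), (x.map f).toList.length ≤ 1 := by
    intro x f; cases x <;> simp
  simp only [issued, List.length_cons, List.length_append]
  have h1 := key s.strong fun v => Token.cert (n - p.ti) (p.stmt .input v)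
  have h2 := key s.cand fun v => Token.sig i (p.stmt .relay v)
  have h3 := key s.quorum fun v => Token.cert (n - p.ts) (p.stmt .relay v)
  have h4 := key s.vote fun v => Token.sig i (p.stmt .vote v)
  have h5 := key s.commit fun v => Token.sig i (p.stmt .commit v)
  omega

theorem issued_size_le {κ m : ℕ} (hm : ∀ v, (p.encode v).length ≤ m) {t : Token n}
    (ht : t ∈ p.issued i s) : t.size κ ≤ κ + (2 + m) := by
  have key : ∀ k v, (p.stmt k v).length ≤ 2 + m := by
    intro k v
    have := hm v
    cases k <;> simp [stmt, Topic.code] <;> omega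
  cases t with
  | sig j x =>
    rw [mem_issued_sig] at ht
    obtain ⟨-, rfl | ⟨v, -, rfl⟩ | ⟨v, -, rfl⟩ | ⟨v, -, rfl⟩⟩ := ht <;>
      exact Nat.add_le_add_left (key _ _) _
  | cert k x =>
    rw [mem_issued_cert] at ht
    obtain ⟨v, -, -, rfl⟩ | ⟨v, -, -, rfl⟩ := ht <;> exact Nat.add_le_add_left (key _ _) _

end Params

end

section

variable {n : ℕ} {V : Type}

/-! ### Executions of the compiler, seen from the hosts -/

/-- The states of the hosts, the messages they exchange, and what they see of the two instances. -/
structure Rounds (n : ℕ) (V : Type) where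
  st : ℕ → Fin n → JugState n V
  wire : ℕ → Fin n → Fin n → Wire n
  auth : ℕ → Fin n → Status V
  sab : ℕ → Fin n → Status V

namespace Rounds

/-- What party `j` has received by the end of round `k`. -/
def heard (T : Rounds n V) (k : ℕ) (j : Fin n) : Set (Fin n × Token n) :=
  (T.st k j).hear fun i => T.wire k i j

/-- The parties in `F` follow the protocol for `K` rounds. -/
structure Follows (T : Rounds n V) (p : Params n V) (F : Finset (Fin n)) (K : ℕ) : Prop where
  init : ∀ i ∈ F, T.st 0 i = p.initial i (T.st 0 i).input
  step : ∀ i ∈ F, ∀ k < K, (T.st k i).decision = none →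
    T.st (k + 1) i = p.step i (T.st k i) (fun j => T.wire k j i) (T.auth k i) (T.sab k i)
  stay : ∀ i ∈ F, ∀ k < K, (T.st k i).decision ≠ none → T.st (k + 1) i = T.st k i
  sent : ∀ i ∈ F, ∀ j, ∀ k < K, (T.st k i).decision = none →
    (T.wire k i j).tokens = (T.st k i).outbox
  quiet : ∀ i ∈ F, ∀ j, ∀ k < K, (T.st k i).decision ≠ none → (T.wire k i j).tokens = []

variable {T : Rounds n V} {p : Params n V} {F : Finset (Fin n)} {K : ℕ}

namespace Follows

variable {i j : Fin n} {k k' : ℕ}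

theorem step_cases (h : T.Follows p F K) (hi : i ∈ F) (hk : k < K) :
    (T.st k i).decision ≠ none ∧ T.st (k + 1) i = T.st k i ∨
    (T.st k i).decision = none ∧ (∃ o, p.verdict (T.st k i) (T.heard k i) (T.sab k i) = some o ∧
      T.st (k + 1) i = { T.st k i with outbox := [], decision := some o }) ∨
    (T.st k i).decision = none ∧ p.verdict (T.st k i) (T.heard k i) (T.sab k i) = none ∧
      T.st (k + 1) i = p.next i (T.st k i) (T.heard k i) (T.auth k i) := by
  by_cases hd : (T.st k i).decision = none
  · rw [h.step i hi k hk hd]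
    obtain ⟨o, h1, h2⟩ | h1 := Params.step_cases (p := p) (i := i) (s := T.st k i)
      (inbox := fun j => T.wire k j i) (a := T.auth k i) (b := T.sab k i)
    · exact .inr (.inl ⟨hd, o, h1, h2⟩)
    · exact .inr (.inr ⟨hd, h1⟩)
  · exact .inl ⟨hd, h.stay i hi k hk hd⟩

theorem next_of_undecided (h : T.Follows p F K) (hi : i ∈ F) (hk : k < K)
    (hu : (T.st (k + 1) i).decision = none) :
    (T.st k i).decision = none ∧ p.verdict (T.st k i) (T.heard k i) (T.sab k i) = none ∧
      T.st (k + 1) i = p.next i (T.st k i) (T.heard k i) (T.auth k i) := by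
  obtain ⟨h1, h2⟩ | ⟨-, o, -, h2⟩ | h1 := h.step_cases hi hk
  · exact absurd (h2 ▸ hu) h1
  · rw [h2] at hu; simp at hu
  · exact h1

theorem undecided_of_le (h : T.Follows p F K) (hi : i ∈ F) (hkk : k ≤ k') (hk : k' ≤ K)
    (hu : (T.st k' i).decision = none) : (T.st k i).decision = none := by
  induction k', hkk using Nat.le_induction with
  | base => exact hu
  | succ m _ ih => exact ih (by omega) (h.next_of_undecided hi (by omega) hu).1

theorem decision_of_le (h : T.Follows p F K) (hi : i ∈ F) (hkk : k ≤ k') (hk : k' ≤ K)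
    {o : Option V} (hd : (T.st k i).decision = some o) : (T.st k' i).decision = some o := by
  induction k', hkk using Nat.le_induction with
  | base => exact hd
  | succ m _ ih =>
    have := ih (by omega)
    rw [h.stay i hi m (by omega) (by simp [this]), this]

theorem clock (h : T.Follows p F K) (hi : i ∈ F) (hk : k ≤ K)
    (hu : (T.st k i).decision = none) : (T.st k i).clock = k := by
  induction k with
  | zero => rw [h.init i hi]; rfl
  | succ k ih =>
    obtain ⟨h1, -, h2⟩ := h.next_of_undecided hi (by omega) hu
    rw [h2]
    exact congrArg (· + 1) (ih (by omega) h1)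

theorem issued_mono (h : T.Follows p F K) (hi : i ∈ F) (hkk : k ≤ k') (hk : k' ≤ K)
    {t : Token n} (ht : t ∈ p.issued i (T.st k i)) : t ∈ p.issued i (T.st k' i) := by
  induction k', hkk using Nat.le_induction with
  | base => exact ht
  | succ m _ ih =>
    obtain ⟨-, h2⟩ | ⟨-, o, -, h2⟩ | ⟨-, -, h2⟩ := h.step_cases hi (k := m) (by omega)
    · rw [h2]; exact ih (by omega)
    · rw [h2]; exact ih (by omega)
    · rw [h2]; exact (Params.issued_sublist _).subset (ih (by omega))

/-- How a value that only changes in rounds without a decision is set. -/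
theorem exists_set (h : T.Follows p F K) (f : JugState n V → Option V)
    (h0 : ∀ i v, f (p.initial i v) = none)
    (hdec : ∀ s o, f { s with outbox := [], decision := some o } = f s)
    (hi : i ∈ F) (hk : k ≤ K) {v : V} (hv : f (T.st k i) = some v) :
    ∃ a < k, (T.st a i).decision = none ∧ f (T.st a i) ≠ some v ∧
      T.st (a + 1) i = p.next i (T.st a i) (T.heard a i) (T.auth a i) ∧
      f (p.next i (T.st a i) (T.heard a i) (T.auth a i)) = some v := by
  induction k with
  | zero => rw [h.init i hi, h0] at hv; simp at hv
  | succ k ih =>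
    by_cases hv' : f (T.st k i) = some v
    · obtain ⟨a, ha, h1⟩ := ih (by omega) hv'
      exact ⟨a, by omega, h1⟩
    · obtain ⟨-, h2⟩ | ⟨-, o, -, h2⟩ | ⟨h1, -, h2⟩ := h.step_cases hi (k := k) (by omega)
      · exact absurd (h2 ▸ hv) hv'
      · rw [h2, hdec] at hv; exact absurd hv hv'
      · exact ⟨k, by omega, h1, hv', h2, h2 ▸ hv⟩

theorem exists_decision (h : T.Follows p F K) (hi : i ∈ F) (hk : k ≤ K) {o : Option V}
    (ho : (T.st k i).decision = some o) :
    ∃ a < k, (T.st a i).decision = none ∧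
      p.verdict (T.st a i) (T.heard a i) (T.sab a i) = some o := by
  induction k with
  | zero => rw [h.init i hi] at ho; simp [Params.initial] at ho
  | succ k ih =>
    obtain ⟨-, h2⟩ | ⟨h1, o', h3, h2⟩ | ⟨-, -, h2⟩ := h.step_cases hi (k := k) (by omega)
    · obtain ⟨a, ha, h1⟩ := ih (by omega) (h2 ▸ ho)
      exact ⟨a, by omega, h1⟩
    · rw [h2] at ho
      exact ⟨k, by omega, h1, by rw [h3]; exact ho⟩
    · rw [h2] at ho; simp [Params.next, Params.update] at ho

theorem outbox_subset (h : T.Follows p F K) (hi : i ∈ F) (hk : k ≤ K) {t : Token n}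
    (ht : t ∈ (T.st k i).outbox) : t ∈ p.issued i (T.st k i) := by
  induction k with
  | zero => rw [h.init i hi] at ht ⊢; rwa [← Params.outbox_initial]
  | succ k ih =>
    by_cases hd : (T.st k i).decision = none
    · rw [h.step i hi k (by omega) hd] at ht ⊢
      exact Params.outbox_step_subset t ht
    · have hst := h.stay i hi k (by omega) hd
      rw [hst] at ht ⊢
      exact ih (by omega) ht

theorem exists_outbox (h : T.Follows p F K) (hi : i ∈ F) (hk : k ≤ K) {t : Token n}
    (ht : t ∈ p.issued i (T.st k i)) :
    ∃ a ≤ k, (T.st a i).decision = none ∧ t ∈ (T.st a i).outbox := by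
  induction k with
  | zero =>
    rw [h.init i hi, ← Params.outbox_initial] at ht
    refine ⟨0, le_rfl, ?_, ?_⟩
    · rw [h.init i hi]; rfl
    · rw [h.init i hi]; exact ht
  | succ k ih =>
    have old : t ∈ p.issued i (T.st k i) →
        ∃ a ≤ k + 1, (T.st a i).decision = none ∧ t ∈ (T.st a i).outbox := fun ht => by
      obtain ⟨a, ha, h1⟩ := ih (by omega) ht
      exact ⟨a, by omega, h1⟩
    by_cases hd : (T.st k i).decision = none
    · have hst := h.step i hi k (by omega) hd
      obtain h1 | ⟨h1, h2⟩ := Params.mem_issued_step (hst ▸ ht)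
      · exact old h1
      · exact ⟨k + 1, le_rfl, hst ▸ h2, hst ▸ h1⟩
    · exact old (h.stay i hi k (by omega) hd ▸ ht)

theorem heard_succ (h : T.Follows p F K) (hj : j ∈ F) (hk : k < K)
    (hu : (T.st (k + 1) j).decision = none) : (T.st (k + 1) j).heard = T.heard k j := by
  rw [(h.next_of_undecided hj hk hu).2.2]; rfl

theorem heard_mono (h : T.Follows p F K) (hj : j ∈ F) (hkk : k ≤ k') (hk : k' ≤ K)
    (hu : (T.st k' j).decision = none) : T.heard k j ⊆ T.heard k' j := by
  induction k', hkk using Nat.le_induction with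
  | base => exact subset_rfl
  | succ m _ ih =>
    refine (ih (by omega) (h.next_of_undecided hj (by omega) hu).1).trans ?_
    rw [← h.heard_succ hj (by omega) hu]
    exact Params.subset_hear

/-- What a party in `F` has issued reaches the parties in `F`. -/
theorem mem_heard (h : T.Follows p F K) (hi : i ∈ F) (hj : j ∈ F) (hk : k < K)
    (hu : (T.st k j).decision = none) {t : Token n} (ht : t ∈ p.issued i (T.st k i)) :
    (i, t) ∈ T.heard k j := by
  obtain ⟨a, ha, h1, h2⟩ := h.exists_outbox hi hk.le ht
  refine h.heard_mono hj ha hk.le hu (Or.inr ?_)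
  change t ∈ (T.wire a i j).tokens
  rwa [h.sent i hi j a (by omega) h1]

theorem issued_of_mem_wire (h : T.Follows p F K) (hi : i ∈ F) (hk : k < K) {t : Token n}
    (ht : t ∈ (T.wire k i j).tokens) : t ∈ p.issued i (T.st k i) := by
  by_cases hd : (T.st k i).decision = none
  · rw [h.sent i hi j k hk hd] at ht
    exact h.outbox_subset hi hk.le ht
  · rw [h.quiet i hi j k hk hd] at ht
    simp at ht

/-- What was received from a party in `F` was issued by it. -/
theorem issued_of_mem_heard (h : T.Follows p F K) (hi : i ∈ F) (hj : j ∈ F) (hk : k < K)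
    {t : Token n} (ht : (i, t) ∈ T.heard k j) : t ∈ p.issued i (T.st k i) := by
  have hwire : ∀ m < K, t ∈ (T.wire m i j).tokens → t ∈ p.issued i (T.st m i) := fun m hm ht =>
    h.issued_of_mem_wire hi hm ht
  have hst : ∀ m < K, (i, t) ∈ (T.st m j).heard → t ∈ p.issued i (T.st m i) := by
    intro m
    induction m with
    | zero => intro _ ht; rw [h.init j hj] at ht; simp [Params.initial] at ht
    | succ m ih =>
      intro hm ht
      refine h.issued_mono hi (Nat.le_succ m) hm.le ?_
      obtain ⟨-, h2⟩ | ⟨-, o, -, h2⟩ | ⟨-, -, h2⟩ := h.step_cases hj (k := m) (by omega)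
      · exact ih (by omega) (h2 ▸ ht)
      · rw [h2] at ht; exact ih (by omega) ht
      · rw [h2] at ht
        obtain ht | ht := ht
        · exact ih (by omega) ht
        · exact hwire m (by omega) ht
  obtain ht | ht := ht
  · exact hst k hk ht
  · exact hwire k hk ht

/-! #### Supporters -/

/-- Supporters are counted by signatures received directly from the signer, so a supporter in `F`
has really issued its signature. The channels suffice for this, even if all signatures can be
forged. -/
theorem exists_supporter (h : T.Follows p F K) (hj : j ∈ F) (hk : k < K) {τ : Topic} {v : V}
    (hc : Fᶜ.card < (p.supporters (T.heard k j) τ v).card) :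
    ∃ l ∈ F, Token.sig l (p.stmt τ v) ∈ p.issued l (T.st k l) := by
  obtain ⟨l, hl, hl'⟩ := Finset.exists_mem_notMem_of_card_lt_card hc
  rw [Finset.mem_compl, not_not] at hl'
  exact ⟨l, hl', h.issued_of_mem_heard hl' hj hk (Params.mem_supporters.mp hl)⟩

/-- Parties in `F` send their tokens to everybody. Hence what one party in `F` has counted, another
one counts as well, up to the parties outside `F`. -/
theorem card_supporters_le (h : T.Follows p F K) (hi : i ∈ F) (hj : j ∈ F) (hkk : k ≤ k')
    (hk : k' < K) (hu : (T.st k' j).decision = none) {τ : Topic} {v : V} :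
    (p.supporters (T.heard k i) τ v).card ≤
      (p.supporters (T.heard k' j) τ v).card + Fᶜ.card := by
  classical
  have hsub : p.supporters (T.heard k i) τ v ⊆ p.supporters (T.heard k' j) τ v ∪ Fᶜ := by
    intro l hl
    by_cases hlF : l ∈ F
    · refine Finset.mem_union_left _ (Params.mem_supporters.mpr ?_)
      refine h.mem_heard hlF hj hk hu (h.issued_mono hlF hkk hk.le ?_)
      exact h.issued_of_mem_heard hlF hi (by omega) (Params.mem_supporters.mp hl)
    · exact Finset.mem_union_right _ (Finset.mem_compl.mpr hlF)
  exact (Finset.card_le_card hsub).trans (Finset.card_union_le _ _)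

theorem card_le_supporters (h : T.Follows p F K) (hj : j ∈ F) (hk : k < K)
    (hu : (T.st k j).decision = none) {τ : Topic} {v : V}
    (hv : ∀ l ∈ F, Token.sig l (p.stmt τ v) ∈ p.issued l (T.st k l)) :
    F.card ≤ (p.supporters (T.heard k j) τ v).card :=
  Finset.card_le_card fun l hl =>
    Params.mem_supporters.mpr (h.mem_heard hl hj hk hu (hv l hl))

/-! #### How the fields of a state are set -/

theorem input_eq (h : T.Follows p F K) (hi : i ∈ F) (hk : k ≤ K) :
    (T.st k i).input = (T.st 0 i).input := by
  have h0 := h.issued_mono hi (Nat.zero_le k) hk (Params.sig_input_issued.mpr rfl)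
  exact Params.sig_input_issued.mp h0

theorem cand_mono (h : T.Follows p F K) (hi : i ∈ F) (hkk : k ≤ k') (hk : k' ≤ K) {v : V}
    (hv : (T.st k i).cand = some v) : (T.st k' i).cand = some v :=
  Params.sig_relay_issued.mp (h.issued_mono hi hkk hk (Params.sig_relay_issued.mpr hv))

theorem vote_mono (h : T.Follows p F K) (hi : i ∈ F) (hkk : k ≤ k') (hk : k' ≤ K) {v : V}
    (hv : (T.st k i).vote = some v) : (T.st k' i).vote = some v :=
  Params.sig_vote_issued.mp (h.issued_mono hi hkk hk (Params.sig_vote_issued.mpr hv))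

theorem commit_mono (h : T.Follows p F K) (hi : i ∈ F) (hkk : k ≤ k') (hk : k' ≤ K) {v : V}
    (hv : (T.st k i).commit = some v) : (T.st k' i).commit = some v :=
  Params.sig_commit_issued.mp (h.issued_mono hi hkk hk (Params.sig_commit_issued.mpr hv))

theorem strong_set (h : T.Follows p F K) (hi : i ∈ F) (hk : k ≤ K) {v : V}
    (hv : (T.st k i).strong = some v) :
    0 < k ∧ n - p.ti ≤ (p.supporters (T.heard 0 i) .input v).card ∧
      (T.st 1 i).strong = some v := by
  obtain ⟨a, ha, hu, h1, h2, h3⟩ := h.exists_set JugState.strong (fun _ _ => rfl) (fun _ _ => rfl)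
    hi hk hv
  obtain h4 | ⟨-, h4⟩ := Option.or_eq_some_iff.mp h3
  · exact absurd h4 h1
  · split_ifs at h4 with hc
    rw [h.clock hi (by omega) hu] at hc
    subst hc
    exact ⟨ha, pick_spec (p := fun v => n - p.ti ≤ (p.supporters (T.heard 0 i) .input v).card) h4,
      by rw [h2]; exact h3⟩

theorem cand_set (h : T.Follows p F K) (hi : i ∈ F) (hk : k ≤ K) {v : V}
    (hv : (T.st k i).cand = some v) :
    ∃ a < k, (T.st a i).decision = none ∧ (T.st a i).cand = none ∧
      p.candidate (T.st a i) (T.auth a i) = some v := by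
  obtain ⟨a, ha, hu, h1, -, h3⟩ := h.exists_set JugState.cand (fun _ _ => rfl) (fun _ _ => rfl)
    hi hk hv
  obtain h4 | ⟨h4, h5⟩ := Option.or_eq_some_iff.mp h3
  · exact absurd h4 h1
  · exact ⟨a, ha, hu, h4, h5⟩

theorem quorum_set (h : T.Follows p F K) (hi : i ∈ F) (hk : k ≤ K) {v : V}
    (hv : (T.st k i).quorum = some v) :
    ∃ a < k, (T.st a i).decision = none ∧
      n - p.ts ≤ (p.supporters (T.heard a i) .relay v).card := by
  obtain ⟨a, ha, hu, h1, -, h3⟩ := h.exists_set JugState.quorum (fun _ _ => rfl) (fun _ _ => rfl)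
    hi hk hv
  obtain h4 | ⟨-, h4⟩ := Option.or_eq_some_iff.mp h3
  · exact absurd h4 h1
  · exact ⟨a, ha, hu,
      pick_spec (p := fun v => n - p.ts ≤ (p.supporters (T.heard a i) .relay v).card) h4⟩

theorem vote_set (h : T.Follows p F K) (hi : i ∈ F) (hk : k ≤ K) {v : V}
    (hv : (T.st k i).vote = some v) :
    ∃ a < k, (T.st a i).decision = none ∧ (T.st a i).quorum = some v ∧
      ∀ w, p.Certified (T.heard a i) (n - p.ts) .relay w → w = v := by
  obtain ⟨a, ha, hu, h1, -, h3⟩ := h.exists_set JugState.vote (fun _ _ => rfl) (fun _ _ => rfl)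
    hi hk hv
  obtain h4 | ⟨-, h4⟩ := Option.or_eq_some_iff.mp h3
  · exact absurd h4 h1
  · exact ⟨a, ha, hu, pick_spec (p := fun v => (T.st a i).quorum = some v ∧
      ∀ w, p.Certified (T.heard a i) (n - p.ts) .relay w → w = v) h4⟩

theorem commit_set (h : T.Follows p F K) (hi : i ∈ F) (hk : k ≤ K) {v : V}
    (hv : (T.st k i).commit = some v) :
    ∃ a < k, (T.st a i).decision = none ∧
      n - p.ts ≤ (p.supporters (T.heard a i) .vote v).card := by
  obtain ⟨a, ha, hu, h1, -, h3⟩ := h.exists_set JugState.commit (fun _ _ => rfl) (fun _ _ => rfl)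
    hi hk hv
  obtain h4 | ⟨-, h4⟩ := Option.or_eq_some_iff.mp h3
  · exact absurd h4 h1
  · exact ⟨a, ha, hu,
      pick_spec (p := fun v => n - p.ts ≤ (p.supporters (T.heard a i) .vote v).card) h4⟩

/-- A decision is taken early, with enough commitments, or at the very end. -/
theorem decision_set (h : T.Follows p F K) (hi : i ∈ F) (hk : k ≤ K) {o : Option V}
    (ho : (T.st k i).decision = some o) :
    (∃ a < k, (T.st a i).decision = none ∧ a + 1 ≤ p.fallback ∧ (T.st a i).cand.isSome = true ∧
      (T.st a i).vote.isSome = true ∧ (T.st a i).commit.isSome = true ∧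
      ∃ v, o = some v ∧ n - p.ts ≤ (p.supporters (T.heard a i) .commit v).card) ∨
    (∃ a < k, (T.st a i).decision = none ∧ a + 1 = p.finish ∧
      o = (T.st a i).lock.or ((T.sab a i).out.getD none)) := by
  obtain ⟨a, ha, hu, h1⟩ := h.exists_decision hi hk ho
  have hc := h.clock hi (by omega) hu
  unfold Params.verdict at h1
  split_ifs at h1 with h2 h3
  · obtain ⟨h4, h5, h6, h7, v, hv⟩ := h2
    obtain ⟨w, h8, h9⟩ := exists_pick
      (p := fun v => n - p.ts ≤ (p.supporters (T.heard a i) .commit v).card) hv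
    rw [hc] at h4
    refine .inl ⟨a, ha, hu, h4, h5, h6, h7, w, ?_, h9⟩
    rw [← Option.some.inj h1, ← h8]
  · exact .inr ⟨a, ha, hu, by omega, (Option.some.inj h1).symm⟩

/-- Without an output of the authenticated protocol, a candidate arises only at the deadline, which
is at least 3. -/
theorem cand_eq_none (h : T.Follows p F K) (hi : i ∈ F) (hk : k ≤ K) (hk2 : k ≤ 2)
    (hq : ∀ k < 2, k < K → (T.auth k i).out = none) : (T.st k i).cand = none := by
  by_contra hne
  obtain ⟨v, hv⟩ := Option.ne_none_iff_exists'.mp hne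
  obtain ⟨a, ha, hu, -, h1⟩ := h.cand_set hi hk hv
  unfold Params.candidate at h1
  rw [h.clock hi (by omega) hu, hq a (by omega) (by omega)] at h1
  simp only [Option.isSome_none, Bool.false_eq_true, false_and, false_or, Params.deadline] at h1
  rw [if_neg (by omega)] at h1
  simp at h1

theorem undecided_of_le_two (h : T.Follows p F K) (hi : i ∈ F) (hk : k ≤ K) (hk2 : k ≤ 2)
    (hq : ∀ k < 2, k < K → (T.auth k i).out = none) : (T.st k i).decision = none := by
  by_contra hne
  obtain ⟨o, ho⟩ := Option.ne_none_iff_exists'.mp hne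
  obtain ⟨a, ha, -, -, h1, -⟩ | ⟨a, ha, -, h1, -⟩ := h.decision_set hi hk ho
  · rw [h.cand_eq_none hi (by omega) (by omega) hq] at h1
    simp at h1
  · simp only [Params.finish, Params.fallback, Params.deadline] at h1
    omega

/-! #### Agreement -/

/-- Whoever votes has already circulated its quorum certificate. Of two voters the later one has
received the certificate of the earlier one, and would not have voted for another value. Neither the
number of corruptions nor the security of signatures plays a role. -/
theorem vote_unique (h : T.Follows p F K) (hi : i ∈ F) (hj : j ∈ F) (hk : k < K) (hk' : k' < K)
    {v w : V} (hv : (T.st k i).vote = some v) (hw : (T.st k' j).vote = some w) : v = w := by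
  have key : ∀ {i j : Fin n} {v w : V} {a b : ℕ}, i ∈ F → j ∈ F → a ≤ b → b < K →
      (T.st a i).quorum = some v → (T.st b j).decision = none →
      (∀ w', p.Certified (T.heard b j) (n - p.ts) .relay w' → w' = w) → v = w := by
    intro i j v w a b hi hj hab hb h1 h2 h3
    exact h3 v ⟨i, h.mem_heard hi hj hb h2
      (h.issued_mono hi hab hb.le (Params.cert_relay_issued h1))⟩
  obtain ⟨a, ha, ha1, ha2, ha3⟩ := h.vote_set hi hk.le hv
  obtain ⟨b, hb, hb1, hb2, hb3⟩ := h.vote_set hj hk'.le hw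
  obtain hab | hab := le_total a b
  · exact key hi hj hab (by omega) ha2 hb1 hb3
  · exact (key hj hi hab (by omega) hb2 ha1 ha3).symm

/-- Behind each commitment there is a vote of a party in `F`, because `n - ts` exceeds the number of
parties outside `F`. -/
theorem commit_unique (h : T.Follows p F K) (hF : Fᶜ.card < n - p.ts) (hi : i ∈ F) (hj : j ∈ F)
    (hk : k ≤ K) (hk' : k' ≤ K) {v w : V} (hv : (T.st k i).commit = some v)
    (hw : (T.st k' j).commit = some w) : v = w := by
  obtain ⟨a, ha, -, ha2⟩ := h.commit_set hi hk hv
  obtain ⟨b, hb, -, hb2⟩ := h.commit_set hj hk' hw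
  obtain ⟨l, hl, hl2⟩ := h.exists_supporter hi (by omega) (hF.trans_le ha2)
  obtain ⟨m, hm, hm2⟩ := h.exists_supporter hj (by omega) (hF.trans_le hb2)
  exact h.vote_unique hl hm (by omega) (by omega) (Params.sig_vote_issued.mp hl2)
    (Params.sig_vote_issued.mp hm2)

theorem exists_commit (h : T.Follows p F K) (hi : i ∈ F) (hk : k < K) {v : V}
    (hc : Fᶜ.card < (p.supporters (T.heard k i) .commit v).card) :
    ∃ l ∈ F, (T.st k l).commit = some v := by
  obtain ⟨l, hl, h1⟩ := h.exists_supporter hi hk hc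
  exact ⟨l, hl, Params.sig_commit_issued.mp h1⟩

theorem quit_of_decision (h : T.Follows p F K) (hi : i ∈ F) (hk : k ≤ K) (hkf : k < p.finish)
    {o : Option V} (ho : (T.st k i).decision = some o) :
    ∃ a < k, (T.st a i).decision = none ∧ a + 1 ≤ p.fallback ∧ ∃ v, o = some v ∧
      n - p.ts ≤ (p.supporters (T.heard a i) .commit v).card := by
  obtain ⟨a, ha, h1, h2, -, -, -, h3⟩ | ⟨a, ha, -, h1, -⟩ := h.decision_set hi hk ho
  · exact ⟨a, ha, h1, h2, h3⟩
  · omega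

/-- Before `finish` every decision rests on `n - ts` commitments, at least one of them from `F`. -/
theorem decision_unique (h : T.Follows p F K) (hF : Fᶜ.card < n - p.ts) (hi : i ∈ F) (hj : j ∈ F)
    (hk : k ≤ K) (hk' : k' ≤ K) (hkf : k < p.finish) (hkf' : k' < p.finish) {v w : Option V}
    (hv : (T.st k i).decision = some v) (hw : (T.st k' j).decision = some w) : v = w := by
  obtain ⟨a, ha, -, -, v, rfl, ha2⟩ := h.quit_of_decision hi hk hkf hv
  obtain ⟨b, hb, -, -, w, rfl, hb2⟩ := h.quit_of_decision hj hk' hkf' hw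
  obtain ⟨l, hl, hl2⟩ := h.exists_commit hi (by omega) (hF.trans_le ha2)
  obtain ⟨m, hm, hm2⟩ := h.exists_commit hj (by omega) (hF.trans_le hb2)
  rw [h.commit_unique hF hl hm (by omega) (by omega) hl2 hm2]

theorem next_at_fallback (h : T.Follows p F K) (hj : j ∈ F) (hK : p.fallback ≤ K)
    (hu : (T.st p.fallback j).decision = none) :
    (T.st (p.fallback - 1) j).decision = none ∧
    (T.st p.fallback j).lock = (pick fun v =>
      p.ti + 1 ≤ (p.supporters (T.heard (p.fallback - 1) j) .commit v).card) ∧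
    (T.st p.fallback j).sabInput = ((pick fun v =>
      p.ti + 1 ≤ (p.supporters (T.heard (p.fallback - 1) j) .vote v).card).or
        (T.st (p.fallback - 1) j).cand).getD p.default := by
  have hf : p.fallback - 1 + 1 = p.fallback := by simp only [Params.fallback]; omega
  obtain ⟨h1, -, h2⟩ := h.next_of_undecided (k := p.fallback - 1) hj (by omega) (by rwa [hf])
  rw [hf] at h2
  have hc := h.clock hj (by omega) h1
  refine ⟨h1, ?_, ?_⟩
  · rw [h2]
    simp only [Params.next, Params.update]
    rw [if_pos (by omega)]
  · rw [h2]
    simp only [Params.next, Params.update]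
    rw [if_pos (by omega)]

/-- If some party decides early then all other parties lock its decision. -/
theorem lock_of_decision (h : T.Follows p F K) (hF : Fᶜ.card ≤ p.ti)
    (hn : 2 * p.ti + p.ts < n) (hK : p.fallback ≤ K) (hi : i ∈ F) (hj : j ∈ F)
    {o : Option V} (ho : (T.st p.fallback i).decision = some o)
    (hu : (T.st p.fallback j).decision = none) :
    (T.st p.fallback j).lock = o ∧ o ≠ none := by
  have hf : p.fallback - 1 + 1 = p.fallback := by simp only [Params.fallback]; omega
  obtain ⟨a, ha, -, -, v, rfl, ha2⟩ := h.quit_of_decision hi hK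
    (by simp only [Params.finish]; omega) ho
  obtain ⟨h1, h2, -⟩ := h.next_at_fallback hj hK hu
  -- Of the `n - ts` commitments at most `ti` fail to reach party `j`, and `n - ts - ti ≥ ti + 1`.
  have h3 := h.card_supporters_le hi hj (k := a) (k' := p.fallback - 1) (by omega) (by omega) h1
    (τ := .commit) (v := v)
  obtain ⟨w, h4, h5⟩ := exists_pick (p := fun v =>
    p.ti + 1 ≤ (p.supporters (T.heard (p.fallback - 1) j) .commit v).card) (v := v) (by omega)
  obtain ⟨l, hl, hl2⟩ := h.exists_commit hi (k := a) (v := v) (by omega) (by omega)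
  obtain ⟨m, hm, hm2⟩ := h.exists_commit hj (k := p.fallback - 1) (v := w) (by omega) (by omega)
  have : v = w := h.commit_unique (by omega) hl hm (by omega) (by omega) hl2 hm2
  subst this
  exact ⟨h2.trans h4, by simp⟩

/-- A locked value is the common input to the sabotaged protocol. -/
theorem sabInput_of_lock (h : T.Follows p F K) (hF : Fᶜ.card ≤ p.ti)
    (hn : 2 * p.ti + p.ts < n) (hK : p.fallback ≤ K) (hi : i ∈ F) (hj : j ∈ F)
    (hui : (T.st p.fallback i).decision = none) (huj : (T.st p.fallback j).decision = none)
    {v : V} (hv : (T.st p.fallback i).lock = some v) : (T.st p.fallback j).sabInput = v := by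
  have hf : p.fallback - 1 + 1 = p.fallback := by simp only [Params.fallback]; omega
  obtain ⟨h1, h2, -⟩ := h.next_at_fallback hi hK hui
  obtain ⟨h3, -, h4⟩ := h.next_at_fallback hj hK huj
  rw [h2] at hv
  have hv := pick_spec (p := fun v =>
    p.ti + 1 ≤ (p.supporters (T.heard (p.fallback - 1) i) .commit v).card) hv
  obtain ⟨l, hl, hl2⟩ := h.exists_commit hi (k := p.fallback - 1) (v := v) (by omega) (by omega)
  obtain ⟨a, ha, -, ha2⟩ := h.commit_set hl (by omega) hl2
  -- The same count as for locks, one stage earlier: the committing party has seen `n - ts` votes,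
  -- of which party `j` has at least `ti + 1`.
  have h5 := h.card_supporters_le hl hj (k := a) (k' := p.fallback - 1) (by omega) (by omega) h3
    (τ := .vote) (v := v)
  obtain ⟨w, h6, h7⟩ := exists_pick (p := fun v =>
    p.ti + 1 ≤ (p.supporters (T.heard (p.fallback - 1) j) .vote v).card) (v := v) (by omega)
  obtain ⟨x, hx, hx2⟩ := h.exists_supporter hl (k := a) (τ := .vote) (v := v) (by omega) (by omega)
  obtain ⟨y, hy, hy2⟩ := h.exists_supporter hj (k := p.fallback - 1) (τ := .vote) (v := w)
    (by omega) (by omega)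
  have : v = w := h.vote_unique hx hy (by omega) (by omega) (Params.sig_vote_issued.mp hx2)
    (Params.sig_vote_issued.mp hy2)
  subst this
  rw [h4, h6]
  rfl

end Follows

end Rounds

end

/-! ### Unanimous candidates and unanimous inputs -/

section

variable {n : ℕ} {V : Type}

namespace Rounds

variable {T : Rounds n V} {p : Params n V} {F : Finset (Fin n)} {K : ℕ}

/-- Candidates of the parties in `F` are `v`. -/
def Candidates (T : Rounds n V) (F : Finset (Fin n)) (K : ℕ) (v : V) : Prop :=
  ∀ i ∈ F, ∀ k ≤ K, ∀ w, (T.st k i).cand = some w → w = v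

/-- Threshold signatures received contain the contributions of the parties in `F`. -/
def Sound (T : Rounds n V) (p : Params n V) (F : Finset (Fin n)) (K : ℕ) : Prop :=
  ∀ j ∈ F, ∀ k < K, ∀ i m x, (i, Token.cert m x) ∈ T.heard k j →
    ∃ S : Finset (Fin n), m ≤ S.card ∧ ∀ l ∈ S, l ∈ F → Token.sig l x ∈ p.issued l (T.st k l)

/-- The authenticated protocol has no output in the first two rounds. -/
def Quiet (T : Rounds n V) (F : Finset (Fin n)) (K : ℕ) : Prop :=
  ∀ i ∈ F, ∀ k < 2, k < K → (T.auth k i).out = none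

theorem exists_mem_of_card_lt {S : Finset (Fin n)} (h : Fᶜ.card < S.card) : ∃ l ∈ S, l ∈ F := by
  obtain ⟨l, hl, hl'⟩ := Finset.exists_mem_notMem_of_card_lt_card h
  exact ⟨l, hl, by simpa using hl'⟩

namespace Follows

variable {i j : Fin n} {k k' : ℕ}

theorem strong_mono (h : T.Follows p F K) (hi : i ∈ F) (hkk : k ≤ k') (hk : k' ≤ K) {v : V}
    (hv : (T.st k i).strong = some v) : (T.st k' i).strong = some v := by
  induction k', hkk using Nat.le_induction with
  | base => exact hv
  | succ m _ ih =>
    have ih := ih (by omega)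
    obtain ⟨-, h2⟩ | ⟨-, o, -, h2⟩ | ⟨-, -, h2⟩ := h.step_cases hi (k := m) (by omega)
    · rw [h2, ih]
    · rw [h2]; exact ih
    · rw [h2]; simp [Params.next, Params.update, ih]

/-- At the deadline an undecided party is forced to adopt a candidate, and an early decision
requires one. -/
theorem cand_isSome (h : T.Follows p F K) (hi : i ∈ F) (hd : p.deadline ≤ k) (hk : k ≤ K) :
    (T.st k i).cand.isSome = true := by
  suffices hs : (T.st p.deadline i).cand.isSome = true by
    obtain ⟨v, hv⟩ := Option.isSome_iff_exists.mp hs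
    rw [h.cand_mono hi hd hk hv]; rfl
  cases ho : (T.st p.deadline i).decision with
  | none =>
    have hf : p.deadline - 1 + 1 = p.deadline := by simp only [Params.deadline]; omega
    obtain ⟨h1, -, h2⟩ := h.next_of_undecided (k := p.deadline - 1) hi (by omega) (by rwa [hf])
    rw [hf] at h2
    have hc := h.clock hi (by omega) h1
    rw [h2]
    simp only [Params.next, Params.update, Params.candidate, Option.isSome_or]
    rw [if_pos (by right; omega)]
    simp
  | some o =>
    obtain ⟨a, ha, -, -, h1, -⟩ | ⟨a, ha, -, h1, -⟩ := h.decision_set hi (by omega) ho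
    · obtain ⟨v, hv⟩ := Option.isSome_iff_exists.mp h1
      rw [h.cand_mono hi ha.le (by omega) hv]; rfl
    · simp only [Params.finish, Params.fallback] at h1
      omega

/-! #### Unanimous candidates -/

/-- Each of the following stages needs `n - ts` supporters, more than there are parties outside `F`.
So a value can enter a stage only if `F` has brought it to the preceding one, and by induction it is
the common candidate. -/
theorem quorum_eq (h : T.Follows p F K) (hc : T.Candidates F K v) (hF : Fᶜ.card < n - p.ts)
    (hi : i ∈ F) (hk : k ≤ K) {w : V} (hw : (T.st k i).quorum = some w) : w = v := by
  obtain ⟨a, ha, -, h1⟩ := h.quorum_set hi hk hw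
  obtain ⟨l, hl, h2⟩ := h.exists_supporter hi (by omega) (hF.trans_le h1)
  exact hc l hl a (by omega) w (Params.sig_relay_issued.mp h2)

theorem vote_eq (h : T.Follows p F K) (hc : T.Candidates F K v) (hF : Fᶜ.card < n - p.ts)
    (hi : i ∈ F) (hk : k ≤ K) {w : V} (hw : (T.st k i).vote = some w) : w = v := by
  obtain ⟨a, ha, -, h1, -⟩ := h.vote_set hi hk hw
  exact h.quorum_eq hc hF hi (by omega) h1

theorem commit_eq (h : T.Follows p F K) (hc : T.Candidates F K v) (hF : Fᶜ.card < n - p.ts)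
    (hi : i ∈ F) (hk : k ≤ K) {w : V} (hw : (T.st k i).commit = some w) : w = v := by
  obtain ⟨a, ha, -, h1⟩ := h.commit_set hi hk hw
  obtain ⟨l, hl, h2⟩ := h.exists_supporter hi (by omega) (hF.trans_le h1)
  exact h.vote_eq hc hF hl (by omega) (Params.sig_vote_issued.mp h2)

theorem decision_eq (h : T.Follows p F K) (hc : T.Candidates F K v) (hF : Fᶜ.card < n - p.ts)
    (hi : i ∈ F) (hk : k ≤ K) (hkf : k < p.finish) {o : Option V}
    (ho : (T.st k i).decision = some o) : o = some v := by
  obtain ⟨a, ha, -, -, w, rfl, h1⟩ := h.quit_of_decision hi hk hkf ho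
  obtain ⟨l, hl, h2⟩ := h.exists_commit hi (by omega) (hF.trans_le h1)
  rw [h.commit_eq hc hF hl (by omega) h2]

theorem stay_of_le (h : T.Follows p F K) (hi : i ∈ F) (hkk : k ≤ k') (hk : k' ≤ K)
    (hd : (T.st k i).decision ≠ none) : T.st k' i = T.st k i := by
  induction k', hkk using Nat.le_induction with
  | base => rfl
  | succ m _ ih =>
    have ih := ih (by omega)
    rw [h.stay i hi m (by omega) (by rwa [ih]), ih]

/-- After `fallback` early decisions are no longer allowed. Hence all honest parties that start the
sabotaged protocol stay with it to the end. -/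
theorem undecided_until_finish (h : T.Follows p F K) (hi : i ∈ F) (hk : p.fallback ≤ k)
    (hkf : k < p.finish) (hK : k ≤ K) (hu : (T.st p.fallback i).decision = none) :
    (T.st k i).decision = none := by
  induction k, hk using Nat.le_induction with
  | base => exact hu
  | succ k hk ih =>
    have hd := ih (by omega) (by omega)
    have hc := h.clock hi (by omega) hd
    obtain ⟨h1, -⟩ | ⟨-, o, h1, -⟩ | ⟨-, -, h1⟩ := h.step_cases hi (k := k) (by omega)
    · exact absurd hd h1
    · unfold Params.verdict at h1
      split_ifs at h1 with h2 h3
      · have := h2.1; omega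
      · omega
    · rw [h1]; rfl

theorem exists_wire (h : T.Follows p F K) (hj : j ∈ F) (hk : k < K) {t : Token n}
    (ht : (i, t) ∈ T.heard k j) : ∃ a ≤ k, t ∈ (T.wire a i j).tokens := by
  have hst : ∀ m < K, (i, t) ∈ (T.st m j).heard → ∃ a < m, t ∈ (T.wire a i j).tokens := by
    intro m
    induction m with
    | zero => intro _ ht; rw [h.init j hj] at ht; simp [Params.initial] at ht
    | succ m ih =>
      intro hm ht
      have old : (i, t) ∈ (T.st m j).heard → ∃ a < m + 1, t ∈ (T.wire a i j).tokens := fun ht => by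
        obtain ⟨a, ha, h1⟩ := ih (by omega) ht
        exact ⟨a, by omega, h1⟩
      obtain ⟨-, h2⟩ | ⟨-, o, -, h2⟩ | ⟨-, -, h2⟩ := h.step_cases hj (k := m) (by omega)
      · exact old (h2 ▸ ht)
      · rw [h2] at ht; exact old ht
      · rw [h2] at ht
        obtain ht | ht := ht
        · exact old ht
        · exact ⟨m, by omega, ht⟩
  obtain ht | ht := ht
  · obtain ⟨a, ha, h1⟩ := hst k hk ht
    exact ⟨a, ha.le, h1⟩
  · exact ⟨k, le_rfl, ht⟩

theorem lock_eq (h : T.Follows p F K) (hc : T.Candidates F K v) (hF : Fᶜ.card < n - p.ts)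
    (hF' : Fᶜ.card ≤ p.ti) (hK : p.fallback ≤ K) (hi : i ∈ F)
    (hu : (T.st p.fallback i).decision = none) {w : V} (hw : (T.st p.fallback i).lock = some w) :
    w = v := by
  have hf : p.fallback - 1 + 1 = p.fallback := by simp only [Params.fallback]; omega
  obtain ⟨h1, h2, -⟩ := h.next_at_fallback hi hK hu
  rw [h2] at hw
  have hv := pick_spec (p := fun v =>
    p.ti + 1 ≤ (p.supporters (T.heard (p.fallback - 1) i) .commit v).card) hw
  obtain ⟨l, hl, h2⟩ := h.exists_commit hi (k := p.fallback - 1) (v := w) (by omega) (by omega)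
  exact h.commit_eq hc hF hl (by omega) h2

theorem sabInput_eq (h : T.Follows p F K) (hc : T.Candidates F K v) (hF : Fᶜ.card < n - p.ts)
    (hF' : Fᶜ.card ≤ p.ti) (hK : p.fallback ≤ K) (hi : i ∈ F)
    (hu : (T.st p.fallback i).decision = none) : (T.st p.fallback i).sabInput = v := by
  have hf : p.fallback - 1 + 1 = p.fallback := by simp only [Params.fallback]; omega
  obtain ⟨h1, -, h2⟩ := h.next_at_fallback hi hK hu
  obtain ⟨w, hw⟩ := Option.isSome_iff_exists.mp (h.cand_isSome hi (k := p.fallback - 1)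
    (by simp only [Params.fallback]; omega) (by omega))
  have hwv := hc i hi _ (by omega) w hw
  subst hwv
  rw [h2, hw]
  cases hx : pick fun v => p.ti + 1 ≤ (p.supporters (T.heard (p.fallback - 1) i) .vote v).card with
  | none => rfl
  | some x =>
    have hv := pick_spec (p := fun v =>
      p.ti + 1 ≤ (p.supporters (T.heard (p.fallback - 1) i) .vote v).card) hx
    obtain ⟨l, hl, h2⟩ := h.exists_supporter hi (k := p.fallback - 1) (τ := .vote) (v := x)
      (by omega) (by omega)
    exact h.vote_eq hc hF hl (by omega) (Params.sig_vote_issued.mp h2)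

/-- If the parties in `F` have the same candidate then they decide on it within four rounds. -/
theorem decision_of_candidates (h : T.Follows p F K) (hs : T.Sound p F K)
    (hc : T.Candidates F K v) (hF : Fᶜ.card ≤ p.ts) (hn : 2 * p.ts < n) (hkd : k ≤ p.deadline)
    (hk : k + 4 ≤ K) (hsome : ∀ i ∈ F, (T.st k i).cand.isSome = true) (hi : i ∈ F) :
    (T.st (k + 4) i).decision = some (some v) := by
  have hF' : Fᶜ.card < n - p.ts := by omega
  have hcard : n - p.ts ≤ F.card := by
    have := Finset.card_compl F
    rw [Fintype.card_fin] at this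
    omega
  have hfin : k + 4 < p.finish := by simp only [Params.finish, Params.fallback]; omega
  have hcand : ∀ k', k ≤ k' → k' ≤ K → ∀ l ∈ F, (T.st k' l).cand = some v := by
    intro k' hkk hk' l hl
    obtain ⟨w, hw⟩ := Option.isSome_iff_exists.mp (hsome l hl)
    rw [h.cand_mono hl hkk hk' hw, hc l hl k (by omega) w hw]
  -- Parties that have already left do no harm: they issued all their signatures before.
  have hdec : ∀ k' ≤ k + 4, ∀ l ∈ F, (T.st k' l).decision ≠ none →
      (T.st k' l).vote.isSome = true ∧ (T.st k' l).commit.isSome = true := by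
    intro k' hk' l hl hne
    obtain ⟨o, ho⟩ := Option.ne_none_iff_exists'.mp hne
    obtain ⟨a, ha, -, -, -, h1, h2, -⟩ | ⟨a, ha, -, h1, -⟩ := h.decision_set hl (by omega) ho
    · obtain ⟨x, hx⟩ := Option.isSome_iff_exists.mp h1
      obtain ⟨y, hy⟩ := Option.isSome_iff_exists.mp h2
      rw [h.vote_mono hl ha.le (by omega) hx, h.commit_mono hl ha.le (by omega) hy]
      exact ⟨rfl, rfl⟩
    · omega
  -- One round per stage from here on: quorum at `k + 1`, vote at `k + 2`, commitment at `k + 3`,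
  -- decision at `k + 4`.
  have hquorum : ∀ l ∈ F, (T.st (k + 1) l).decision = none → (T.st (k + 1) l).quorum = some v := by
    intro l hl hu
    obtain ⟨h1, -, h2⟩ := h.next_of_undecided hl (by omega) hu
    obtain ⟨w, h3, -⟩ := exists_pick (p := fun v =>
      n - p.ts ≤ (p.supporters (T.heard k l) .relay v).card) (v := v)
      (hcard.trans (h.card_le_supporters hl (by omega) h1 fun x hx =>
        Params.sig_relay_issued.mpr (hcand k le_rfl (by omega) x hx)))
    have h4 : (T.st (k + 1) l).quorum.isSome = true := by
      rw [h2]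
      simp only [Params.next, Params.update, h3]
      simp
    obtain ⟨x, hx⟩ := Option.isSome_iff_exists.mp h4
    rw [hx, h.quorum_eq hc hF' hl (by omega) hx]
  have hvote : ∀ l ∈ F, (T.st (k + 2) l).vote = some v := by
    intro l hl
    suffices hv : (T.st (k + 2) l).vote.isSome = true by
      obtain ⟨x, hx⟩ := Option.isSome_iff_exists.mp hv
      rw [hx, h.vote_eq hc hF' hl (by omega) hx]
    by_cases hu : (T.st (k + 2) l).decision = none
    · obtain ⟨h1, -, h2⟩ := h.next_of_undecided (k := k + 1) hl (by omega) hu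
      -- A certificate for another value would contain a relay signature of a party in `F`, which
      -- signs only its candidate. This is the place where genuine certificates are needed.
      obtain ⟨w, h3, -⟩ := exists_pick (p := fun v => (T.st (k + 1) l).quorum = some v ∧
        ∀ w, p.Certified (T.heard (k + 1) l) (n - p.ts) .relay w → w = v) (v := v) (by
          refine ⟨hquorum l hl h1, fun w ⟨x, hw⟩ => ?_⟩
          obtain ⟨S, hS, hS2⟩ := hs l hl (k + 1) (by omega) _ _ _ hw
          obtain ⟨y, hy, hyF⟩ := exists_mem_of_card_lt (F := F) (hF'.trans_le hS)
          exact hc y hyF (k + 1) (by omega) w (Params.sig_relay_issued.mp (hS2 y hy hyF)))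
      rw [h2]
      simp only [Params.next, Params.update, h3]
      simp
    · exact (hdec _ (by omega) l hl hu).1
  have hcommit : ∀ l ∈ F, (T.st (k + 3) l).commit = some v := by
    intro l hl
    suffices hv : (T.st (k + 3) l).commit.isSome = true by
      obtain ⟨x, hx⟩ := Option.isSome_iff_exists.mp hv
      rw [hx, h.commit_eq hc hF' hl (by omega) hx]
    by_cases hu : (T.st (k + 3) l).decision = none
    · obtain ⟨h1, -, h2⟩ := h.next_of_undecided (k := k + 2) hl (by omega) hu
      obtain ⟨w, h3, -⟩ := exists_pick (p := fun v =>
        n - p.ts ≤ (p.supporters (T.heard (k + 2) l) .vote v).card) (v := v)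
        (hcard.trans (h.card_le_supporters hl (by omega) h1 fun x hx =>
          Params.sig_vote_issued.mpr (hvote x hx)))
      rw [h2]
      simp only [Params.next, Params.update, h3]
      simp
    · exact (hdec _ (by omega) l hl hu).2
  cases ho : (T.st (k + 4) i).decision with
  | some o => rw [h.decision_eq hc hF' hi (by omega) hfin ho]
  | none =>
    exfalso
    obtain ⟨h1, h2, -⟩ := h.next_of_undecided (k := k + 3) hi (by omega) ho
    unfold Params.verdict at h2
    rw [if_pos] at h2
    · simp at h2
    · refine ⟨?_, ?_, ?_, ?_, v, ?_⟩
      · rw [h.clock hi (by omega) h1]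
        simp only [Params.fallback]
        omega
      · rw [hcand _ (by omega) (by omega) i hi]; rfl
      · rw [h.vote_mono hi (Nat.le_succ _) (by omega) (hvote i hi)]; rfl
      · rw [hcommit i hi]; rfl
      · exact hcard.trans (h.card_le_supporters hi (by omega) h1 fun x hx =>
          Params.sig_commit_issued.mpr (hcommit x hx))

/-! #### Unanimous inputs -/

theorem two_le_of_candidate (h : T.Follows p F K) (hq : T.Quiet F K) (hi : i ∈ F) (hk : k < K)
    (hu : (T.st k i).decision = none) {v : V}
    (hv : p.candidate (T.st k i) (T.auth k i) = some v) :
    2 ≤ k ∧ (((T.auth k i).out.isSome = true ∧ (T.auth k i).halted = true) ∨ p.deadline ≤ k + 1) ∧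
      v = (T.st k i).strong.getD (((T.auth k i).out.getD none).getD p.default) := by
  unfold Params.candidate at hv
  rw [h.clock hi hk.le hu] at hv
  split_ifs at hv with hc
  refine ⟨?_, hc, (Option.some.inj hv).symm⟩
  by_contra hk2
  rw [hq i hi k (by omega) hk] at hc
  simp only [Option.isSome_none, Bool.false_eq_true, false_and, false_or, Params.deadline] at hc
  omega

/-- All parties in `F` sign `v`, which makes `n - ti` signatures, and any other set of `n - ti`
signers meets `F`. So `v` becomes strong and overrides whatever the authenticated protocol returns.
Certificates play no part, hence the argument covers the sabotaged setting. -/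
theorem candidates_of_inputs (h : T.Follows p F K) (hq : T.Quiet F K) (hF : Fᶜ.card ≤ p.ti)
    (hn : 2 * p.ti < n) {v : V} (hv : ∀ i ∈ F, (T.st 0 i).input = v) : T.Candidates F K v := by
  intro i hi k hk w hw
  obtain ⟨a, ha, hu, -, h1⟩ := h.cand_set hi hk hw
  obtain ⟨h2, -, h3⟩ := h.two_le_of_candidate hq hi (by omega) hu h1
  have hu1 := h.undecided_of_le hi (k := 1) (k' := a) (by omega) (by omega) hu
  obtain ⟨hu0, -, h4⟩ := h.next_of_undecided (k := 0) hi (by omega) hu1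
  have hcard : n - p.ti ≤ F.card := by
    have := Finset.card_compl F
    rw [Fintype.card_fin] at this
    omega
  obtain ⟨x, h5, h6⟩ := exists_pick (p := fun v =>
    n - p.ti ≤ (p.supporters (T.heard 0 i) .input v).card) (v := v)
    (hcard.trans (h.card_le_supporters hi (by omega) hu0 fun x hx =>
      Params.sig_input_issued.mpr (hv x hx)))
  obtain ⟨l, hl, h7⟩ := h.exists_supporter hi (k := 0) (τ := .input) (v := x) (by omega) (by omega)
  have h8 : x = v := (Params.sig_input_issued.mp h7).symm.trans (hv l hl)
  subst h8
  have h9 : (T.st 1 i).strong.isSome = true := by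
    have hc := h.clock hi (k := 0) (by omega) hu0
    rw [zero_add] at h4
    rw [h4]
    simp only [Params.next, Params.update, hc, h5]
    simp
  obtain ⟨y, hy⟩ := Option.isSome_iff_exists.mp h9
  obtain ⟨-, h10, -⟩ := h.strong_set hi (k := 1) (by omega) hy
  obtain ⟨l', hl', h11⟩ := h.exists_supporter hi (k := 0) (τ := .input) (v := y) (by omega)
    (by omega)
  have h12 : y = x := (Params.sig_input_issued.mp h11).symm.trans (hv l' hl')
  rw [h3, h.strong_mono hi (k := 1) (k' := a) (by omega) (by omega) hy]
  exact h12

theorem authInput_two (h : T.Follows p F K) (hq : T.Quiet F K) (hK : 2 ≤ K) (hi : i ∈ F) :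
    (T.st 2 i).authInput =
      (pick fun v => p.Certified (T.heard 1 i) (n - p.ti) .input v).getD (T.st 0 i).input ∧
      (T.st 1 i).decision = none := by
  have hu := h.undecided_of_le_two hi hK le_rfl (hq i hi)
  obtain ⟨h1, -, h2⟩ := h.next_of_undecided (k := 1) hi (by omega) hu
  refine ⟨?_, h1⟩
  rw [h2]
  simp only [Params.next, Params.update]
  rw [if_pos (h.clock hi (by omega) h1), h.input_eq hi (by omega)]

/-- A genuine certificate of `n - ti` signers contains a signature from `F`, so it cannot divert a
party from the common input. -/
theorem authInput_of_inputs (h : T.Follows p F K) (hs : T.Sound p F K) (hq : T.Quiet F K)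
    (hK : 2 ≤ K) (hF : Fᶜ.card < n - p.ti) {v : V} (hv : ∀ i ∈ F, (T.st 0 i).input = v)
    (hi : i ∈ F) : (T.st 2 i).authInput = v := by
  rw [(h.authInput_two hq hK hi).1, hv i hi]
  cases hx : pick fun v => p.Certified (T.heard 1 i) (n - p.ti) .input v with
  | none => rfl
  | some w =>
    obtain ⟨j, hj⟩ := pick_spec (p := fun v => p.Certified (T.heard 1 i) (n - p.ti) .input v) hx
    obtain ⟨S, hS, hS2⟩ := hs i hi 1 (by omega) _ _ _ hj
    obtain ⟨l, hl, hlF⟩ := exists_mem_of_card_lt (F := F) (hF.trans_le hS)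
    rw [← hv l hlF, ← h.input_eq hlF (k := 1) (by omega)]
    exact (Params.sig_input_issued.mp (hS2 l hl hlF)).symm

/-- The certificate of the strong value reaches everybody in round 1. Any other certified value
would share an honest signer with it, and a party in `F` signs one input only. -/
theorem authInput_of_strong (h : T.Follows p F K) (hs : T.Sound p F K) (hq : T.Quiet F K)
    (hK : 2 ≤ K) (hF : Fᶜ.card ≤ p.ts) (hn : 2 * p.ti + p.ts < n) (hi : i ∈ F) (hj : j ∈ F)
    (hk : k ≤ K) {v : V} (hv : (T.st k i).strong = some v) : (T.st 2 j).authInput = v := by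
  classical
  obtain ⟨hk0, h1, h2⟩ := h.strong_set hi hk hv
  obtain ⟨h3, h4⟩ := h.authInput_two hq hK hj
  obtain ⟨w, h5, x, h6⟩ := exists_pick (p := fun v => p.Certified (T.heard 1 j) (n - p.ti) .input v)
    (v := v) ⟨i, h.mem_heard hi hj (by omega) h4 (Params.cert_input_issued h2)⟩
  obtain ⟨S, hS, hS2⟩ := hs j hj 1 (by omega) _ _ _ h6
  -- Two sets of at least `n - ti` parties have at least `n - 2 * ti > ts` common members.
  have h7 : Fᶜ.card < (S ∩ p.supporters (T.heard 0 i) .input v).card := by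
    have h8 := Finset.card_union_add_card_inter S (p.supporters (T.heard 0 i) .input v)
    have h9 := (S ∪ p.supporters (T.heard 0 i) .input v).card_le_univ
    rw [Fintype.card_fin] at h9
    omega
  obtain ⟨l, hl, hlF⟩ := exists_mem_of_card_lt h7
  obtain ⟨hl1, hl2⟩ := Finset.mem_inter.mp hl
  have h8 := Params.sig_input_issued.mp (hS2 l hl1 hlF)
  have h9 := Params.sig_input_issued.mp
    (h.issued_of_mem_heard hlF hi (by omega) (Params.mem_supporters.mp hl2))
  rw [h.input_eq hlF (by omega)] at h8
  rw [h3, h5, ← h9, h8]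
  rfl

end Follows

end Rounds

end

section

variable {n : ℕ} {V : Type}

/-! ### The compiled protocol at one party -/

/-- The key instance used by the host itself. -/
def hostKey (h : Host n V) (P Q : Protocol n V) : (compile h P Q).K := Sum.inl ()

/-- A slot that is started at time `s` and never stopped, at time `c`. -/
structure Slot.Scheduled {P : Protocol n V} (c s : ℕ) (x : Slot P) : Prop where
  running : x.stopped = false
  idle : c < s → x.inst = Inst.idle P
  started : s ≤ c → x.inst.st.isSome = true

theorem Slot.Scheduled.recv {P : Protocol n V} {c s : ℕ} {x : Slot P} (h : x.Scheduled c s)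
    (i : Fin n) (coin : P.Coin) (inbox) : (x.recv i coin inbox).Scheduled c s where
  running := by rw [Slot.recv_stopped, h.running]
  idle hc := Slot.recv_inst_idle (h.idle hc)
  started hc := by rw [Slot.recv_isSome, h.started hc]

theorem Slot.Scheduled.command {P : Protocol n V} {c c' s : ℕ} {x : Slot P} (h : x.Scheduled c s)
    (i : Fin n) (priv : P.Priv) (v : V) (hc : c' = c ∨ c' = c + 1) :
    (x.command i priv (if c' = s then some v else none) false).Scheduled c' s := by
  obtain ⟨⟨st, status⟩, b⟩ := x
  obtain ⟨rfl, h2, h3⟩ := h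
  by_cases hcs : c < s
  · obtain ⟨rfl, rfl⟩ : st = none ∧ status = ⟨none, false⟩ := by
      simpa [Inst.idle] using h2 hcs
    by_cases hc' : c' = s
    · rw [if_pos hc']
      exact ⟨rfl, fun h => absurd hc' h.ne, fun _ => rfl⟩
    · rw [if_neg hc']
      exact ⟨rfl, fun _ => rfl, fun h => by omega⟩
  · have h4 := h3 (by omega)
    rw [Slot.command_of_started h4]
    exact ⟨rfl, fun h => by omega, fun _ => h4⟩

/-- The slot is scheduled; the decision and the candidate were obtained in time. -/
structure Sane (p : Params n V) {P Q : Protocol n V} (k : ℕ)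
    (y : CompiledState p.juggernaut P Q) (s : JugState n V) : Prop where
  auth : y.auth.Scheduled s.clock 2
  sab : y.sab.Scheduled s.clock p.fallback
  clock_le : s.clock ≤ k
  clock : s.decision = none → s.clock = k
  clock_lt : s.decision ≠ none → s.clock < k
  lt_finish : s.decision = none → k < p.finish
  cand : s.cand.isSome = true → s.clock < p.deadline → y.auth.inst.status.Done
  early : s.decision ≠ none → s.clock + 1 = p.finish ∨
    s.clock + 1 ≤ p.fallback ∧ s.cand.isSome = true

namespace Sane

variable {p : Params n V} {P Q : Protocol n V} {k : ℕ}

theorem done_of_recv {x : Inst P} {i : Fin n} {coin : P.Coin} {inbox} (h : x.status.Done) :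
    (x.recv i coin inbox).status.Done := by
  rw [Inst.recv_of_halted h.2]; exact h

/-- An early decision needs a candidate, which before the deadline comes from a terminated
authenticated instance; such an instance must have been started. -/
theorem two_le {y : CompiledState p.juggernaut P Q} (h : Sane p k y y.host)
    (hd : y.host.decision ≠ none) : 2 ≤ y.host.clock := by
  obtain h1 | ⟨-, h1⟩ := h.early hd
  · simp only [Params.finish, Params.fallback, Params.deadline] at h1
    omega
  · by_contra h2
    have h3 := h.cand h1 (by simp only [Params.deadline]; omega)
    rw [h.auth.idle (by omega)] at h3
    exact absurd h3.1 (by simp [Inst.idle])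

theorem init (i : Fin n) (priv) (v : V) :
    Sane p 0 ((compile p.juggernaut P Q).init i priv v) (p.initial i v) := by
  have hidle : ∀ {P : Protocol n V} {s : ℕ}, 0 < s →
      (⟨Inst.idle P, false⟩ : Slot P).Scheduled 0 s := fun hs =>
    ⟨rfl, fun _ => rfl, fun h => by omega⟩
  refine ⟨?_, ?_, le_rfl, fun _ => rfl, fun h => absurd rfl h, fun _ => ?_, fun h => ?_,
    fun h => absurd rfl h⟩
  · exact (hidle two_pos).command i priv.1 v (.inl rfl)
  · refine (hidle (s := p.fallback) ?_).command i priv.2 v (.inl rfl)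
    simp only [Params.fallback]; omega
  · simp only [Params.finish]; omega
  · simp [Params.initial] at h

theorem succ {y : CompiledState p.juggernaut P Q} (h : Sane p k y y.host)
    (hd : y.host.decision ≠ none) : Sane p (k + 1) y y.host :=
  ⟨h.auth, h.sab, h.clock_le.trans (Nat.le_succ k), fun h' => absurd h' hd,
    fun _ => Nat.lt_succ_of_le h.clock_le, fun h' => absurd h' hd, h.cand, h.early⟩

theorem command_status {x : Slot P} {i : Fin n} {priv : P.Priv} {go : Option V}
    (h : x.inst.st.isSome = true) : (x.command i priv go false).inst.status = x.inst.status := by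
  rw [Slot.command_of_started h]

/-- The status of the authenticated instance after a round, before new commands. -/
def authStatus (i : Fin n) (y : CompiledState p.juggernaut P Q)
    (coin : (compile p.juggernaut P Q).Coin)
    (inbox : Fin n → (compile p.juggernaut P Q).K → Wire n) : Status V :=
  (y.auth.recv i coin.1 fun j b => inbox j (.inr (.inl b))).inst.status

/-- The status of the sabotaged instance after a round, before new commands. -/
def sabStatus (i : Fin n) (y : CompiledState p.juggernaut P Q)
    (coin : (compile p.juggernaut P Q).Coin)
    (inbox : Fin n → (compile p.juggernaut P Q).K → Wire n) : Status V :=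
  (y.sab.recv i coin.2 fun j b => inbox j (.inr (.inr b))).inst.status

theorem recv_host (i : Fin n) (y : CompiledState p.juggernaut P Q)
    (coin : (compile p.juggernaut P Q).Coin)
    (inbox : Fin n → (compile p.juggernaut P Q).K → Wire n) :
    CompiledState.host ((compile p.juggernaut P Q).recv i y coin inbox) =
      p.step i y.host (fun j => inbox j (hostKey _ P Q)) (authStatus i y coin inbox)
        (sabStatus i y coin inbox) := rfl

/-- A deciding party keeps its clock, so it cannot cross a starting time afterwards; an undecided
one advances by one, and the slots are started exactly when the clock reaches their times. -/
theorem recv {y : CompiledState p.juggernaut P Q} (h : Sane p k y y.host)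
    (hd : y.host.decision = none) (i : Fin n) (coin : (compile p.juggernaut P Q).Coin)
    (inbox : Fin n → (compile p.juggernaut P Q).K → Wire n) :
    Sane p (k + 1) ((compile p.juggernaut P Q).recv i y coin inbox)
      (CompiledState.host ((compile p.juggernaut P Q).recv i y coin inbox)) := by
  have hauth := h.auth.recv i coin.1 fun j b => inbox j (.inr (.inl b))
  have hsab := h.sab.recv i coin.2 fun j b => inbox j (.inr (.inr b))
  have hclock := h.clock hd
  -- An instance that is done has been started, so the commands at the end of the round leave its
  -- status alone.
  have hstart : (y.auth.recv i coin.1 fun j b => inbox j (.inr (.inl b))).inst.status.Done →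
      (y.auth.recv i coin.1 fun j b => inbox j (.inr (.inl b))).inst.st.isSome = true := fun hD => by
    by_contra hne
    have h2 : (JugState.clock y.host) < 2 := by
      by_contra h2; exact hne (hauth.started (by omega))
    rw [hauth.idle h2] at hD
    exact absurd hD.1 (by simp [Inst.idle])
  have hcand : (JugState.cand y.host).isSome = true → JugState.clock y.host < p.deadline →
      (y.auth.recv i coin.1 fun j b => inbox j (.inr (.inl b))).inst.status.Done := fun h1 h2 => by
    have h3 := h.cand h1 h2
    rw [Slot.recv_inst (by rw [h.auth.running]; simp)]
    exact done_of_recv h3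
  have hstatus : ∀ go, (y.auth.recv i coin.1 fun j b => inbox j (.inr (.inl b))).inst.status.Done →
      Status.Done (Slot.inst (Slot.command i y.privAuth go false
        (y.auth.recv i coin.1 fun j b => inbox j (.inr (.inl b))))).status := fun go hD => by
    rw [command_status (hstart hD)]; exact hD
  have hst := recv_host i y coin inbox
  obtain ⟨o, hv, h1⟩ | ⟨hv, h1⟩ := Params.step_cases (p := p) (i := i) (s := y.host)
      (inbox := fun j => inbox j (hostKey _ P Q)) (a := authStatus i y coin inbox)
      (b := sabStatus i y coin inbox)
  · rw [h1] at hst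
    have e1 : JugState.clock (CompiledState.host ((compile p.juggernaut P Q).recv i y coin inbox))
      = JugState.clock y.host := by rw [hst]
    have e2 : JugState.cand (CompiledState.host ((compile p.juggernaut P Q).recv i y coin inbox))
      = JugState.cand y.host := by rw [hst]
    have e3 : JugState.decision
      (CompiledState.host ((compile p.juggernaut P Q).recv i y coin inbox)) = some o := by rw [hst]
    refine ⟨?_, ?_, ?_, ?_, ?_, ?_, ?_, ?_⟩
    · exact hauth.command i y.privAuth (JugState.authInput
        (CompiledState.host ((compile p.juggernaut P Q).recv i y coin inbox))) (.inl e1)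
    · exact hsab.command i y.privSab (JugState.sabInput
        (CompiledState.host ((compile p.juggernaut P Q).recv i y coin inbox))) (.inl e1)
    · omega
    · intro h'; rw [e3] at h'; simp at h'
    · intro _; omega
    · intro h'; rw [e3] at h'; simp at h'
    · intro h2 h3
      rw [e2] at h2; rw [e1] at h3
      exact hstatus _ (hcand h2 h3)
    · intro _
      rw [e1, e2]
      unfold Params.verdict at hv
      split_ifs at hv with h2 h3
      · exact .inr ⟨h2.1, h2.2.1⟩
      · exact .inl h3
  · rw [h1] at hst
    have e1 : JugState.clock (CompiledState.host ((compile p.juggernaut P Q).recv i y coin inbox))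
      = JugState.clock y.host + 1 := by rw [hst]; rfl
    have e2 : JugState.cand (CompiledState.host ((compile p.juggernaut P Q).recv i y coin inbox))
      = (JugState.cand y.host).or (p.candidate y.host (authStatus i y coin inbox)) := by
      rw [hst]; rfl
    have e3 : JugState.decision
      (CompiledState.host ((compile p.juggernaut P Q).recv i y coin inbox)) = none := by
      rw [hst]; rfl
    refine ⟨?_, ?_, ?_, ?_, ?_, ?_, ?_, ?_⟩
    · exact hauth.command i y.privAuth (JugState.authInput
        (CompiledState.host ((compile p.juggernaut P Q).recv i y coin inbox))) (.inr e1)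
    · exact hsab.command i y.privSab (JugState.sabInput
        (CompiledState.host ((compile p.juggernaut P Q).recv i y coin inbox))) (.inr e1)
    · omega
    · omega
    · intro h'; exact absurd e3 h'
    · intro _
      have h2 := h.lt_finish hd
      by_contra h3
      unfold Params.verdict at hv
      split_ifs at hv with h4 h5
      omega
    · intro h2 h3
      rw [e1] at h3
      refine hstatus _ ?_
      rw [e2, Option.isSome_or, Bool.or_eq_true] at h2
      obtain h2 | h2 := h2
      · exact hcand h2 (by omega)
      · unfold Params.candidate at h2
        split_ifs at h2 with h4
        · obtain h4 | h4 := h4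
          · exact h4
          · omega
        · simp at h2
    · intro h'; exact absurd e3 h'

end Sane

/-! ### Executions of the compiled protocol -/

section Runs

variable (p : Params n V) {P Q : Protocol n V} (A : Adversary (compile p.juggernaut P Q))
  (m : Setting) {H : ℕ} (ω : Randomness (compile p.juggernaut P Q) H)

/-- The local instance in state `y`. -/
def instOf {p : Params n V} {P Q : Protocol n V} (y : CompiledState p.juggernaut P Q) :
    Inst (compile p.juggernaut P Q) :=
  ⟨some y, ⟨JugState.decision y.host, (JugState.decision y.host).isSome⟩⟩

theorem instOf_recv {p : Params n V} {P Q : Protocol n V} {y : CompiledState p.juggernaut P Q}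
    (hd : y.host.decision = none) (i : Fin n) (coin) (inbox) :
    (instOf y).recv i coin inbox = instOf ((compile p.juggernaut P Q).recv i y coin inbox) := by
  have h1 : (instOf y).status = ⟨none, false⟩ := by
    change Status.mk (JugState.decision y.host) (JugState.decision y.host).isSome = _
    rw [hd]; rfl
  unfold Inst.recv
  rw [h1]
  rfl

theorem instOf_halted {p : Params n V} {P Q : Protocol n V} {y : CompiledState p.juggernaut P Q}
    (hd : y.host.decision ≠ none) : (instOf y).status.halted = true :=
  Option.isSome_iff_ne_none.mpr hd

/-- The state of an honest party, `k` rounds after the start. -/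
theorem exists_state {R k : ℕ} {i : Fin n} (hi : i ∉ (conf A m ω R).corrupt) (hR : A.start < R)
    (hk : A.start + k ≤ R) :
    ∃ y, (during A m ω (A.start + k)).loc i = instOf y ∧ Sane p k y y.host ∧
      p.Backed i y.host ∧ (k = 0 → ∃ v, (during A m ω A.start).inp i = some v ∧
        y.host = p.initial i v) ∧
      ∀ x ∈ JugState.heard y.host,
        x.2 ∈ tokensReceived (conf A m ω (A.start + k)).hist i (hostKey _ P Q) := by
  have hid : ∀ {r}, r < R → i ∉ (during A m ω r).corrupt := fun hr h =>
    hi (during_corrupt_subset_conf A m ω hr h)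
  induction k with
  | zero =>
    obtain ⟨v, h1, h2, -⟩ := during_start A m ω (hid hR)
    refine ⟨_, h2, Sane.init i _ v, Params.backed_initial i v, fun _ => ⟨v, h1, rfl⟩, fun x hx => ?_⟩
    simp [compile, CompiledState.commands, Params.juggernaut, Params.initial] at hx
  | succ k ih =>
    obtain ⟨y, h1, h2, h3, -, h4⟩ := ih (by omega)
    have h5 : (during A m ω (A.start + (k + 1))).loc i =
        ((during A m ω (A.start + k)).loc i).recv i (ω.coin (A.start + k) i)
          (fun j a => msgsAt A m ω (A.start + k) j i a) := by
      rw [during_loc_of_ne _ _ _ (by omega), ← add_assoc, conf_succ_loc _ _ _ (hid (by omega))]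
    have h6 : ∀ t ∈ tokensReceived (conf A m ω (A.start + k)).hist i (hostKey _ P Q),
        t ∈ tokensReceived (conf A m ω (A.start + (k + 1))).hist i (hostKey _ P Q) := fun t ht => by
      rw [mem_tokensReceived] at ht ⊢
      obtain ⟨r, hr, ht⟩ := ht
      exact ⟨r, by omega, ht⟩
    by_cases hd : y.host.decision = none
    · rw [h1, instOf_recv hd] at h5
      refine ⟨_, h5, h2.recv hd i _ _, Params.Backed.step h3, fun h => by omega, fun x hx => ?_⟩
      rw [Sane.recv_host] at hx
      have hx' : x ∈ JugState.hear y.host fun j => msgsAt A m ω (A.start + k) j i (hostKey _ P Q) := by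
        obtain ⟨o, -, hst⟩ | ⟨-, hst⟩ := Params.step_cases (p := p) (i := i) (s := y.host)
          (inbox := fun j => msgsAt A m ω (A.start + k) j i (hostKey _ P Q))
          (a := Sane.authStatus i y (ω.coin (A.start + k) i)
            (fun j a => msgsAt A m ω (A.start + k) j i a))
          (b := Sane.sabStatus i y (ω.coin (A.start + k) i)
            (fun j a => msgsAt A m ω (A.start + k) j i a))
        · rw [hst] at hx; exact Params.subset_hear hx
        · rw [hst] at hx; exact hx
      obtain hx | hx := hx'
      · exact h6 _ (h4 x hx)
      · rw [mem_tokensReceived]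
        exact ⟨A.start + k, by omega, x.1, hx⟩
    · rw [h1, Inst.recv_of_halted (instOf_halted hd)] at h5
      exact ⟨y, h5, h2.succ hd, h3, fun h => by omega, fun x hx => h6 _ (h4 x hx)⟩

/-- The hosts in an execution. -/
noncomputable def rounds : Rounds n V where
  st k i := match ((during A m ω (A.start + k)).loc i).st with
    | some y => CompiledState.host y
    -- A dummy value: from round `start` on, every honest party has a state.
    | none => p.initial i p.default
  wire k i j := msgsAt A m ω (A.start + k) i j (hostKey _ P Q)
  auth k i := match ((during A m ω (A.start + k)).loc i).st with
    | some y => Sane.authStatus i y (ω.coin (A.start + k) i)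
        (fun j a => msgsAt A m ω (A.start + k) j i a)
    | none => ⟨none, false⟩
  sab k i := match ((during A m ω (A.start + k)).loc i).st with
    | some y => Sane.sabStatus i y (ω.coin (A.start + k) i)
        (fun j a => msgsAt A m ω (A.start + k) j i a)
    | none => ⟨none, false⟩

variable {p A m ω}

theorem rounds_st {k : ℕ} {i : Fin n} {y} (h : (during A m ω (A.start + k)).loc i = instOf y) :
    (rounds p A m ω).st k i = y.host := by
  simp only [rounds, h]; rfl

theorem rounds_auth {k : ℕ} {i : Fin n} {y}
    (h : (during A m ω (A.start + k)).loc i = instOf y) :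
    (rounds p A m ω).auth k i = Sane.authStatus i y (ω.coin (A.start + k) i)
        (fun j a => msgsAt A m ω (A.start + k) j i a) := by
  simp only [rounds, h, instOf]

theorem rounds_sab {k : ℕ} {i : Fin n} {y}
    (h : (during A m ω (A.start + k)).loc i = instOf y) :
    (rounds p A m ω).sab k i = Sane.sabStatus i y (ω.coin (A.start + k) i)
        (fun j a => msgsAt A m ω (A.start + k) j i a) := by
  simp only [rounds, h, instOf]

open Classical in
-- Verification removes nothing from what an honest host sends: signatures are its own, and
-- certificates are backed by signatures it has received.
theorem send_tokens {y : CompiledState p.juggernaut P Q} (hd : y.host.decision = none) (i j : Fin n)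
    (coin) (known : Set (Token n)) (hb : p.Backed i y.host)
    (ho : ∀ t ∈ JugState.outbox y.host, t ∈ p.issued i y.host)
    (hh : ∀ x ∈ JugState.heard y.host, x.2 ∈ known) :
    (((instOf y).send i coin j (hostKey _ P Q)).verified {i} known).tokens = JugState.outbox y.host := by
  have h1 : (instOf y).send i coin j (hostKey _ P Q) = ⟨[], JugState.outbox y.host⟩ := by
    have h2 : (instOf y).status = ⟨none, false⟩ := by
      change Status.mk (JugState.decision y.host) (JugState.decision y.host).isSome = _
      rw [hd]; rfl
    unfold Inst.send
    rw [h2]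
    rfl
  rw [h1]
  refine List.filter_eq_self.mpr fun t ht => decide_eq_true ?_
  have ht := ho t ht
  cases t with
  | sig j x => exact .inl (by simpa using (Params.mem_issued_sig.mp ht).1)
  | cert k x =>
    obtain ⟨S, h2, h3⟩ := hb k x ht
    exact .inr ⟨S, h2, fun j hj => .inr (hh _ (h3 j hj))⟩

theorem during_succ_loc {R k : ℕ} {i : Fin n} (hi : i ∉ (conf A m ω R).corrupt)
    (hk : A.start + k < R) :
    (during A m ω (A.start + (k + 1))).loc i =
      ((during A m ω (A.start + k)).loc i).recv i (ω.coin (A.start + k) i)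
        (fun j a => msgsAt A m ω (A.start + k) j i a) := by
  rw [during_loc_of_ne _ _ _ (by omega), ← add_assoc,
    conf_succ_loc _ _ _ fun h => hi (during_corrupt_subset_conf A m ω hk h)]

theorem outbox_subset_issued {R k : ℕ} {i : Fin n} (hi : i ∉ (conf A m ω R).corrupt)
    (hR : A.start < R) (hk : A.start + k ≤ R) {y}
    (hy : (during A m ω (A.start + k)).loc i = instOf y) :
    ∀ t ∈ JugState.outbox y.host, t ∈ p.issued i y.host := by
  induction k generalizing y with
  | zero =>
    obtain ⟨y', h1, -, -, h2, -⟩ := exists_state p A m ω hi hR hk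
    obtain ⟨v, -, h2⟩ := h2 rfl
    have hyy : y' = y := by
      rw [h1] at hy
      exact Option.some.inj (congrArg Inst.st hy)
    subst hyy
    rw [h2]
    exact fun t ht => ht
  | succ k ih =>
    obtain ⟨y', h1, -⟩ := exists_state p A m ω hi hR (k := k) (by omega)
    have h2 := during_succ_loc hi (A := A) (m := m) (ω := ω) (k := k) (by omega)
    by_cases hd : y'.host.decision = none
    · rw [h1, instOf_recv hd, hy] at h2
      have h3 := Option.some.inj (congrArg Inst.st h2)
      have h4 : y.host = p.step i y'.host _ _ _ := congrArg CompiledState.host h3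
      rw [h4]
      exact Params.outbox_step_subset
    · rw [h1, Inst.recv_of_halted (instOf_halted hd), hy] at h2
      have h3 : y = y' := Option.some.inj (congrArg Inst.st h2)
      subst h3
      exact ih (by omega) h1

/-- The passage from executions to the combinatorial description. It holds in both settings, and the
parties honest up to round `R` are the ones that follow the protocol. -/
theorem follows {R : ℕ} (hR : A.start < R) :
    (rounds p A m ω).Follows p (conf A m ω R).corruptᶜ (R - A.start) where
  init i hi := by
    obtain ⟨y, h1, -, -, h2, -⟩ := exists_state p A m ω (k := 0) (Finset.mem_compl.mp hi) hR hR.le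
    obtain ⟨v, -, h2⟩ := h2 rfl
    rw [rounds_st h1, h2]; rfl
  step i hi k hk hd := by
    have hi := Finset.mem_compl.mp hi
    obtain ⟨y, h1, -⟩ := exists_state p A m ω (k := k) hi hR (by omega)
    have h2 := during_succ_loc hi (A := A) (m := m) (ω := ω) (k := k) (by omega)
    rw [rounds_st h1] at hd ⊢
    rw [h1, instOf_recv hd] at h2
    rw [rounds_st h2, rounds_auth h1, rounds_sab h1]
    rfl
  stay i hi k hk hd := by
    have hi := Finset.mem_compl.mp hi
    obtain ⟨y, h1, -⟩ := exists_state p A m ω (k := k) hi hR (by omega)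
    have h2 := during_succ_loc hi (A := A) (m := m) (ω := ω) (k := k) (by omega)
    rw [rounds_st h1] at hd ⊢
    rw [h1, Inst.recv_of_halted (instOf_halted hd)] at h2
    rw [rounds_st h2]
  sent i hi j k hk hd := by
    have hi := Finset.mem_compl.mp hi
    obtain ⟨y, h1, -, h2, -, h3⟩ := exists_state p A m ω (k := k) hi hR (by omega)
    rw [rounds_st h1] at hd ⊢
    have h4 : (rounds p A m ω).wire k i j = msgsAt A m ω (A.start + k) i j (hostKey _ P Q) := rfl
    rw [h4, msgsAt_of_notMem _ _ _ fun h => hi (during_corrupt_subset_conf A m ω (by omega) h), h1]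
    exact send_tokens hd i j _ _ h2 (outbox_subset_issued hi hR (by omega) h1) h3
  quiet i hi j k hk hd := by
    have hi := Finset.mem_compl.mp hi
    obtain ⟨y, h1, -⟩ := exists_state p A m ω (k := k) hi hR (by omega)
    rw [rounds_st h1] at hd
    have h4 : (rounds p A m ω).wire k i j = msgsAt A m ω (A.start + k) i j (hostKey _ P Q) := rfl
    rw [h4, msgsAt_of_notMem _ _ _ fun h => hi (during_corrupt_subset_conf A m ω (by omega) h), h1,
      Inst.send_of_halted (instOf_halted hd)]
    rfl

theorem quiet {R : ℕ} (hR : A.start < R) :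
    (rounds p A m ω).Quiet (conf A m ω R).corruptᶜ (R - A.start) := by
  intro i hi k hk hkR
  obtain ⟨y, h1, h2, -⟩ := exists_state p A m ω (k := k) (Finset.mem_compl.mp hi) hR (by omega)
  rw [rounds_auth h1, Sane.authStatus]
  have h3 := h2.clock_le
  rw [Slot.recv_inst_idle (h2.auth.idle (by omega))]
  rfl

end Runs

end

section

variable {n : ℕ} {V : Type}

/-! ### Unforgeability -/

theorem derivable_of_mem_verified {own : Finset (Fin n)} {known : Set (Token n)} {w : Wire n}
    {t : Token n} (h : t ∈ (w.verified own known).tokens) : Derivable own known t := by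
  simpa using (List.mem_filter.mp h).2

section Runs

variable {p : Params n V} {P Q : Protocol n V} {A : Adversary (compile p.juggernaut P Q)}
  {m : Setting} {H : ℕ} {ω : Randomness (compile p.juggernaut P Q) H}

/-- The parties outside `S` contributed to a token. -/
def Genuine (T : Rounds n V) (p : Params n V) (S : Finset (Fin n)) (s r : ℕ) : Token n → Prop
  | .sig l x => l ∉ S → s ≤ r ∧ Token.sig l x ∈ p.issued l (T.st (r - s) l)
  | .cert k x => ∃ L : Finset (Fin n), k ≤ L.card ∧
      ∀ l ∈ L, l ∉ S → s ≤ r ∧ Token.sig l x ∈ p.issued l (T.st (r - s) l)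

/-- A derivation uses keys of parties in `S`, about which nothing is claimed, and known tokens,
which are genuine. -/
theorem genuine_of_derivable {T : Rounds n V} {S own : Finset (Fin n)} {s r : ℕ}
    {known : Set (Token n)} (h1 : own ⊆ S) (h2 : ∀ t ∈ known, Genuine T p S s r t) {t : Token n}
    (ht : Derivable own known t) : Genuine T p S s r t := by
  cases t with
  | sig l x =>
    intro hl
    obtain h | h := ht
    · exact absurd (h1 h) hl
    · exact h2 _ h hl
  | cert k x =>
    obtain h | ⟨L, hL, h⟩ := ht
    · exact h2 _ h
    · refine ⟨L, hL, fun l hl hlS => ?_⟩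
      obtain h3 | h3 := h l hl
      · exact absurd (h1 h3) hlS
      · exact h2 _ h3 hlS

theorem genuine_mono {R : ℕ} (hR : A.start < R) {r r' : ℕ} (hr : r ≤ r') (hr' : r' ≤ R)
    {t : Token n} (h : Genuine (rounds p A m ω) p (conf A m ω R).corrupt A.start r t) :
    Genuine (rounds p A m ω) p (conf A m ω R).corrupt A.start r' t := by
  have key : ∀ l x, l ∉ (conf A m ω R).corrupt →
      A.start ≤ r ∧ Token.sig l x ∈ p.issued l ((rounds p A m ω).st (r - A.start) l) →
      A.start ≤ r' ∧ Token.sig l x ∈ p.issued l ((rounds p A m ω).st (r' - A.start) l) :=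
    fun l x hl h => ⟨h.1.trans hr, (follows hR).issued_mono (Finset.mem_compl.mpr hl)
      (by omega) (by omega) h.2⟩
  cases t with
  | sig l x => exact fun hl => key l x hl (h hl)
  | cert k x =>
    obtain ⟨L, hL, h⟩ := h
    exact ⟨L, hL, fun l hl hlS => key l x hlS (h l hl hlS)⟩

/-- A sender that is honest now may be corrupted by round `R`. Then it belongs to the excluded set
and only verification is used; otherwise it follows the protocol, and its certificates are backed by
received signatures. -/
theorem genuine_of_honest {R r : ℕ} (hR : A.start < R) (hr : r < R) {i j : Fin n}
    (hi : i ∉ (during A m ω r).corrupt)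
    (ih : ∀ i j, ∀ k < r, ∀ t ∈ (msgsAt A m ω k i j (hostKey _ P Q)).tokens,
      Genuine (rounds p A m ω) p (conf A m ω R).corrupt A.start r t) {t : Token n}
    (ht : t ∈ (msgsAt A m ω r i j (hostKey _ P Q)).tokens) :
    Genuine (rounds p A m ω) p (conf A m ω R).corrupt A.start r t := by
  have hknown : ∀ t ∈ tokensReceived (conf A m ω r).hist i (hostKey _ P Q),
      Genuine (rounds p A m ω) p (conf A m ω R).corrupt A.start r t := by
    intro t ht
    rw [mem_tokensReceived] at ht
    obtain ⟨k, hk, j, ht⟩ := ht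
    exact ih _ _ k hk t ht
  by_cases hiR : i ∈ (conf A m ω R).corrupt
  · rw [msgsAt_of_notMem _ _ _ hi] at ht
    exact genuine_of_derivable (by simpa using hiR) hknown (derivable_of_mem_verified ht)
  · obtain hrs | hrs := lt_or_ge r A.start
    · rw [msgsAt_of_notMem _ _ _ hi, during_loc_of_ne _ _ _ hrs.ne,
        conf_loc_of_le_start _ _ _ hrs.le] at ht
      simp [Inst.send_idle, Wire.silent, Wire.verified] at ht
    · obtain ⟨k, rfl⟩ := Nat.exists_eq_add_of_le hrs
      have h1 : t ∈ p.issued i ((rounds p A m ω).st k i) :=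
        (follows hR).issued_of_mem_wire (Finset.mem_compl.mpr hiR) (by omega) ht
      cases t with
      | sig l x =>
        obtain ⟨rfl, -⟩ := Params.mem_issued_sig.mp h1
        refine fun _ => ⟨hrs, ?_⟩
        rwa [Nat.add_sub_cancel_left]
      | cert c x =>
        obtain ⟨y, h2, -, h3, -, h4⟩ := exists_state p A m ω hiR hR hr.le
        rw [rounds_st h2] at h1
        obtain ⟨L, h5, h6⟩ := h3 c x h1
        exact ⟨L, h5, fun l hl hlR => hknown _ (h4 _ (h6 l hl)) hlR⟩

/-- Strong induction on the round. The adversary moves after the honest parties and may reuse tokens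
of the same round, so the messages of honest parties are settled first. -/
theorem genuine_of_mem_msgsAt {A : Adversary (compile p.juggernaut P Q)}
    {ω : Randomness (compile p.juggernaut P Q) H} {R r : ℕ} (hR : A.start < R) (hr : r < R)
    {i j : Fin n} {t : Token n}
    (ht : t ∈ (msgsAt A .authenticated ω r i j (hostKey _ P Q)).tokens) :
    Genuine (rounds p A .authenticated ω) p (conf A .authenticated ω R).corrupt A.start r t := by
  induction r using Nat.strong_induction_on generalizing i j t with
  | _ r ih =>
    have ih' : ∀ i j, ∀ k < r, ∀ t ∈ (msgsAt A .authenticated ω k i j (hostKey _ P Q)).tokens,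
        Genuine (rounds p A .authenticated ω) p (conf A .authenticated ω R).corrupt A.start r t :=
      fun i j k hk t ht => genuine_mono hR hk.le hr.le (ih k hk (by omega) ht)
    by_cases hi : i ∈ (during A .authenticated ω r).corrupt
    · rw [msgsAt, roundMsgs, if_pos hi] at ht
      refine genuine_of_derivable (during_corrupt_subset_conf A _ ω hr) ?_
        (derivable_of_mem_verified ht)
      rintro t (⟨R', hR', i, j, h⟩ | ⟨i, j, h⟩)
      · rw [during_hist, mem_conf_hist] at hR'
        obtain ⟨k, hk, rfl⟩ := hR'
        exact ih' i j k hk t h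
      · by_cases hi : i ∈ (during A .authenticated ω r).corrupt
        · rw [honestMsgs_of_mem hi] at h
          simp [Wire.silent] at h
        · rw [honestMsgs_eq_msgsAt hi] at h
          exact genuine_of_honest hR hr hi ih' h
    · exact genuine_of_honest hR hr hi ih' ht

theorem sound {A : Adversary (compile p.juggernaut P Q)}
    {ω : Randomness (compile p.juggernaut P Q) H} {R : ℕ} (hR : A.start < R) :
    (rounds p A .authenticated ω).Sound p (conf A .authenticated ω R).corruptᶜ (R - A.start) := by
  intro j hj k hk i c x ht
  obtain ⟨a, ha, h1⟩ := (follows hR).exists_wire hj hk ht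
  have h2 := genuine_of_mem_msgsAt hR (r := A.start + a) (by omega) h1
  obtain ⟨L, h3, h4⟩ := genuine_mono hR (r' := A.start + k) (by omega) (by omega) h2
  refine ⟨L, h3, fun l hl hlF => ?_⟩
  have h5 := (h4 l hl (Finset.mem_compl.mp hlF)).2
  rwa [Nat.add_sub_cancel_left] at h5

/-! ### The instances inside the compiled protocol -/

theorem conf_loc_eq {k : ℕ} (hk : 0 < k) (i : Fin n) :
    (conf A m ω (A.start + k)).loc i = (during A m ω (A.start + k)).loc i :=
  (during_loc_of_ne _ _ _ (by omega) i).symm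

theorem conf_status {R k : ℕ} {i : Fin n} (hi : i ∉ (conf A m ω R).corrupt) (hk : 0 < k)
    (hR : A.start + k ≤ R) : ((conf A m ω (A.start + k)).loc i).status =
      ⟨((rounds p A m ω).st k i).decision, ((rounds p A m ω).st k i).decision.isSome⟩ := by
  obtain ⟨y, h1, -⟩ := exists_state p A m ω hi (by omega) hR
  rw [conf_loc_eq hk, rounds_st h1, h1]
  rfl

theorem input_of_inp {R : ℕ} {i : Fin n} (hi : i ∉ (conf A m ω R).corrupt) (hR : A.start < R)
    {v : V} (h : (conf A m ω R).inp i = some v) : ((rounds p A m ω).st 0 i).input = v := by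
  obtain ⟨y, h1, -, -, h2, -⟩ := exists_state p A m ω (k := 0) hi hR (by omega)
  obtain ⟨w, h2, h3⟩ := h2 rfl
  rw [conf_inp_of_lt _ _ _ hR, h2] at h
  rw [rounds_st h1, h3, ← Option.some.inj h]
  rfl

/-- The host reads the status before its new commands are carried out; for an instance already
started the commands do not change it. -/
theorem auth_status {R k : ℕ} {i : Fin n} (hi : i ∉ (conf A m ω R).corrupt)
    (hR : A.start + k < R) (hk : 2 ≤ k) (hd : ((rounds p A m ω).st k i).decision = none) :
    ((authEmbedding _ P Q).part ((conf A m ω (A.start + (k + 1))).loc i)).inst.status =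
      (rounds p A m ω).auth k i := by
  obtain ⟨y, h1, h2, -⟩ := exists_state p A m ω (k := k) hi (by omega) hR.le
  rw [rounds_st h1] at hd
  have h3 := h2.clock hd
  rw [conf_loc_eq (by omega), during_succ_loc hi hR, h1, instOf_recv hd, rounds_auth h1,
    Embedding.part_some _ rfl]
  refine Sane.command_status ?_
  exact (h2.auth.recv _ _ _).started (by omega)

theorem sab_status {R k : ℕ} {i : Fin n} (hi : i ∉ (conf A m ω R).corrupt)
    (hR : A.start + k < R) (hk : p.fallback ≤ k)
    (hd : ((rounds p A m ω).st k i).decision = none) :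
    ((sabEmbedding _ P Q).part ((conf A m ω (A.start + (k + 1))).loc i)).inst.status =
      (rounds p A m ω).sab k i := by
  obtain ⟨y, h1, h2, -⟩ := exists_state p A m ω (k := k) hi (by omega) hR.le
  rw [rounds_st h1] at hd
  have h3 := h2.clock hd
  rw [conf_loc_eq (by omega), during_succ_loc hi hR, h1, instOf_recv hd, rounds_sab h1,
    Embedding.part_some _ rfl]
  refine Sane.command_status ?_
  exact (h2.sab.recv _ _ _).started (by omega)

theorem auth_go {R : ℕ} {i : Fin n} (hi : i ∉ (conf A m ω R).corrupt) (hR : A.start + 2 ≤ R) {y}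
    (hy : ((conf A m ω (A.start + 2)).loc i).st = some y) :
    (authEmbedding _ P Q).go ((authEmbedding _ P Q).rest y) =
      some ((rounds p A m ω).st 2 i).authInput := by
  obtain ⟨y', h1, h2, -⟩ := exists_state p A m ω (k := 2) hi (by omega) hR
  rw [conf_loc_eq (by omega), h1] at hy
  obtain rfl : y' = y := Option.some.inj hy
  rw [rounds_st h1]
  have hd := (follows (p := p) (A := A) (m := m) (ω := ω) (R := R) (by omega)).undecided_of_le_two
    (Finset.mem_compl.mpr hi) (k := 2) (by omega) le_rfl
    (quiet (by omega) i (Finset.mem_compl.mpr hi))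
  rw [rounds_st h1] at hd
  exact if_pos (h2.clock hd)

theorem sab_go {R : ℕ} {i : Fin n} (hi : i ∉ (conf A m ω R).corrupt)
    (hR : A.start + p.fallback ≤ R)
    (hd : ((rounds p A m ω).st p.fallback i).decision = none) {y}
    (hy : ((conf A m ω (A.start + p.fallback)).loc i).st = some y) :
    (sabEmbedding _ P Q).go ((sabEmbedding _ P Q).rest y) =
      some ((rounds p A m ω).st p.fallback i).sabInput := by
  have hf : 0 < p.fallback := by simp only [Params.fallback]; omega
  obtain ⟨y', h1, h2, -⟩ := exists_state p A m ω (k := p.fallback) hi (by omega) hR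
  rw [conf_loc_eq hf, h1] at hy
  obtain rfl : y' = y := Option.some.inj hy
  rw [rounds_st h1] at hd ⊢
  exact if_pos (h2.clock hd)

theorem during_loc_of_lt_start {r : ℕ} (hr : r < A.start) (i : Fin n) :
    (during A m ω r).loc i = Inst.idle _ := by
  rw [during_loc_of_ne _ _ _ hr.ne, conf_loc_of_le_start _ _ _ hr.le]

/-- No assumption on the corruptions is needed: a party that has decided before the deadline took
its candidate from a terminated instance. -/
theorem live_auth (p : Params n V) {P Q : Protocol n V} (A : Adversary (compile p.juggernaut P Q))
    (m : Setting) {H : ℕ} (ω : Randomness (compile p.juggernaut P Q) H) :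
    (authEmbedding _ P Q).Live A m (A.start + 2) ω (A.start + p.deadline) := by
  intro r hr i hi
  obtain hrs | hrs := lt_or_ge r A.start
  · rw [during_loc_of_lt_start hrs, Embedding.part_none _ rfl]
    exact ⟨fun _ => rfl, fun h => by omega⟩
  · obtain ⟨k, rfl⟩ := Nat.exists_eq_add_of_le hrs
    obtain ⟨y, h1, h2, -⟩ := exists_state p A m ω (R := A.start + k + 1) (k := k) hi (by omega)
      (by omega)
    rw [h1, Embedding.part_some (s := y) _ rfl]
    have h3 := h2.clock_le
    refine ⟨fun h => ?_, fun h => ⟨h2.auth.started ?_, ?_⟩⟩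
    · have h4 := h2.auth.idle (by omega)
      exact congrArg Inst.st h4
    · by_cases hd : y.host.decision = none
      · have := h2.clock hd; omega
      · exact h2.two_le hd
    · rintro (h4 | h4)
      · exact absurd (h2.auth.running.symm.trans h4) (by simp)
      · have hd : y.host.decision ≠ none := Option.isSome_iff_ne_none.mp h4
        obtain h5 | ⟨-, h5⟩ := h2.early hd
        · simp only [Params.finish, Params.fallback] at h5
          omega
        · exact (h2.cand h5 (by omega)).2

/-- If nobody decides early then the sabotaged protocol is run properly. -/
theorem live_sab (h : ∀ i ∉ (during A m ω (A.start + p.fallback)).corrupt,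
      ((rounds p A m ω).st p.fallback i).decision = none) :
    (sabEmbedding _ P Q).Live A m (A.start + p.fallback) ω (A.start + p.finish) := by
  intro r hr i hi
  obtain hrs | hrs := lt_or_ge r A.start
  · rw [during_loc_of_lt_start hrs, Embedding.part_none _ rfl]
    exact ⟨fun _ => rfl, fun h => by omega⟩
  · obtain ⟨k, rfl⟩ := Nat.exists_eq_add_of_le hrs
    have hi' : i ∉ (conf A m ω (A.start + k + 1)).corrupt := hi
    have h0 : A.start < A.start + k + 1 := by omega
    have hiF := Finset.mem_compl.mpr hi'
    obtain ⟨y, h1, h2, -⟩ := exists_state p A m ω (k := k) hi' h0 (by omega)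
    rw [h1, Embedding.part_some (s := y) _ rfl]
    have h3 := h2.clock_le
    have hdec : p.fallback ≤ k → y.host.decision = none := fun hk => by
      have h5 := h i fun h' => hi (by
        obtain rfl | hk := eq_or_lt_of_le hk
        · exact h'
        · exact conf_corrupt_subset_during A m ω _
            (during_corrupt_subset_conf A m ω (s := A.start + k) (by omega) h'))
      have h6 := (follows (p := p) (A := A) (m := m) (ω := ω) h0).undecided_until_finish
        hiF hk (by omega) (by omega) h5
      rwa [rounds_st h1] at h6
    refine ⟨fun h => ?_, fun h => ⟨h2.sab.started ?_, ?_⟩⟩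
    · have h4 := h2.sab.idle (by omega)
      exact congrArg Inst.st h4
    · rw [h2.clock (hdec (by omega))]; omega
    · rintro (h4 | h4)
      · exact absurd (h2.sab.running.symm.trans h4) (by simp)
      · have hd : y.host.decision ≠ none := Option.isSome_iff_ne_none.mp h4
        exact absurd (hdec (by omega)) hd

end Runs

end

section

variable {n : ℕ} {V : Type}

/-! ### Executions in which the two protocols work -/

namespace Rounds.Follows

variable {T : Rounds n V} {p : Params n V} {F : Finset (Fin n)} {K : ℕ} {i : Fin n}

theorem lock_const (h : T.Follows p F K) (hi : i ∈ F) {k : ℕ} (hk : p.fallback ≤ k) (hK : k ≤ K)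
    (hu : (T.st k i).decision = none) : (T.st k i).lock = (T.st p.fallback i).lock := by
  induction k, hk using Nat.le_induction with
  | base => rfl
  | succ k hk ih =>
    obtain ⟨h1, -, h2⟩ := h.next_of_undecided hi (by omega) hu
    have hc := h.clock hi (by omega) h1
    rw [h2]
    simp only [Params.next, Params.update]
    rw [if_neg (by omega)]
    exact ih (by omega) h1

/-- A party that did not decide early uses its lock, or the output of the sabotaged protocol. -/
theorem decision_of_late (h : T.Follows p F K) (hi : i ∈ F) (hK : p.finish ≤ K)
    (hu : (T.st p.fallback i).decision = none) :
    (T.st (p.finish - 1) i).decision = none ∧ (T.st p.finish i).decision =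
      some ((T.st p.fallback i).lock.or ((T.sab (p.finish - 1) i).out.getD none)) := by
  have hf : p.finish - 1 + 1 = p.finish := by simp only [Params.finish]; omega
  have hle : p.fallback ≤ p.finish - 1 := by simp only [Params.finish]; omega
  have h1 := h.undecided_until_finish hi hle (by omega) (by omega) hu
  have hc := h.clock hi (by omega) h1
  refine ⟨h1, ?_⟩
  have hv : p.verdict (T.st (p.finish - 1) i) (T.heard (p.finish - 1) i) (T.sab (p.finish - 1) i) =
      some ((T.st p.fallback i).lock.or ((T.sab (p.finish - 1) i).out.getD none)) := by
    unfold Params.verdict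
    rw [if_neg, if_pos (by omega), h.lock_const hi hle (by omega) h1]
    intro hq
    have := hq.1
    omega
  obtain ⟨h2, -⟩ | ⟨-, o, h2, h3⟩ | ⟨-, h2, -⟩ := h.step_cases hi (k := p.finish - 1) (by omega)
  · exact absurd h1 h2
  · rw [hf] at h3
    rw [h3, ← h2, hv]
  · rw [hv] at h2; simp at h2

end Rounds.Follows

section Runs

variable {p : Params n V} {P Q : Protocol n V} {A : Adversary (compile p.juggernaut P Q)}
  {m : Setting} {H : ℕ} {ω : Randomness (compile p.juggernaut P Q) H}

theorem auth_out_mono {R k k' : ℕ} {i : Fin n} (hi : i ∉ (conf A m ω R).corrupt) (hk : 0 < k)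
    (hkk : k ≤ k') (hR : A.start + k' ≤ R) {o : Option V}
    (ho : ((authEmbedding _ P Q).part ((conf A m ω (A.start + k)).loc i)).inst.status.out = some o) :
    ((authEmbedding _ P Q).part ((conf A m ω (A.start + k')).loc i)).inst.status.out = some o := by
  induction k', hkk using Nat.le_induction with
  | base => exact ho
  | succ k' hk' ih =>
    have ih := ih (by omega)
    obtain ⟨y, h1, h2, -⟩ := exists_state p A m ω (k := k') hi (by omega) (by omega)
    rw [conf_loc_eq (by omega), h1, Embedding.part_some (s := y) _ rfl] at ih
    rw [conf_loc_eq (by omega), during_succ_loc hi (by omega), h1]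
    by_cases hd : y.host.decision = none
    · rw [instOf_recv hd, Embedding.part_some _ rfl]
      have h3 := h2.auth.recv i (ω.coin (A.start + k') i).1
        fun j b => msgsAt A m ω (A.start + k') j i (.inr (.inl b))
      have h4 : (y.auth.recv i (ω.coin (A.start + k') i).1
          fun j b => msgsAt A m ω (A.start + k') j i (.inr (.inl b))).inst.status.out = some o := by
        rw [Slot.recv_inst (by rw [h2.auth.running]; simp)]
        exact Inst.recv_status_out ih
      refine Eq.trans (congrArg Status.out (Sane.command_status ?_)) h4
      refine h3.started ?_
      by_contra hc
      rw [h3.idle (by omega)] at h4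
      simp [Inst.idle] at h4
    · rw [Inst.recv_of_halted (instOf_halted hd), Embedding.part_some (s := y) _ rfl]
      exact ih

/-- If the authenticated protocol works then all candidates agree. -/
theorem exists_candidates {A : Adversary (compile p.juggernaut P Q)}
    {ω : Randomness (compile p.juggernaut P Q) H} {r R : ℕ} (hr : A.start < r)
    (hR : R = min r (A.start + p.deadline)) (hn : 2 * p.ti + p.ts < n)
    (hts : 2 * p.ts < n) (hS : (conf A .authenticated ω r).corrupt.card ≤ p.ts)
    (hB : A.start + 2 < R → ¬ (authEmbedding _ P Q).Broken A .authenticated (A.start + 2) R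
      p.authRounds (conf A .authenticated ω r).corrupt ω) :
    ∃ v, (rounds p A .authenticated ω).Candidates (conf A .authenticated ω r).corruptᶜ
        (r - A.start) v ∧
      ∀ w, (∀ i ∉ (conf A .authenticated ω r).corrupt,
        ((rounds p A .authenticated ω).st 0 i).input = w) → v = w := by
  have hF := follows (p := p) (A := A) (m := .authenticated) (ω := ω) hr
  have hQ := quiet (p := p) (A := A) (m := .authenticated) (ω := ω) hr
  have hSd := sound (p := p) (A := A) (ω := ω) hr
  have hcard : (conf A .authenticated ω r).corruptᶜᶜ.card ≤ p.ts := by rwa [compl_compl]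
  obtain ⟨i0, hi0⟩ : ∃ i0, i0 ∉ (conf A .authenticated ω r).corrupt := by
    by_contra hne
    push Not at hne
    have := Finset.card_le_card (fun i _ => hne i :
      (Finset.univ : Finset (Fin n)) ⊆ (conf A .authenticated ω r).corrupt)
    rw [Finset.card_univ, Fintype.card_fin] at this
    omega
  -- The spare round in the deadline matters here: even for `authRounds = 0` the deadline comes
  -- after the start in round 2. So if `R` is not beyond that start, neither is `r`, and there are
  -- no candidates yet.
  have hd3 : 3 ≤ p.deadline := by simp only [Params.deadline]; omega
  by_cases hsR : A.start + 2 < R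
  · have hB := hB hsR
    simp only [Embedding.Broken, not_or, not_exists, not_and] at hB
    obtain ⟨hcons, hvalid, hout⟩ := hB
    have hvalid' : ∀ v, (∀ i ∉ (conf A .authenticated ω r).corrupt,
        ((rounds p A .authenticated ω).st 2 i).authInput = v) →
        ∀ i ∉ (conf A .authenticated ω r).corrupt, ∀ o,
        ((authEmbedding _ P Q).part ((conf A .authenticated ω R).loc i)).inst.status.out = some o →
          o = some v := fun v hv i hi o ho => by
      by_contra hne
      exact hvalid v (fun j hj y hy => by rw [auth_go hj (by omega) hy, hv j hj]) i hi o ho hne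
    have hcand : ∀ i ∉ (conf A .authenticated ω r).corrupt, ∀ k ≤ r - A.start, ∀ w,
        ((rounds p A .authenticated ω).st k i).cand = some w → ∃ o,
          ((authEmbedding _ P Q).part ((conf A .authenticated ω R).loc i)).inst.status.out = some o ∧
          w = o.getD p.default := by
      intro i hi k hk w hw
      have hiF := Finset.mem_compl.mpr hi
      obtain ⟨a, ha, hu, hnone, h1⟩ := hF.cand_set hiF hk hw
      obtain ⟨h2, h3, h4⟩ := hF.two_le_of_candidate hQ hiF (by omega) hu h1
      -- A candidate is adopted at the deadline at the latest, so its source is an output present in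
      -- round `R`.
      have had : a + 1 ≤ p.deadline := by
        by_contra hlt
        have := hF.cand_isSome hiF (k := a) (by omega) (by omega)
        rw [hnone] at this
        simp at this
      have h5 := auth_status hi (k := a) (by omega) h2 hu
      have h6 : ∃ o, ((rounds p A .authenticated ω).auth a i).out = some o ∧
          ((authEmbedding _ P Q).part ((conf A .authenticated ω R).loc i)).inst.status.out =
            some o := by
        obtain h3 | h3 := h3
        · obtain ⟨o, ho⟩ := Option.isSome_iff_exists.mp h3.1
          refine ⟨o, ho, ?_⟩
          rw [← h5] at ho
          obtain ⟨c, rfl⟩ := Nat.exists_eq_add_of_le (show A.start ≤ R by omega)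
          exact auth_out_mono hi (by omega) (by omega) (by omega) ho
        · have h6 : R = A.start + (a + 1) := by omega
          have h7 := hout (by simp only [Params.deadline] at h3; omega) i hi
          obtain ⟨o, ho⟩ := Option.ne_none_iff_exists'.mp h7
          refine ⟨o, ?_, ho⟩
          rw [← h5, ← h6, ho]
      obtain ⟨o, ho, ho'⟩ := h6
      refine ⟨o, ho', ?_⟩
      rw [h4, ho]
      -- A strong value does override the output, but it is the common input to the authenticated
      -- protocol, so validity makes the two equal.
      cases hst : ((rounds p A .authenticated ω).st a i).strong with
      | none => rfl
      | some x =>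
        have h7 := hvalid' x (fun j hj => hF.authInput_of_strong hSd hQ (by omega) hcard hn hiF
          (Finset.mem_compl.mpr hj) (k := a) (by omega) hst) i hi o ho'
        rw [h7]
        rfl
    by_cases hex : ∃ i ∉ (conf A .authenticated ω r).corrupt, ∃ o,
        ((authEmbedding _ P Q).part ((conf A .authenticated ω R).loc i)).inst.status.out = some o
    · obtain ⟨i, hi, o, ho⟩ := hex
      refine ⟨o.getD p.default, fun j hj k hk w hw => ?_, fun w hw => ?_⟩
      · obtain ⟨o', ho', rfl⟩ := hcand j (Finset.mem_compl.mp hj) k hk w hw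
        by_contra hne
        exact hcons i hi j (Finset.mem_compl.mp hj) o o' ho ho' fun h => hne (by rw [h])
      · rw [hvalid' w (fun j hj => hF.authInput_of_inputs hSd hQ (by omega) (by omega)
          (fun l hl => hw l (Finset.mem_compl.mp hl)) (Finset.mem_compl.mpr hj)) i hi o ho]
        rfl
    -- There is no output and hence no candidate, so any value would do for the first claim; the
    -- input of `i0` also satisfies the second.
    · refine ⟨_, fun j hj k hk w hw => ?_, fun w hw => hw i0 hi0⟩
      obtain ⟨o', ho', -⟩ := hcand j (Finset.mem_compl.mp hj) k hk w hw
      exact absurd ⟨j, Finset.mem_compl.mp hj, o', ho'⟩ hex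
  · refine ⟨_, fun j hj k hk w hw => ?_, fun w hw => hw i0 hi0⟩
    rw [hF.cand_eq_none hj hk (by omega) (hQ j hj)] at hw
    simp at hw

/-- If the sabotaged protocol works then all decisions agree. -/
theorem exists_decision_sab {R : ℕ} (hH : A.start + p.finish ≤ H)
    (hR : R = A.start + p.finish) (hn : 2 * p.ti + p.ts < n)
    (hS : (conf A m ω H).corrupt.card ≤ p.ti)
    (hB : (sabEmbedding _ P Q).Live A m (A.start + p.fallback) ω R →
      ¬ (sabEmbedding _ P Q).Broken A m (A.start + p.fallback) R
      p.sabRounds (conf A m ω H).corrupt ω) :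
    ∃ o, ∀ i ∉ (conf A m ω H).corrupt,
      ((rounds p A m ω).st (H - A.start) i).decision = some o ∧
      ∀ v, (∀ i ∉ (conf A m ω H).corrupt, ((rounds p A m ω).st 0 i).input = v) → o = some v := by
  have hf0 : 0 < p.fallback := by simp only [Params.fallback]; omega
  have hff : p.fallback < p.finish := by simp only [Params.finish]; omega
  have hF := follows (p := p) (A := A) (m := m) (ω := ω) (R := H) (by omega)
  have hQ := quiet (p := p) (A := A) (m := m) (ω := ω) (R := H) (by omega)
  have hcard : (conf A m ω H).corruptᶜᶜ.card ≤ p.ti := by rwa [compl_compl]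
  have hcand : ∀ v, (∀ i ∉ (conf A m ω H).corrupt, ((rounds p A m ω).st 0 i).input = v) →
      (rounds p A m ω).Candidates (conf A m ω H).corruptᶜ (H - A.start) v := fun v hv =>
    hF.candidates_of_inputs hQ hcard (by omega) fun i hi => hv i (Finset.mem_compl.mp hi)
  -- Parties that are honest in round `fallback` but corrupted later have to be included: the early
  -- decision of such a party already prevents a proper run of the sabotaged protocol.
  have hF0 := follows (p := p) (A := A) (m := m) (ω := ω) (R := A.start + p.fallback + 1) (by omega)
  have hsub : (conf A m ω (A.start + p.fallback + 1)).corrupt ⊆ (conf A m ω H).corrupt :=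
    conf_corrupt_mono A m ω (by omega)
  have hcard0 : (conf A m ω (A.start + p.fallback + 1)).corruptᶜᶜ.card ≤ p.ti := by
    rw [compl_compl]; exact (Finset.card_le_card hsub).trans hS
  have hmem : ∀ i ∉ (conf A m ω H).corrupt,
      i ∈ (conf A m ω (A.start + p.fallback + 1)).corruptᶜ := fun i hi =>
    Finset.mem_compl.mpr fun h => hi (hsub h)
  -- If somebody has decided early, the others rely on their locks and nothing is asked of the
  -- sabotaged protocol. Otherwise its run is live and its guarantees apply.
  by_cases hex : ∃ i0 ∈ (conf A m ω (A.start + p.fallback + 1)).corruptᶜ, ∃ o,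
      ((rounds p A m ω).st p.fallback i0).decision = some o
  · obtain ⟨i0, hi0, o, ho⟩ := hex
    refine ⟨o, fun i hi => ?_⟩
    have hiF := Finset.mem_compl.mpr hi
    cases hd : ((rounds p A m ω).st p.fallback i).decision with
    | some o' =>
      have : o = o' := hF0.decision_unique (by omega) hi0 (hmem i hi) (by omega) (by omega) hff hff
        ho hd
      subst this
      refine ⟨hF.decision_of_le hiF (by omega) le_rfl hd, fun v hv => ?_⟩
      exact hF.decision_eq (hcand v hv) (by omega) hiF (by omega) hff hd
    | none =>
      obtain ⟨h1, h2⟩ := hF0.lock_of_decision hcard0 hn (by omega) hi0 (hmem i hi) ho hd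
      obtain ⟨w, rfl⟩ := Option.ne_none_iff_exists'.mp h2
      obtain ⟨-, h3⟩ := hF.decision_of_late hiF (by omega) hd
      rw [h1] at h3
      refine ⟨hF.decision_of_le hiF (by omega) le_rfl h3, fun v hv => ?_⟩
      rw [hF.lock_eq (hcand v hv) (by omega) hcard (by omega) hiF hd h1]
  · have hund : ∀ i ∈ (conf A m ω (A.start + p.fallback + 1)).corruptᶜ,
        ((rounds p A m ω).st p.fallback i).decision = none := fun i hi => by
      by_contra hne
      obtain ⟨o, ho⟩ := Option.ne_none_iff_exists'.mp hne
      exact hex ⟨i, hi, o, ho⟩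
    have hB := hB (hR ▸ live_sab fun i hi => hund i (Finset.mem_compl.mpr hi))
    simp only [Embedding.Broken, not_or, not_exists, not_and] at hB
    obtain ⟨hcons, hvalid, hout⟩ := hB
    have hout := hout (by rw [hR]; simp only [Params.finish]; omega)
    by_cases hne : ∃ i, i ∉ (conf A m ω H).corrupt
    · obtain ⟨j, hj⟩ := hne
      obtain ⟨o, ho⟩ := Option.ne_none_iff_exists'.mp (hout j hj)
      have hall : ∀ i ∉ (conf A m ω H).corrupt,
          ((sabEmbedding _ P Q).part ((conf A m ω R).loc i)).inst.status.out = some o :=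
        fun i hi => by
          obtain ⟨o', ho'⟩ := Option.ne_none_iff_exists'.mp (hout i hi)
          have : o = o' := by
            by_contra hne
            exact hcons j hj i hi o o' ho ho' hne
          rw [ho', this]
      have hvalid' : ∀ v, (∀ i ∉ (conf A m ω H).corrupt,
          ((rounds p A m ω).st p.fallback i).sabInput = v) → o = some v := fun v hv => by
        by_contra hne
        refine hvalid v (fun i hi y hy => ?_) j hj o ho hne
        rw [sab_go hi (by omega) (hund i (hmem i hi)) hy, hv i hi]
      refine ⟨o, fun i hi => ⟨?_, fun v hv => ?_⟩⟩
      · have hiF := Finset.mem_compl.mpr hi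
        obtain ⟨h1, h2⟩ := hF.decision_of_late hiF (by omega) (hund i (hmem i hi))
        have h3 := sab_status hi (k := p.finish - 1) (by omega) (by omega) h1
        have h4 : A.start + (p.finish - 1 + 1) = R := by omega
        rw [h4] at h3
        rw [← h3, hall i hi] at h2
        refine hF.decision_of_le hiF (by omega) le_rfl (h2.trans ?_)
        cases hl : ((rounds p A m ω).st p.fallback i).lock with
        | none => rfl
        | some v =>
          rw [hvalid' v fun j hj => hF.sabInput_of_lock hcard hn (by omega) hiF
            (Finset.mem_compl.mpr hj) (hund i (hmem i hi)) (hund j (hmem j hj)) hl]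
          rfl
      · exact hvalid' v fun i hi => hF.sabInput_eq (hcand v hv) (by omega) hcard (by omega)
          (Finset.mem_compl.mpr hi) (hund i (hmem i hi))
    · push Not at hne
      exact ⟨none, fun i hi => absurd (hne i) hi⟩

end Runs

end

section

variable {n : ℕ}

/-! ### Security -/

/-- Corrupt sets only grow. For a static adversary they are constant from the first round on, but
empty before it; therefore `R` must be positive. -/
theorem reachable_of_admissible {V : Type} {J : Protocol n V} {A : Adversary J} {m : Setting}
    {q : Corruption} {t H : ℕ} (hA : Admissible A m q t H) (ω : Randomness J H) {R r : ℕ}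
    (hR : 0 < R) (hr : R ≤ r) (hrH : r ≤ H) :
    Embedding.Reachable A m q t R ω (conf A m ω r).corrupt := by
  obtain ⟨h1, h2⟩ := hA ω
  refine ⟨conf_corrupt_mono A m ω hr, (Finset.card_le_card (conf_corrupt_mono A m ω hrH)).trans h1,
    fun hq => ?_⟩
  have h3 : ∀ r, 0 < r → r ≤ H → (conf A m ω r).corrupt = (during A m ω 0).corrupt := by
    intro r h0 hrH
    obtain ⟨k, rfl⟩ := Nat.exists_eq_succ_of_ne_zero h0.ne'
    exact h2 hq k hrH
  rw [h3 r (by omega) hrH, h3 R hR (by omega)]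

/-! ### The bad events, and what holds outside them -/

section Failures

variable {V : Type} {p : Params n V} {P Q : Protocol n V}

/-- The authenticated protocol fails in a live execution. -/
def AuthFails (q : Corruption) (A : Adversary (compile p.juggernaut P Q)) {H : ℕ}
    (ω : Randomness (compile p.juggernaut P Q) H) : Prop :=
  (authEmbedding _ P Q).Live A .authenticated (A.start + 2) ω (min H (A.start + p.deadline)) ∧
    A.start + 2 < min H (A.start + p.deadline) ∧ ∃ S, Embedding.Reachable A .authenticated q p.ts
      (min H (A.start + p.deadline)) ω S ∧ (authEmbedding _ P Q).Broken A .authenticated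
        (A.start + 2) (min H (A.start + p.deadline)) p.authRounds S ω

/-- The sabotaged protocol fails in a live execution. -/
def SabFails (q : Corruption) (A : Adversary (compile p.juggernaut P Q)) {H : ℕ}
    (ω : Randomness (compile p.juggernaut P Q) H) : Prop :=
  (sabEmbedding _ P Q).Live A .sabotaged (A.start + p.fallback) ω (min H (A.start + p.finish)) ∧
    A.start + p.fallback < min H (A.start + p.finish) ∧ ∃ S,
      Embedding.Reachable A .sabotaged q p.ti (min H (A.start + p.finish)) ω S ∧
        (sabEmbedding _ P Q).Broken A .sabotaged (A.start + p.fallback)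
          (min H (A.start + p.finish)) p.sabRounds S ω

/-- The decisions of the honest parties are those of a Byzantine agreement. -/
def Agree (A : Adversary (compile p.juggernaut P Q)) (m : Setting) {H : ℕ}
    (ω : Randomness (compile p.juggernaut P Q) H) : Prop :=
  (∀ i ∉ (conf A m ω H).corrupt, ∀ j ∉ (conf A m ω H).corrupt, ∀ v w,
    ((rounds p A m ω).st (H - A.start) i).decision = some v →
      ((rounds p A m ω).st (H - A.start) j).decision = some w → v = w) ∧
  (A.start + p.finish ≤ H → ∀ v,
    (∀ i ∉ (conf A m ω H).corrupt, ((rounds p A m ω).st 0 i).input = v) →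
      ∀ i ∉ (conf A m ω H).corrupt,
        ((rounds p A m ω).st (H - A.start) i).decision = some (some v))

variable {A : Adversary (compile p.juggernaut P Q)} {q : Corruption} {H : ℕ}
  {ω : Randomness (compile p.juggernaut P Q) H}

theorem exists_candidates_of_not_authFails (hA : Admissible A .authenticated q p.ts H)
    (hω : ¬ AuthFails q A ω) (hn : 2 * p.ti + p.ts < n) (hts : 2 * p.ts < n) {r : ℕ}
    (hr : A.start < r) (hrH : r ≤ H) (hrR : min H (A.start + p.deadline) ≤ r) :
    ∃ v, (rounds p A .authenticated ω).Candidates (conf A .authenticated ω r).corruptᶜ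
        (r - A.start) v ∧
      ∀ w, (∀ i ∉ (conf A .authenticated ω r).corrupt,
        ((rounds p A .authenticated ω).st 0 i).input = w) → v = w := by
  refine exists_candidates (R := min H (A.start + p.deadline)) hr (by omega) hn hts ?_ fun h hB => ?_
  · exact (Finset.card_le_card (conf_corrupt_mono A _ ω hrH)).trans (hA ω).1
  · exact hω ⟨(live_auth p A .authenticated ω).mono (min_le_right ..), h, _,
      reachable_of_admissible hA ω (by omega) hrR hrH, hB⟩

/-- The candidates agree, so every decision before `finish` is the common candidate, and by
`deadline + 4` everybody has decided. -/
theorem agree_of_not_authFails (hA : Admissible A .authenticated q p.ts H)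
    (hω : ¬ AuthFails q A ω) (hn : 2 * p.ti + p.ts < n) (hts : 2 * p.ts < n) (hH : A.start < H) :
    Agree A .authenticated ω := by
  obtain ⟨v, hc, hv⟩ := exists_candidates_of_not_authFails hA hω hn hts hH le_rfl (min_le_left ..)
  have hF := follows (p := p) (A := A) (m := .authenticated) (ω := ω) hH
  have hcard : (conf A .authenticated ω H).corruptᶜᶜ.card ≤ p.ts := by
    rw [compl_compl]; exact (hA ω).1
  have hall : A.start + p.finish ≤ H → ∀ i ∉ (conf A .authenticated ω H).corrupt,
      ((rounds p A .authenticated ω).st (H - A.start) i).decision = some (some v) := by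
    intro hfin i hi
    have hf : p.deadline + 4 < p.finish := by simp only [Params.finish, Params.fallback]; omega
    exact hF.decision_of_le (Finset.mem_compl.mpr hi) (k := p.deadline + 4) (by omega) le_rfl
      (hF.decision_of_candidates (sound hH) hc hcard hts le_rfl (by omega)
        (fun j hj => hF.cand_isSome hj le_rfl (by omega)) (Finset.mem_compl.mpr hi))
  refine ⟨fun i hi j hj x y hx hy => ?_, fun hfin w hw i hi => ?_⟩
  · obtain hfin | hfin := lt_or_ge H (A.start + p.finish)
    · rw [hF.decision_eq hc (by omega) (Finset.mem_compl.mpr hi) le_rfl (by omega) hx,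
        hF.decision_eq hc (by omega) (Finset.mem_compl.mpr hj) le_rfl (by omega) hy]
    · rw [hall hfin i hi] at hx
      rw [hall hfin j hj] at hy
      exact Option.some.inj (hx.symm.trans hy)
  · rw [hall hfin i hi, hv w hw]

/-- If the execution ends before `finish`, uniqueness of commitments suffices; the sabotaged
protocol matters only for later decisions. -/
theorem agree_of_not_sabFails {A : Adversary (compile p.juggernaut P Q)}
    {ω : Randomness (compile p.juggernaut P Q) H} (hA : Admissible A .sabotaged q p.ti H)
    (hω : ¬ SabFails q A ω) (hn : 2 * p.ti + p.ts < n) (hH : A.start < H) :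
    Agree A .sabotaged ω := by
  have hF := follows (p := p) (A := A) (m := .sabotaged) (ω := ω) hH
  have hcard : (conf A .sabotaged ω H).corruptᶜᶜ.card ≤ p.ti := by
    rw [compl_compl]; exact (hA ω).1
  obtain hfin | hfin := lt_or_ge H (A.start + p.finish)
  · refine ⟨fun i hi j hj x y hx hy => ?_, fun h => by omega⟩
    exact hF.decision_unique (by omega) (Finset.mem_compl.mpr hi) (Finset.mem_compl.mpr hj)
      le_rfl le_rfl (by omega) (by omega) hx hy
  · have hff : p.fallback < p.finish := by simp only [Params.finish]; omega
    obtain ⟨o, ho⟩ := exists_decision_sab (p := p) (A := A) (m := .sabotaged) (ω := ω)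
      (R := min H (A.start + p.finish)) hfin (by omega) hn (hA ω).1 fun hl hB =>
        hω ⟨hl, by omega, _, reachable_of_admissible hA ω (by omega) (min_le_left ..) le_rfl, hB⟩
    refine ⟨fun i hi j hj x y hx hy => ?_, fun _ v hv i hi => ?_⟩
    · rw [(ho i hi).1] at hx
      rw [(ho j hj).1] at hy
      exact Option.some.inj (hx.symm.trans hy)
    · rw [(ho i hi).1, (ho i hi).2 v hv]

/-- Termination is unconditional: the clock forces a decision at `finish`, with default ⊥ if the
sabotaged protocol has no output. -/
theorem decided_of_finish {m : Setting} {R k : ℕ} {i : Fin n} (hi : i ∉ (conf A m ω R).corrupt)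
    (hk : p.finish ≤ k) (hR : A.start + k ≤ R) : ((conf A m ω (A.start + k)).loc i).status.Done := by
  have hf0 : 0 < p.finish := by simp only [Params.finish]; omega
  obtain ⟨y, h1, h2, -⟩ := exists_state p A m ω (k := k) hi (by omega) hR
  rw [conf_loc_eq (by omega), h1]
  have h3 : (JugState.decision y.host).isSome = true := by
    by_contra hne
    have := h2.lt_finish (by simpa using hne)
    omega
  exact ⟨h3, h3⟩

theorem authStarted_iff {m : Setting} {r : ℕ} {i : Fin n} (hi : i ∉ (during A m ω r).corrupt) :
    AuthStarted (during A m ω r) i ↔ A.start + 2 ≤ r := by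
  obtain hrs | hrs := lt_or_ge r A.start
  · constructor
    · rintro ⟨s, hs, -⟩
      rw [during_loc_of_lt_start hrs] at hs
      simp [Inst.idle] at hs
    · intro h; omega
  · obtain ⟨k, rfl⟩ := Nat.exists_eq_add_of_le hrs
    obtain ⟨y, h1, h2, -⟩ := exists_state p A m ω (R := A.start + k + 1) (k := k) hi (by omega)
      (by omega)
    constructor
    · rintro ⟨s, hs, h3⟩
      rw [h1] at hs
      obtain rfl : y = s := Option.some.inj hs
      by_contra hlt
      rw [h2.auth.idle (by have := h2.clock_le; omega)] at h3
      simp [Inst.idle] at h3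
    · intro hk
      refine ⟨y, by rw [h1]; rfl, h2.auth.started ?_⟩
      by_cases hd : y.host.decision = none
      · rw [h2.clock hd]; omega
      · exact h2.two_le hd

/-- After the authenticated protocol, a party decides in a constant number of rounds. -/
theorem done_of_authDone (hA : Admissible A .authenticated q p.ts H)
    (hω : ¬ AuthFails q A ω) (hn : 2 * p.ti + p.ts < n) (hts : 2 * p.ts < n) {r C : ℕ} (hC : 5 ≤ C)
    (hr : r + C ≤ H)
    (h : (∀ i ∉ (during A .authenticated ω r).corrupt, AuthDone (during A .authenticated ω r) i) ∨
      ∃ i ∉ (during A .authenticated ω r).corrupt, AuthAbandoned (during A .authenticated ω r) i)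
    {j : Fin n} (hj : j ∉ (conf A .authenticated ω H).corrupt) :
    ((conf A .authenticated ω (r + C)).loc j).status.Done := by
  have hhonest : ∀ i ∉ (conf A .authenticated ω H).corrupt,
      i ∉ (during A .authenticated ω r).corrupt := fun i hi h' =>
    hi (during_corrupt_subset_conf A _ ω (by omega) h')
  have hrs : A.start ≤ r := by
    by_contra hlt
    obtain h | ⟨i, -, s, hs, -⟩ := h
    · obtain ⟨s, hs, -⟩ := h j (hhonest j hj)
      rw [during_loc_of_lt_start (by omega)] at hs
      simp [Inst.idle] at hs
    · rw [during_loc_of_lt_start (by omega)] at hs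
      simp [Inst.idle] at hs
  obtain ⟨k, rfl⟩ := Nat.exists_eq_add_of_le hrs
  have hH : A.start < H := by omega
  obtain ⟨v, hc, -⟩ := exists_candidates_of_not_authFails hA hω hn hts hH le_rfl (min_le_left ..)
  have hF := follows (p := p) (A := A) (m := .authenticated) (ω := ω) hH
  have hcard : (conf A .authenticated ω H).corruptᶜᶜ.card ≤ p.ts := by
    rw [compl_compl]; exact (hA ω).1
  -- A time at which all honest parties have candidates, at most one round after the given one.
  -- Adding the four rounds of agreement gives a delay of five.
  obtain ⟨k0, h1, h2, h3⟩ : ∃ k0 ≤ p.deadline, k0 ≤ k + 1 ∧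
      ∀ i ∈ (conf A .authenticated ω H).corruptᶜ,
        ((rounds p A .authenticated ω).st k0 i).cand.isSome = true := by
    obtain hkd | hkd := le_or_gt p.deadline (k + 1)
    · exact ⟨p.deadline, le_rfl, hkd, fun i hi => hF.cand_isSome hi le_rfl (by omega)⟩
    obtain h | ⟨i, hi, s, hs, h4, h5, h6⟩ := h
    · refine ⟨k + 1, hkd.le, le_rfl, fun i hi => ?_⟩
      by_cases hd : ((rounds p A .authenticated ω).st (k + 1) i).decision = none
      · obtain ⟨h4, -, h5⟩ := hF.next_of_undecided hi (by omega) hd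
        obtain ⟨s, hs, h6⟩ := h i (hhonest i (Finset.mem_compl.mp hi))
        obtain ⟨y, h7, h8, -⟩ := exists_state p A .authenticated ω (k := k)
          (Finset.mem_compl.mp hi) hH (by omega)
        rw [h7] at hs
        obtain rfl : y = s := Option.some.inj hs
        have h9 : ((rounds p A .authenticated ω).auth k i).Done := by
          rw [rounds_auth h7, Sane.authStatus, Slot.recv_inst (by rw [h8.auth.running]; simp)]
          exact Sane.done_of_recv h6
        rw [h5]
        simp only [Params.next, Params.update, Params.candidate, Option.isSome_or]
        rw [if_pos (.inl h9)]
        simp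
      · obtain ⟨o, ho⟩ := Option.ne_none_iff_exists'.mp hd
        obtain ⟨a, ha, -, -, h4, -⟩ | ⟨a, ha, -, h4, -⟩ := hF.decision_set hi (by omega) ho
        · obtain ⟨w, hw⟩ := Option.isSome_iff_exists.mp h4
          rw [hF.cand_mono hi ha.le (by omega) hw]
          rfl
        · simp only [Params.finish, Params.fallback] at h4
          omega
    -- Before the deadline no honest party abandons an unfinished instance: its decision would
    -- require a candidate, hence a terminated instance.
    · exfalso
      obtain ⟨y, h7, h8, -⟩ := exists_state p A .authenticated ω (R := A.start + k + 1) (k := k) hi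
        (by omega) (by omega)
      rw [h7] at hs h6
      obtain rfl : y = s := Option.some.inj hs
      have hk := h8.clock_le
      obtain h6 | h6 := h6
      · exact absurd (h8.auth.running.symm.trans h6) (by simp)
      · obtain h9 | ⟨-, h9⟩ := h8.early (Option.isSome_iff_ne_none.mp h6)
        · simp only [Params.finish, Params.fallback] at h9
          omega
        · exact h5 (h8.cand h9 (by omega))
  have h4 := hF.decision_of_candidates (sound hH) hc hcard hts h1 (by omega) h3
    (Finset.mem_compl.mpr hj)
  have h5 := hF.decision_of_le (Finset.mem_compl.mpr hj) (k' := k + C) (by omega) (by omega) h4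
  rw [add_assoc, conf_status hj (by omega) (by omega), h5]
  exact ⟨rfl, rfl⟩

end Failures

/-! ### Negligible failure for families of executions -/

section Families

variable {V : ℕ → Type} {p : ∀ κ, Params n (V κ)} {P Q : ∀ κ, Protocol n (V κ)} {q : Corruption}

theorem negligible_of_false {Ω : ℕ → Type} [∀ κ, Fintype (Ω κ)] {E : ∀ κ, Ω κ → Prop}
    (h : ∀ κ ω, ¬ E κ ω) : Negligible fun κ => prob (E κ) := by
  have h0 : (fun κ => prob (E κ)) = 0 := by
    funext κ
    simp [prob, h κ]
  rw [h0]
  exact Asymptotics.superpolynomialDecay_zero Filter.atTop fun κ : ℕ => (κ : ℝ)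

/-- Validity and consistency can fail only on the bad event, and termination never fails. -/
theorem secureBy_of_agree {m : Setting} {t : ℕ} {T : ℕ → ℕ} (hT : ∀ κ, (p κ).finish ≤ T κ)
    (h : ∀ (A : ∀ κ, Adversary (compile (p κ).juggernaut (P κ) (Q κ))) (H : ℕ → ℕ),
      (∀ κ, Admissible (A κ) m q t (H κ)) →
      ∃ B : ∀ κ, Randomness (compile (p κ).juggernaut (P κ) (Q κ)) (H κ) → Prop,
        (Negligible fun κ => prob (B κ)) ∧
        ∀ κ ω, ¬ B κ ω → (A κ).start < H κ → Agree (A κ) m ω) :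
    SecureBy m q t (fun κ => compile (p κ).juggernaut (P κ) (Q κ)) T := by
  have hf0 : ∀ κ, 0 < (p κ).finish := fun κ => by simp only [Params.finish]; omega
  refine ⟨fun A H hA => ?_, fun A H hA => ?_, fun A H hA => ?_⟩
  · obtain ⟨B, hB, hB'⟩ := h A H hA
    refine negligible_prob_mono hB fun κ ω => ?_
    rintro ⟨h1, v, h2, i, hi, h3⟩
    by_contra hω
    have hT := hT κ
    have hf0 := hf0 κ
    have hH : (A κ).start < H κ := by omega
    have h4 := (hB' κ ω hω hH).2 (by omega) v
      (fun j hj => input_of_inp hj hH (h2 j hj)) i hi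
    have h5 := conf_status (k := H κ - (A κ).start) hi (by omega) (by omega)
    rw [h4] at h5
    have h6 : (A κ).start + (H κ - (A κ).start) = H κ := by omega
    rw [h6] at h5
    rw [h5] at h3
    exact h3 rfl
  · obtain ⟨B, hB, hB'⟩ := h A H hA
    refine negligible_prob_mono hB fun κ ω => ?_
    rintro ⟨i, hi, j, hj, v, w, hv, hw, hne⟩
    by_contra hω
    obtain hH | hH := le_or_gt (H κ) (A κ).start
    · rw [conf_loc_of_le_start _ _ _ hH] at hv
      simp [Inst.idle] at hv
    · have h6 : (A κ).start + (H κ - (A κ).start) = H κ := by omega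
      have h5 := conf_status (k := H κ - (A κ).start) hi (by omega) (by omega)
      have h7 := conf_status (k := H κ - (A κ).start) hj (by omega) (by omega)
      rw [h6] at h5 h7
      rw [h5] at hv
      rw [h7] at hw
      exact hne ((hB' κ ω hω hH).1 i hi j hj v w hv hw)
  · refine negligible_of_false fun κ ω => ?_
    rintro ⟨h1, i, hi, h2⟩
    exact h2 (decided_of_finish hi (hT κ) h1)

variable {ts ti : ℕ}

theorem negligible_authFails [∀ κ, Nonempty (V κ)] (hts : ∀ κ, (p κ).ts = ts)
    (hP : BlackBox .authenticated q ts P fun κ => (p κ).authRounds)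
    (A : ∀ κ, Adversary (compile (p κ).juggernaut (P κ) (Q κ))) (H : ℕ → ℕ)
    (hA : ∀ κ, Admissible (A κ) .authenticated q ts (H κ)) :
    Negligible fun κ => prob fun ω : Randomness _ (H κ) => AuthFails q (A κ) ω := by
  obtain ⟨-, h1, h2, h3⟩ := hP
  refine negligible_prob_mono (Embedding.negligible_broken (fun κ => authEmbedding _ (P κ) (Q κ))
    h1 h2 h3 A H (fun κ => (A κ).start + 2) (fun κ => min (H κ) ((A κ).start + (p κ).deadline)) hA
    (fun κ => by omega) (fun κ => min_le_left ..)) fun κ ω h => ?_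
  rw [AuthFails, hts] at h
  exact h

theorem negligible_sabFails [∀ κ, Nonempty (V κ)] (hti : ∀ κ, (p κ).ti = ti)
    (hQ : BlackBox .sabotaged q ti Q fun κ => (p κ).sabRounds)
    (A : ∀ κ, Adversary (compile (p κ).juggernaut (P κ) (Q κ))) (H : ℕ → ℕ)
    (hA : ∀ κ, Admissible (A κ) .sabotaged q ti (H κ)) :
    Negligible fun κ => prob fun ω : Randomness _ (H κ) => SabFails q (A κ) ω := by
  obtain ⟨-, h1, h2, h3⟩ := hQ
  refine negligible_prob_mono (Embedding.negligible_broken (fun κ => sabEmbedding _ (P κ) (Q κ))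
    h1 h2 h3 A H (fun κ => (A κ).start + (p κ).fallback)
    (fun κ => min (H κ) ((A κ).start + (p κ).finish)) hA
    (fun κ => by simp only [Params.fallback]; omega) (fun κ => min_le_left ..)) fun κ ω h => ?_
  rw [SabFails, hti] at h
  exact h

end Families

end

section

variable {n : ℕ}

/-! ### Communication -/

section Bits

variable {V : Type} {J : Protocol n V} (A : Adversary J) (m : Setting) {H : ℕ} (ω : Randomness J H)
  (κ : ℕ)

open Classical in
/-- The bits sent by party `i` in round `r`, while honest, within the key instances in `S`. -/
noncomputable def sentBits (S : Set J.K) (r : ℕ) (i : Fin n) : ℕ :=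
  if i ∈ (during A m ω r).corrupt then 0 else
    ∑ j : Fin n, ∑ a : J.K, if a ∈ S then (msgsAt A m ω r i j a).size κ else 0

theorem bits_eq_sum (S : Set J.K) :
    bits κ A m S ω = ∑ i, ∑ r ∈ Finset.range H, sentBits A m ω κ S r i := by
  have key : ∀ r, (conf A m ω r).bits κ S = ∑ k ∈ Finset.range r, ∑ i, sentBits A m ω κ S k i := by
    intro r
    induction r with
    | zero => simp [conf, Config.start, Config.bits]
    | succ r ih =>
      rw [Finset.sum_range_succ, ← ih, Config.bits, conf_succ_hist, List.map_cons, List.sum_cons,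
        add_comm]
      rfl
  rw [bits, key, Finset.sum_comm]

theorem sentBits_union {S T : Set J.K} (h : Disjoint S T) (r : ℕ) (i : Fin n) :
    sentBits A m ω κ (S ∪ T) r i = sentBits A m ω κ S r i + sentBits A m ω κ T r i := by
  unfold sentBits
  split_ifs
  · rfl
  · simp only [← Finset.sum_add_distrib]
    refine Finset.sum_congr rfl fun j _ => Finset.sum_congr rfl fun a _ => ?_
    by_cases hS : a ∈ S
    · rw [if_pos (Set.mem_union_left T hS), if_pos hS, if_neg (Set.disjoint_left.mp h hS), add_zero]
    · by_cases hT : a ∈ T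
      · rw [if_pos (Set.mem_union_right S hT), if_neg hS, if_pos hT, zero_add]
      · rw [if_neg fun h => h.elim hS hT, if_neg hS, if_neg hT]

theorem bits_union {S T : Set J.K} (h : Disjoint S T) :
    bits κ A m (S ∪ T) ω = bits κ A m S ω + bits κ A m T ω := by
  simp only [bits_eq_sum, sentBits_union A m ω κ h, Finset.sum_add_distrib]

end Bits

theorem univ_eq_parts {V : Type} (h : Host n V) (P Q : Protocol n V) :
    (Set.univ : Set (compile h P Q).K) = {hostKey h P Q} ∪ authPart h P Q ∪ sabPart h P Q := by
  refine Eq.symm (Set.eq_univ_of_forall fun a => ?_)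
  obtain ⟨⟩ | b | b := a
  · exact .inl (.inl rfl)
  · exact .inl (.inr ⟨b, rfl⟩)
  · exact .inr ⟨b, rfl⟩

theorem bits_univ {V : Type} {h : Host n V} {P Q : Protocol n V} (κ : ℕ)
    (A : Adversary (compile h P Q)) (m : Setting) {H : ℕ} (ω : Randomness (compile h P Q) H) :
    bits κ A m Set.univ ω = bits κ A m {hostKey h P Q} ω + bits κ A m (authPart h P Q) ω +
      bits κ A m (sabPart h P Q) ω := by
  have h1 : Disjoint ({hostKey h P Q} : Set (compile h P Q).K) (authPart h P Q) := by
    refine Set.disjoint_left.mpr ?_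
    rintro a rfl ⟨b, hb⟩
    exact absurd hb Sum.inl_ne_inr
  have h2 : Disjoint ({hostKey h P Q} ∪ authPart h P Q) (sabPart h P Q) := by
    refine Set.disjoint_left.mpr ?_
    rintro a (rfl | ⟨b, rfl⟩) ⟨b', hb⟩
    · exact absurd hb Sum.inl_ne_inr
    · exact absurd (Sum.inr.inj hb) Sum.inl_ne_inr
  rw [univ_eq_parts, bits_union _ _ _ _ h2, bits_union _ _ _ _ h1]

/-! ### Communication of the host, and silence of the sabotaged protocol -/

section Host

variable {V : Type} {p : Params n V} {P Q : Protocol n V}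
  {A : Adversary (compile p.juggernaut P Q)} {m : Setting} {H : ℕ}
  {ω : Randomness (compile p.juggernaut P Q) H}

theorem Wire.size_eq_zero {κ : ℕ} {w : Wire n} (hb : w.body = []) (ht : w.tokens = []) :
    w.size κ = 0 := by
  simp [Wire.size, hb, ht]

theorem body_eq_nil {y : CompiledState p.juggernaut P Q} {i j : Fin n} {coin} :
    ((instOf y).send i coin j (hostKey _ P Q)).body = [] := by
  unfold Inst.send
  split
  · rfl
  · rfl

theorem sentBits_host {κ r : ℕ} {i : Fin n} (hi : i ∉ (during A m ω r).corrupt) :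
    sentBits A m ω κ {hostKey _ P Q} r i =
      ∑ j, (msgsAt A m ω r i j (hostKey _ P Q)).size κ := by
  rw [sentBits, if_neg hi]
  refine Finset.sum_congr rfl fun j _ => ?_
  refine (Finset.sum_eq_single_of_mem _ (Finset.mem_univ (hostKey _ P Q))
    fun b _ hb => if_neg hb).trans (if_pos rfl)

theorem sentBits_of_lt_start {κ r : ℕ} {i : Fin n} {S : Set (compile p.juggernaut P Q).K}
    (hr : r < A.start) : sentBits A m ω κ S r i = 0 := by
  unfold sentBits
  split_ifs with hi
  · rfl
  · refine Finset.sum_eq_zero fun j _ => Finset.sum_eq_zero fun a _ => ?_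
    split_ifs
    · rw [msgsAt_of_notMem _ _ _ hi, during_loc_of_lt_start hr, Inst.send_idle]
      exact Wire.size_eq_zero rfl rfl
    · rfl

theorem sentBits_host_le {κ l R k : ℕ} {i : Fin n} (hl : ∀ v, (p.encode v).length ≤ l)
    (hi : i ∉ (conf A m ω R).corrupt) (hk : A.start + k < R) :
    (((rounds p A m ω).st k i).decision = none →
      sentBits A m ω κ {hostKey _ P Q} (A.start + k) i ≤
        n * (κ + (2 + l)) * ((rounds p A m ω).st k i).outbox.length) ∧
    (((rounds p A m ω).st k i).decision ≠ none →
      sentBits A m ω κ {hostKey _ P Q} (A.start + k) i = 0) := by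
  have hF := follows (p := p) (A := A) (m := m) (ω := ω) (R := R) (by omega)
  have hiF := Finset.mem_compl.mpr hi
  have hid : i ∉ (during A m ω (A.start + k)).corrupt := fun h =>
    hi (during_corrupt_subset_conf A m ω hk h)
  obtain ⟨y, h1, -⟩ := exists_state p A m ω (k := k) hi (by omega) hk.le
  have hbody : ∀ j, (msgsAt A m ω (A.start + k) i j (hostKey _ P Q)).body = [] := fun j => by
    rw [msgsAt_of_notMem _ _ _ hid, h1]
    exact body_eq_nil
  rw [sentBits_host hid]
  constructor
  · intro hd
    have hsize : ∀ j, (msgsAt A m ω (A.start + k) i j (hostKey _ P Q)).size κ ≤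
        (κ + (2 + l)) * ((rounds p A m ω).st k i).outbox.length := fun j => by
      have h2 : (msgsAt A m ω (A.start + k) i j (hostKey _ P Q)).tokens =
        ((rounds p A m ω).st k i).outbox := hF.sent i hiF j k (by omega) hd
      rw [Wire.size, hbody, h2, List.length_nil, zero_add]
      refine (List.sum_le_card_nsmul _ (κ + (2 + l)) ?_).trans ?_
      · intro x hx
        obtain ⟨t, ht, rfl⟩ := List.mem_map.mp hx
        exact Params.issued_size_le hl (hF.outbox_subset hiF (by omega) ht)
      · rw [List.length_map, smul_eq_mul, mul_comm]
    refine (Finset.sum_le_card_nsmul _ _ _ fun j _ => hsize j).trans ?_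
    rw [Finset.card_univ, Fintype.card_fin, smul_eq_mul, mul_assoc]
  · intro hd
    exact Finset.sum_eq_zero fun j _ => Wire.size_eq_zero (hbody j)
      (hF.quiet i hiF j k (by omega) hd)

/-- Amortized accounting: bits already sent and bits waiting in the outbox are together paid for by
the tokens issued so far. -/
theorem sum_sentBits_host_add_le {κ l R k : ℕ} {i : Fin n} (hl : ∀ v, (p.encode v).length ≤ l)
    (hi : i ∉ (conf A m ω R).corrupt) (hR : A.start < R) (hk : A.start + k ≤ R) :
    ∑ r ∈ Finset.range (A.start + k), sentBits A m ω κ {hostKey _ P Q} r i +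
      n * (κ + (2 + l)) * ((rounds p A m ω).st k i).outbox.length ≤
        n * (κ + (2 + l)) * (p.issued i ((rounds p A m ω).st k i)).length := by
  have hF := follows (p := p) (A := A) (m := m) (ω := ω) (R := R) (by omega)
  have hiF := Finset.mem_compl.mpr hi
  induction k with
  | zero =>
    rw [Finset.sum_eq_zero fun r hr => sentBits_of_lt_start (by simpa using hr), zero_add,
      hF.init i hiF, Params.outbox_initial]
  | succ k ih =>
    have ih := ih (by omega)
    obtain ⟨h1, h2⟩ := sentBits_host_le (κ := κ) hl hi (A := A) (m := m) (ω := ω) (k := k) (by omega)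
    rw [← add_assoc, Finset.sum_range_succ]
    by_cases hd : ((rounds p A m ω).st k i).decision = none
    · have h1 := h1 hd
      have h3 := Nat.mul_le_mul_left (n * (κ + (2 + l))) (Params.outbox_step_length (p := p) (i := i)
        (s := (rounds p A m ω).st k i) (inbox := fun j => (rounds p A m ω).wire k j i)
        (a := (rounds p A m ω).auth k i) (b := (rounds p A m ω).sab k i))
      rw [← hF.step i hiF k (by omega) hd, mul_add] at h3
      omega
    · rw [h2 hd, hF.stay i hiF k (by omega) hd]
      omega

/-- The bound also covers parties that are corrupted during the execution: up to the last honest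
round the accounting applies, and afterwards nothing is counted. -/
theorem sum_sentBits_host_le {κ l : ℕ} (hl : ∀ v, (p.encode v).length ≤ l) (r : ℕ) (i : Fin n) :
    ∑ k ∈ Finset.range r, sentBits A m ω κ {hostKey _ P Q} k i ≤ 6 * n * (κ + (2 + l)) := by
  induction r with
  | zero => simp
  | succ r ih =>
    rw [Finset.sum_range_succ]
    by_cases hi : i ∈ (during A m ω r).corrupt
    · rw [sentBits, if_pos hi, add_zero]
      exact ih
    obtain hr | hr := lt_or_ge r A.start
    · rw [sentBits_of_lt_start hr, add_zero]
      exact ih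
    obtain ⟨k, rfl⟩ := Nat.exists_eq_add_of_le hr
    have hi' : i ∉ (conf A m ω (A.start + k + 1)).corrupt := hi
    obtain ⟨h1, h2⟩ := sentBits_host_le (κ := κ) hl hi' (A := A) (m := m) (ω := ω) (k := k) (by omega)
    by_cases hd : ((rounds p A m ω).st k i).decision = none
    · have h1 := h1 hd
      have h3 := sum_sentBits_host_add_le (κ := κ) hl hi' (by omega) (k := k) (by omega)
      have h4 := Nat.mul_le_mul_left (n * (κ + (2 + l)))
        (Params.issued_length_le (p := p) (i := i) (s := (rounds p A m ω).st k i))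
      have h5 : n * (κ + (2 + l)) * 6 = 6 * n * (κ + (2 + l)) := by ring
      omega
    · rw [h2 hd, add_zero]
      exact ih

theorem bits_host_le {κ l : ℕ} (hl : ∀ v, (p.encode v).length ≤ l) :
    bits κ A m {hostKey _ P Q} ω ≤ 6 * (κ + (2 + l)) * n ^ 2 := by
  rw [bits_eq_sum]
  refine (Finset.sum_le_card_nsmul _ _ _ fun i _ => sum_sentBits_host_le hl H i).trans ?_
  rw [Finset.card_univ, Fintype.card_fin, smul_eq_mul]
  exact le_of_eq (by ring)

/-- Every party still honest at `fallback` has decided by then, and its frozen clock never reaches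
the time at which the sabotaged protocol is started. -/
theorem bits_sab_eq_zero {A : Adversary (compile p.juggernaut P Q)}
    {ω : Randomness (compile p.juggernaut P Q) H} {q : Corruption} {κ : ℕ}
    (hA : Admissible A .authenticated q p.ts H) (hω : ¬ AuthFails q A ω) (hn : 2 * p.ti + p.ts < n)
    (hts : 2 * p.ts < n) : bits κ A .authenticated (sabPart _ P Q) ω = 0 := by
  rw [bits_eq_sum]
  refine Finset.sum_eq_zero fun i _ => Finset.sum_eq_zero fun r hr => ?_
  have hr : r < H := by simpa using hr
  obtain hrs | hrs := lt_or_ge r A.start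
  · exact sentBits_of_lt_start hrs
  obtain ⟨k, rfl⟩ := Nat.exists_eq_add_of_le hrs
  unfold sentBits
  split_ifs with hi
  · rfl
  have hi' : i ∉ (conf A .authenticated ω (A.start + k + 1)).corrupt := hi
  obtain ⟨y, h1, h2, -⟩ := exists_state p A .authenticated ω (k := k) hi' (by omega) (by omega)
  -- Party `i` may be corrupted later, so the agreement of candidates is applied to the parties
  -- honest up to round `fallback`, not to those honest at the end.
  have hclock : JugState.clock y.host < p.fallback := by
    by_contra hc
    have hk := h2.clock_le
    have hf : p.fallback = p.deadline + 4 := rfl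
    have hmin : min H (A.start + p.deadline) ≤ A.start + p.fallback := by omega
    obtain ⟨v, hcand, -⟩ := exists_candidates_of_not_authFails hA hω hn hts
      (r := A.start + p.fallback) (by omega) (by omega) hmin
    have hi1 : i ∉ (conf A .authenticated ω (A.start + p.fallback)).corrupt := fun h =>
      hi' (conf_corrupt_mono A _ ω (by omega) h)
    have hF := follows (p := p) (A := A) (m := .authenticated) (ω := ω)
      (R := A.start + p.fallback) (by omega)
    have hcard : (conf A .authenticated ω (A.start + p.fallback)).corruptᶜᶜ.card ≤ p.ts := by
      rw [compl_compl]
      exact (Finset.card_le_card (conf_corrupt_mono A _ ω (by omega))).trans (hA ω).1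
    have h3 := hF.decision_of_candidates (sound (by omega)) hcand hcard hts le_rfl (by omega)
      (fun j hj => hF.cand_isSome hj le_rfl (by omega)) (Finset.mem_compl.mpr hi1)
    have hF' := follows (p := p) (A := A) (m := .authenticated) (ω := ω)
      (R := A.start + k + 1) (by omega)
    have h4 : (rounds p A .authenticated ω).st k i =
        (rounds p A .authenticated ω).st p.fallback i :=
      hF'.stay_of_le (Finset.mem_compl.mpr hi') (by omega) (by omega)
        (by rw [hf, h3]; simp)
    obtain ⟨y', h5, h6, -⟩ := exists_state p A .authenticated ω (k := p.fallback) hi' (by omega)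
      (by omega)
    have h7 : (y'.host : JugState n V).decision ≠ none := by
      rw [← rounds_st h5, hf, h3]; simp
    have h8 := h6.clock_lt h7
    rw [← rounds_st h5, ← h4, rounds_st h1] at h8
    exact hc h8
  refine Finset.sum_eq_zero fun j _ => Finset.sum_eq_zero fun a _ => ?_
  split_ifs with ha
  · rw [msgsAt_of_notMem _ _ _ hi, h1]
    have h3 : (instOf y).send i (ω.coin (A.start + k) i) j a = Wire.silent n := by
      obtain ⟨b, rfl⟩ := ha
      unfold Inst.send
      split
      · rename_i s hs _
        obtain rfl : y = s := Option.some.inj hs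
        change y.sab.send i _ j b = _
        unfold Slot.send
        rw [h2.sab.idle hclock, Inst.send_idle]
        split_ifs <;> rfl
      · rfl
    rw [h3]
    exact Wire.size_eq_zero rfl rfl
  · rfl

theorem bits_univ_le {A : Adversary (compile p.juggernaut P Q)}
    {ω : Randomness (compile p.juggernaut P Q) H} {q : Corruption} {κ B : ℕ}
    (hA : Admissible A .authenticated q p.ts H) (hω : ¬ AuthFails q A ω) (hn : 2 * p.ti + p.ts < n)
    (hts : 2 * p.ts < n) (hB : bits κ A .authenticated {hostKey _ P Q} ω ≤ B) :
    bits κ A .authenticated Set.univ ω ≤ bits κ A .authenticated (authPart _ P Q) ω + B := by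
  rw [bits_univ, bits_sab_eq_zero hA hω hn hts]
  omega

end Host

end

section

variable {n : ℕ}

/-! ### The compiler has the required properties -/

theorem exists_encoding (V : Type) [Fintype V] {l : ℕ} (h : Fintype.card V ≤ 2 ^ l) :
    ∃ f : V → List Bool, Function.Injective f ∧ ∀ v, (f v).length ≤ l := by
  obtain ⟨g⟩ := Function.Embedding.nonempty_of_card_le (α := V) (β := Fin l → Bool) (by simpa)
  exact ⟨fun v => List.ofFn (g v), fun v w hvw => g.injective (List.ofFn_injective hvw),
    fun v => by simp⟩

theorem Negligible.of_eventuallyEq {f g : ℕ → ℝ} (hg : Negligible g)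
    (h : ∀ᶠ κ in Filter.atTop, g κ = f κ) : Negligible f :=
  Asymptotics.SuperpolynomialDecay.congr' hg h

/-- A polynomially bounded cost, incurred with negligible probability, vanishes in the limit. -/
theorem Negligible.tendsto_mul {f g : ℕ → ℝ} (hf : Negligible f) {d : ℕ}
    (hg : g =O[Filter.atTop] fun κ : ℕ => (κ : ℝ) ^ d) :
    Filter.Tendsto (fun κ => g κ * f κ) Filter.atTop (nhds 0) :=
  (hg.mul (Asymptotics.isBigO_refl f _)).trans_tendsto (hf d)

theorem prob_mul_eq_expect {Ω : Type} [Fintype Ω] (E : Ω → Prop) [DecidablePred E] (M : ℝ) :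
    M * prob E = 𝔼 ω : Ω, if E ω then M else 0 := by
  rw [prob, Finset.mul_expect]
  refine Finset.expect_congr rfl fun ω _ => ?_
  by_cases h : E ω <;> simp [h]

section Expectation

variable {V : Type} {p : Params n V} {P Q : Protocol n V}
  {A : Adversary (compile p.juggernaut P Q)} {H : ℕ}

instance : Nonempty (Randomness (compile p.juggernaut P Q) H) :=
  inferInstanceAs (Nonempty ((compile p.juggernaut P Q).Setup ×
    (Fin n → Fin H → (compile p.juggernaut P Q).Coin)))

theorem expectedBits_univ_le {m : Setting} {κ B : ℕ}
    (hB : ∀ ω : Randomness (compile p.juggernaut P Q) H, bits κ A m {hostKey _ P Q} ω ≤ B) :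
    expectedBits κ A m H Set.univ ≤ expectedBits κ A m H (authPart _ P Q) +
      expectedBits κ A m H (sabPart _ P Q) + B := by
  have h1 : (B : ℝ) = 𝔼 _ω : Randomness (compile p.juggernaut P Q) H, (B : ℝ) :=
    (Finset.expect_const Finset.univ_nonempty _).symm
  rw [expectedBits, expectedBits, expectedBits, h1, ← Finset.expect_add_distrib,
    ← Finset.expect_add_distrib]
  refine Finset.expect_le_expect fun ω _ => ?_
  have h2 := hB ω
  rw [bits_univ]
  exact_mod_cast (by omega)

/-- The sabotaged protocol costs something only on the event `E`, and then at most `M`. -/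
theorem expectedBits_sab_le {m : Setting} {κ M : ℕ}
    {E : Randomness (compile p.juggernaut P Q) H → Prop}
    (h0 : ∀ ω, ¬ E ω → bits κ A m (sabPart _ P Q) ω = 0)
    (hM : ∀ ω : Randomness (compile p.juggernaut P Q) H, bits κ A m (sabPart _ P Q) ω ≤ M) :
    expectedBits κ A m H (sabPart _ P Q) ≤ M * prob E := by
  classical
  rw [prob_mul_eq_expect, expectedBits]
  refine Finset.expect_le_expect fun ω _ => ?_
  split_ifs with h
  · exact_mod_cast hM ω
  · exact_mod_cast (h0 ω h).le

end Expectation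

end

end CryptoAgnostic

/-! ### The main theorem -/

open CryptoAgnostic

theorem theorem1 (c : ℕ) : ∃ C : ℕ, ∀ (n ts ti : ℕ), 2 * ti + ts < n → ti ≤ ts → 2 * ts < n →
    ∀ (V : ℕ → Type) [∀ κ, Fintype (V κ)] [∀ κ, Nontrivial (V κ)],
    (∀ κ, 1 ≤ κ → Fintype.card (V κ) ≤ 2 ^ (c * κ)) →
    ∀ (TAuth TSab : ℕ → ℕ), ∃ J : ∀ κ, Host n (V κ),
    ∀ (BAuth BSab : ∀ κ, Protocol n (V κ)) (q : Corruption),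
    BlackBox .authenticated q ts BAuth TAuth → BlackBox .sabotaged q ti BSab TSab →
      -- security in both settings
      SecureBy .authenticated q ts (fun κ => compile (J κ) (BAuth κ) (BSab κ))
        (fun κ => TAuth κ + TSab κ + C) ∧
      SecureBy .sabotaged q ti (fun κ => compile (J κ) (BAuth κ) (BSab κ))
        (fun κ => TAuth κ + TSab κ + C) ∧
      -- communication in the sabotaged setting
      (∀ (κ : ℕ) (A : Adversary (compile (J κ) (BAuth κ) (BSab κ))) (H : ℕ), 1 ≤ κ →
        Admissible A .sabotaged q ti H →
        expectedBits κ A .sabotaged H Set.univ ≤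
          expectedBits κ A .sabotaged H (authPart (J κ) (BAuth κ) (BSab κ)) +
          expectedBits κ A .sabotaged H (sabPart (J κ) (BAuth κ) (BSab κ)) + C * κ * n ^ 2) ∧
      -- communication in the authenticated setting
      (∀ (A : ∀ κ, Adversary (compile (J κ) (BAuth κ) (BSab κ))) (H : ℕ → ℕ),
        (∀ κ, Admissible (A κ) .authenticated q ts (H κ)) →
        Negligible (fun κ => prob fun ω : Randomness (compile (J κ) (BAuth κ) (BSab κ)) (H κ) =>
          bits κ (A κ) .authenticated (authPart (J κ) (BAuth κ) (BSab κ)) ω + C * κ * n ^ 2 <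
            bits κ (A κ) .authenticated Set.univ ω) ∧
        ∀ (M : ℕ → ℕ) (d : ℕ), (fun κ => (M κ : ℝ)) =O[Filter.atTop] (fun κ => (κ : ℝ) ^ d) →
          (∀ (κ : ℕ) (ω : Randomness (compile (J κ) (BAuth κ) (BSab κ)) (H κ)),
            bits κ (A κ) .authenticated (sabPart (J κ) (BAuth κ) (BSab κ)) ω ≤ M κ) →
          ∀ᶠ κ in Filter.atTop, expectedBits κ (A κ) .authenticated (H κ) Set.univ ≤
            expectedBits κ (A κ) .authenticated (H κ) (authPart (J κ) (BAuth κ) (BSab κ)) +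
              C * κ * n ^ 2) ∧
      -- the authenticated protocol is started in one common round, O(1) rounds after the start
      (∃ τ ≤ C, ∀ (κ : ℕ) (A : Adversary (compile (J κ) (BAuth κ) (BSab κ))) (m : Setting) (H : ℕ)
        (ω : Randomness (compile (J κ) (BAuth κ) (BSab κ)) H) (r : ℕ), r < H →
        ∀ i ∉ (during A m ω r).corrupt, AuthStarted (during A m ω r) i ↔ A.start + τ ≤ r) ∧
      -- termination O(1) rounds after the authenticated protocol in the authenticated setting
      (∀ (A : ∀ κ, Adversary (compile (J κ) (BAuth κ) (BSab κ))) (H : ℕ → ℕ),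
        (∀ κ, Admissible (A κ) .authenticated q ts (H κ)) →
        Negligible fun κ => prob fun ω : Randomness (compile (J κ) (BAuth κ) (BSab κ)) (H κ) =>
          ∃ r, r < H κ ∧ r + C ≤ H κ ∧
            ((∀ i ∉ (during (A κ) .authenticated ω r).corrupt,
                AuthDone (during (A κ) .authenticated ω r) i) ∨
              ∃ i ∉ (during (A κ) .authenticated ω r).corrupt,
                AuthAbandoned (during (A κ) .authenticated ω r) i) ∧
            ∃ j ∉ (conf (A κ) .authenticated ω (H κ)).corrupt,
              ¬ ((conf (A κ) .authenticated ω (r + C)).loc j).status.Done) := by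
  classical
  -- Six tokens of at most `κ + 2 + c * κ` bits for each pair of parties make at most `(6 * c + 18)
  -- * κ * n ^ 2` bits if `κ ≥ 1`. The rest of the constant leaves room for the additive round
  -- constants and for a spare `κ * n ^ 2`.
  refine ⟨6 * c + 40, fun n ts ti hn hle hts V _ _ hV TAuth TSab => ?_⟩
  choose f hf hl using fun κ => exists_encoding (V κ)
    -- For `κ = 0` nothing is assumed on the size of values, so any sufficient length is taken.
    (l := if κ = 0 then Fintype.card (V κ) else c * κ) (by
      split_ifs with h
      · exact Nat.lt_two_pow_self.le
      · exact hV κ (Nat.one_le_iff_ne_zero.mpr h))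
  let p : ∀ κ, Params n (V κ) := fun κ =>
    { ts := ts, ti := ti, authRounds := TAuth κ, sabRounds := TSab κ, encode := f κ,
      encode_injective := hf κ, default := Classical.arbitrary (V κ) }
  have hfin : ∀ κ, (p κ).finish ≤ TAuth κ + TSab κ + (6 * c + 40) := fun κ => by
    simp only [p, Params.finish, Params.fallback, Params.deadline]
    omega
  -- The spare `κ * n ^ 2` will absorb the expected cost of the sabotaged protocol in the
  -- authenticated setting.
  have hhost : ∀ (P Q : ∀ κ, Protocol n (V κ)) (κ : ℕ)
      (A : Adversary (compile (p κ).juggernaut (P κ) (Q κ))) (m : Setting) (H : ℕ)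
      (ω : Randomness (compile (p κ).juggernaut (P κ) (Q κ)) H), 1 ≤ κ →
      bits κ A m {hostKey _ (P κ) (Q κ)} ω + κ * n ^ 2 ≤ (6 * c + 40) * κ * n ^ 2 := by
    intro P Q κ A m H ω hκ
    have h1 := bits_host_le (p := p κ) (A := A) (m := m) (ω := ω) (κ := κ) (l := c * κ) fun v => by
      have := hl κ v
      rwa [if_neg (by omega)] at this
    have h2 : 6 * (κ + (2 + c * κ)) + κ ≤ (6 * c + 40) * κ := by
      have h3 : (6 * c + 40) * κ = 6 * (c * κ) + 40 * κ := by ring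
      omega
    calc _ ≤ 6 * (κ + (2 + c * κ)) * n ^ 2 + κ * n ^ 2 := Nat.add_le_add_right h1 _
      _ = (6 * (κ + (2 + c * κ)) + κ) * n ^ 2 := by ring
      _ ≤ _ := Nat.mul_le_mul_right _ h2
  refine ⟨fun κ => (p κ).juggernaut, fun BAuth BSab q hAuth hSab => ⟨?_, ?_, ?_, ?_, ?_, ?_⟩⟩
  · exact secureBy_of_agree hfin fun A H hA => ⟨_, negligible_authFails (p := p) (fun _ => rfl) hAuth
      A H hA, fun κ ω hω hH => agree_of_not_authFails (hA κ) hω hn hts hH⟩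
  · exact secureBy_of_agree hfin fun A H hA => ⟨_, negligible_sabFails (p := p) (fun _ => rfl) hSab
      A H hA, fun κ ω hω hH => agree_of_not_sabFails (hA κ) hω hn hH⟩
  · intro κ A H hκ _
    have h1 := expectedBits_univ_le (A := A) (m := .sabotaged) (H := H) (κ := κ)
      (B := (6 * c + 40) * κ * n ^ 2) fun ω =>
        (Nat.le_add_right _ _).trans (hhost BAuth BSab κ A _ H ω hκ)
    exact_mod_cast h1
  · intro A H hA
    have hneg := negligible_authFails (p := p) (fun _ => rfl) hAuth A H hA
    refine ⟨?_, fun M d hM hbits => ?_⟩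
    -- The bound on the host is available only for `κ ≥ 1`; negligibility does not see the value at
    -- 0.
    · refine Negligible.of_eventuallyEq (g := fun κ => if κ = 0 then 0 else prob fun ω :
        Randomness (compile (p κ).juggernaut (BAuth κ) (BSab κ)) (H κ) =>
          bits κ (A κ) .authenticated (authPart (p κ).juggernaut (BAuth κ) (BSab κ)) ω +
            (6 * c + 40) * κ * n ^ 2 < bits κ (A κ) .authenticated Set.univ ω) ?_ ?_
      · refine hneg.mono (fun κ => ?_) fun κ => ?_
        · split_ifs
          · exact le_rfl
          · exact prob_nonneg _
        · split_ifs with hκ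
          · exact prob_nonneg _
          · refine prob_mono fun ω h => ?_
            by_contra hω
            exact absurd h (not_lt.mpr (bits_univ_le (hA κ) hω hn hts ((Nat.le_add_right _ _).trans
              (hhost BAuth BSab κ (A κ) .authenticated (H κ) ω (by omega)))))
      · filter_upwards [Filter.eventually_ne_atTop 0] with κ hκ
        rw [if_neg hκ]
    · have hlim := hneg.tendsto_mul hM
      -- Eventually the expected cost of the sabotaged protocol is at most one bit, which is at most
      -- the spare `κ * n ^ 2`.
      filter_upwards [hlim.eventually_le_const one_pos, Filter.eventually_ge_atTop 1] with κ h1 hκ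
      have hB : (6 * c + 40) * κ * n ^ 2 - κ * n ^ 2 + κ * n ^ 2 = (6 * c + 40) * κ * n ^ 2 :=
        Nat.sub_add_cancel ((Nat.le_add_left _ _).trans
          (hhost BAuth BSab κ (A κ) .authenticated (H κ) (Classical.arbitrary _) hκ))
      have h2 := expectedBits_univ_le (A := A κ) (m := .authenticated) (H := H κ) (κ := κ)
        (B := (6 * c + 40) * κ * n ^ 2 - κ * n ^ 2) fun ω =>
          Nat.le_sub_of_add_le (hhost BAuth BSab κ (A κ) _ (H κ) ω hκ)
      have h3 := expectedBits_sab_le (A := A κ) (m := .authenticated) (H := H κ) (κ := κ) (M := M κ)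
        (E := AuthFails q (A κ)) (fun ω hω => bits_sab_eq_zero (hA κ) hω hn hts) (hbits κ)
      have h4 : (1 : ℝ) ≤ (κ * n ^ 2 : ℕ) := by
        have : 0 < κ * n ^ 2 := Nat.mul_pos hκ (pow_pos (by omega) 2)
        exact_mod_cast this
      have h5 : (((6 * c + 40) * κ * n ^ 2 - κ * n ^ 2 : ℕ) : ℝ) + (κ * n ^ 2 : ℕ) =
          ((6 * c + 40 : ℕ) : ℝ) * κ * n ^ 2 := by
        rw [← Nat.cast_add, hB]
        push_cast
        ring
      linarith
  · exact ⟨2, by omega, fun κ A m H ω r _ i hi => authStarted_iff hi⟩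
  · intro A H hA
    refine negligible_prob_mono (negligible_authFails (p := p) (fun _ => rfl) hAuth A H hA)
      fun κ ω => ?_
    rintro ⟨r, -, h1, h2, j, hj, h3⟩
    by_contra hω
    exact h3 (done_of_authDone (hA κ) hω hn hts (by omega) h1 h2 hj)
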